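/- Let $\mathcal A$ be a non-empty finite alphabet and let $\theta$ be a substitution of constant length $\ell\ge 2$ on $\mathcal A$, $\theta(a)=\theta_0(a)\theta_1(a)\cdots\theta_{\ell-1}(a)$ with column maps $\theta_i:\mathcal A\to\mathcal A$; write $(\theta^n)_i$, $0\le i<\ell^n$, for the column maps of $\theta^n$. Let $X_\theta\subset\mathcal A^{\mathbb Z}$ be the substitution shift, $\sigma$ the left shift, $E=E(X_\theta)$ the Ellis semigroup (the closure of $\{\sigma^n:n\in\mathbb Z\}$ in $X_\theta^{X_\theta}$ for pointwise convergence) and $\mathcal M(X_\theta)$ its kernel, i.e. its smallest two-sided ideal. Assume that $\theta$ is primitive, aperiodic ($X_\theta$ contains no $\sigma$-periodic point), quasi-bijective (for some $n\geq 1$ all $(\theta^n)_i$ have rank $c$, where the column rank $c$ is the minimum of $|(\theta^n)_j(\mathcal A)|$ over all $n$ and $0\le j<\ell^n$) and simplified (every $\theta_i$ has rank $c$, and every $\theta$-periodic point of $X_\theta$ is $\theta$-fixed). Let $\mathrm{Fix}(\theta)\subset X_\theta$ be the set of $\theta$-fixed points. Let $e\in E$ be a minimal idempotent. Let $\mathcal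 G^{fib}$ be the group of those elements of $eEe$ that preserve the fibres of the maximal equicontinuous factor, and let $\Gamma$ be the little structure group, generated by the products $qp$, where $q$ runs over the idempotents of $eE$ and $p$ over those of $Ee$. Let $\mathcal G^{fib}_0$ and $\Gamma_0$ be their restrictions to $e\,\mathrm{Fix}(\theta)$, and suppose that the normal closure of $\Gamma_0$ in $\mathcal G^{fib}_0$ is the group of all permutations of $e\,\mathrm{Fix}(\theta)$. Then the following hold. 1. $E(X_\theta)=\mathcal M(X_\theta)\sqcup\{\sigma^n:n\in\mathbb Z\}$ (disjoint union), and $n\mapsto\sigma^n$ is injective, so that $E(X_\theta)=\mathcal M(X_\theta)\sqcup\mathbb Z$. 2. There are an integer $h$ coprime to $\ell$ with $0<h<\ell$ and a maximal equicontinuous factor map $\pi:(X_\theta,\sigma)\to(\mathbb Z_{\bar\ell,h},+1)$, $\mathbb Z_{\bar\ell,h}=\varprojlim\mathbb Z/\ell^nh\mathbb Z$, with $\pi^{-1}(0)=\mathrm{Fix}(\theta)$, such that (a)--(d) hold. Write $\mathfrak a$ for the group of automorphisms of $(X_\theta,\sigma)$, $\alpha_{eq}$ for the map which $\alpha\in\mathfrak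 a$ induces on $\mathbb Z_{\bar\ell,h}$, and $\mathfrak a_{eq}(0)=\{\alpha_{eq}(0):\alpha\in\mathfrak a\}$. (a) $\mathfrak a_{eq}(0)$ is the set of singular points of $\mathbb Z_{\bar\ell,h}$, i.e. of those points whose fibre contains two distinct proximal points. (b) Let $\mathcal G$ be the set of all functions $g$ on $\mathbb Z_{\bar\ell,h}$ for which there is a $\xi\in\mathbb Z_{\bar\ell,h}$ such that each $g(\eta)$ is a bijection $e\pi^{-1}(\eta)\to e\pi^{-1}(\eta+\xi)$, and which are covariant: $\alpha\, g(\eta)\,\alpha^{-1}=g(\alpha_{eq}(\eta))$ for all $\alpha\in\mathfrak a$ and all $\eta$. With the product $(gg')(\eta)=g(\eta+\xi')\,g'(\eta)$, where $\xi'$ belongs to $g'$, $\mathcal G$ is isomorphic to the structure group $eEe$ of $\mathcal M(X_\theta)$: an element of $eEe$ corresponds to the family of its restrictions to the sets $e\pi^{-1}(\eta)$. (c) Let $S_\theta$ be the semigroup generated by all $(\theta^n)_i$, $n\geq1$, let $e_+=\theta_0$, $e_-=\theta_{\ell-1}$ (idempotents), $\mathcal H_+=e_+S_\theta e_+$ (a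 group with identity $e_+$), $\mathcal H_{-+}=e_-S_\theta e_+$ and $\mathcal H_{+-}=e_+S_\theta e_-$. Let $S^{(2)}_\theta$ be the set of pairs $(L,R)\in\mathcal H_{-+}\times\mathcal H_+$ with $L=(\theta^n)_{i-1}$, $R=(\theta^n)_i$ for some $n>0$, $0<i<\ell^n$, and let $I_\theta=\{LR^{-1}:(L,R)\in S^{(2)}_\theta\}$, the inverse being taken in $\mathcal H_+$. For every $\phi\in\mathcal H_{+-}$ let $A_\phi$ be the $\{\pm\}\times I_\theta$ matrix with $a_{+,\mathfrak i}=e_+$ and $a_{-,\mathfrak i}=\phi\,\mathfrak i$ in $\mathcal H_+$. Then there is a matrix $\tilde A_\phi=(\tilde a_{\lambda,\mathfrak i})$ with entries in $\mathcal G$ and $\xi=0$, which equals $A_\phi$ on $\mathfrak a_{eq}(0)$ (that is, $\tilde a_{\lambda,\mathfrak i}(0)$ acts on $e\pi^{-1}(0)$ as $a_{\lambda,\mathfrak i}$ on the letter at position $0$, and its values on $\mathfrak a_{eq}(0)$ are determined by covariance) and is the identity at all other points, and there is an isomorphism of semigroups from the matrix semigroup $M(I_\theta,\mathcal G,\{\pm\};\tilde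 A_\phi)$ onto $\mathcal M(X_\theta)$. Here $M(I,G,\Lambda;A)$ is $I\times G\times\Lambda$ with the product $(i,g,\lambda)(j,g',\mu)=(i,g\,a_{\lambda,j}\,g',\mu)$. (d) Under this isomorphism the product (on either side) of an element $(\mathfrak i,g,\lambda)$ with $\sigma^n$, $n\in\mathbb Z$, is $(\mathfrak i,\sigma^ng,\lambda)$, where $\sigma^n\in\mathcal G$ is the function whose value at $\eta$ is the restriction of $\sigma^n$ to $e\pi^{-1}(\eta)$. -/

import Mathlib

universe u

namespace EllisQB

/-! ### Substitutions of constant length -/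

/-- A substitution of constant length `ℓ` on the alphabet `A`, given by its column maps:
`θ(a) = θ_0(a) θ_1(a) ⋯ θ_{ℓ-1}(a)`. -/
structure Subst (A : Type u) (ℓ : ℕ) where
  col : Fin ℓ → A → A

namespace Subst

variable {A : Type u} {ℓ : ℕ} [NeZero ℓ]

/-- `θ.colPow n i` is the `i`-th column map of `θ^n` (meaningful for `i < ℓ ^ n`): the letter of
`θ^(n+1)(a) = θ(θ^n(a))` at position `i` is the letter number `i % ℓ` of the image under `θ` of
the letter of `θ^n(a)` at position `i / ℓ`. -/
def colPow (θ : Subst A ℓ) : ℕ → ℕ → A → A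
  | 0, _ => id
  | n + 1, i => θ.col (Fin.ofNat ℓ i) ∘ colPow θ n (i / ℓ)

/-- The action of `θ` on bi-infinite sequences; `θ(u_0)` starts at position `0`. -/
def act (θ : Subst A ℓ) (u : ℤ → A) : ℤ → A :=
  fun k => θ.col (Fin.ofNat ℓ (k % (ℓ : ℤ)).toNat) (u (k / (ℓ : ℤ)))

/-- The word `w 0, …, w (n-1)` is allowed: it occurs in some `θ^m(a)`. -/
def Allowed (θ : Subst A ℓ) (n : ℕ) (w : ℕ → A) : Prop :=
  ∃ (a : A) (m j : ℕ), j + n ≤ ℓ ^ m ∧ ∀ t < n, w t = θ.colPow m (j + t) a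

/-- The set of bi-infinite sequences all of whose finite subwords are allowed. -/
def shiftSet (θ : Subst A ℓ) : Set (ℤ → A) :=
  {u | ∀ (k : ℤ) (n : ℕ), θ.Allowed n (fun t => u (k + t))}

/-- The substitution shift `X_θ`, with the subspace topology of the product topology. -/
abbrev X (θ : Subst A ℓ) : Type u := ↥θ.shiftSet

/-- The `ℤ`-action on `X_θ`: `θ.shift n` is the `n`-th power of the left shift. -/
def shift (θ : Subst A ℓ) (n : ℤ) (x : θ.X) : θ.X :=
  ⟨fun k => x.1 (k + n), fun k m => by
    have h := x.2 (k + n) m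
    have e : (fun t : ℕ => x.1 (k + n + t)) = fun t : ℕ => x.1 (k + t + n) := by
      funext t
      rw [add_right_comm]
    rwa [e] at h⟩

def IsPrimitive (θ : Subst A ℓ) : Prop :=
  ∃ k : ℕ, 0 < k ∧ ∀ a a' : A, ∃ i < ℓ ^ k, θ.colPow k i a = a'

/-- `X_θ` contains no shift-periodic sequence. -/
def IsAperiodic (θ : Subst A ℓ) : Prop :=
  ∀ (x : θ.X) (n : ℤ), n ≠ 0 → θ.shift n x ≠ x

/-- The rank (number of letters in the image) of a self-map of the alphabet. -/
noncomputable def rank (f : A → A) : ℕ := (Set.range f).ncard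

/-- The column rank: the least rank of a column map of a power of `θ`. -/
noncomputable def columnRank (θ : Subst A ℓ) : ℕ :=
  sInf {r | ∃ n j : ℕ, j < ℓ ^ n ∧ r = rank (θ.colPow n j)}

def IsQuasiBijective (θ : Subst A ℓ) : Prop :=
  ∃ n : ℕ, 0 < n ∧ ∀ i < ℓ ^ n, rank (θ.colPow n i) = θ.columnRank

/-- Simplified: each column map has rank the column rank, and each `θ`-periodic point of `X_θ` is
fixed by `θ`. -/
structure IsSimplified (θ : Subst A ℓ) : Prop where
  rank_col : ∀ i : Fin ℓ, rank (θ.col i) = θ.columnRank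
  periodic_fixed : ∀ x ∈ θ.shiftSet, ∀ n : ℕ, 0 < n → θ.act^[n] x = x → θ.act x = x

/-- The set of `θ`-fixed points of `X_θ`. -/
def fixedPts (θ : Subst A ℓ) : Set θ.X := {x | θ.act x.1 = x.1}

/-! ### The semigroup of the substitution and the data of the matrix semigroup -/

/-- The semigroup `S_θ` (under composition) generated by the column maps of all `θ^n`, `n ≥ 1`. -/
inductive Sgp (θ : Subst A ℓ) : (A → A) → Prop
  | col (n i : ℕ) (hn : 0 < n) (hi : i < ℓ ^ n) : Sgp θ (θ.colPow n i)
  | comp (f g : A → A) (hf : Sgp θ f) (hg : Sgp θ g) : Sgp θ (f ∘ g)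

/-- `e₊ = θ_0`. -/
def ePlus (θ : Subst A ℓ) : A → A := θ.col (Fin.ofNat ℓ 0)

/-- `e₋ = θ_{ℓ-1}`. -/
def eMinus (θ : Subst A ℓ) : A → A := θ.col (Fin.ofNat ℓ (ℓ - 1))

/-- `θ.H p q = p S_θ q`. So `H e₊ e₊` is `ℋ₊` (which is the structure group `G_θ`), `H e₋ e₊` is
`ℋ₋₊` and `H e₊ e₋` is `ℋ₊₋`. -/
def H (θ : Subst A ℓ) (p q : A → A) : Set (A → A) := {s | ∃ t, θ.Sgp t ∧ s = p ∘ t ∘ q}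

/-- The set `S_θ^{(2)}` of consecutive elements `(L, R)` in `ℋ₋₊ × ℋ₊`. -/
def S2 (θ : Subst A ℓ) : Set ((A → A) × (A → A)) :=
  {p | (∃ n i : ℕ, 0 < n ∧ 0 < i ∧ i < ℓ ^ n ∧ p.1 = θ.colPow n (i - 1) ∧ p.2 = θ.colPow n i) ∧
    p.1 ∈ θ.H θ.eMinus θ.ePlus ∧ p.2 ∈ θ.H θ.ePlus θ.ePlus}

/-- `I_θ = {L R⁻¹ : (L, R) ∈ S_θ^{(2)}}`, where `R⁻¹` is the inverse of `R` in the group `ℋ₊` with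
identity `e₊`. -/
def I (θ : Subst A ℓ) : Set (A → A) :=
  {i | ∃ L R R' : A → A, (L, R) ∈ θ.S2 ∧ R' ∈ θ.H θ.ePlus θ.ePlus ∧
    R ∘ R' = θ.ePlus ∧ R' ∘ R = θ.ePlus ∧ i = L ∘ R'}

end Subst

/-- The index set `{+, -}`. -/
inductive Side
  | plus
  | minus

variable {A : Type u} {ℓ : ℕ} [NeZero ℓ]

/-- The `{±} × I_θ` matrix `A_φ`: `a_{+ i} = e₊`, `a_{- i} = φ i`. -/
def Subst.matA (θ : Subst A ℓ) (φ : A → A) : Side → θ.I → (A → A)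
  | Side.plus, _ => θ.ePlus
  | Side.minus, i => φ ∘ i.1

/-! ### Matrix semigroups -/

/-- The underlying set of the matrix semigroup `M(I, G, Λ; M)`. -/
@[ext]
structure Rees {I G Λ : Type*} (M : Λ → I → G) where
  i : I
  g : G
  l : Λ

instance {I G Λ : Type*} [Mul G] (M : Λ → I → G) : Mul (Rees M) :=
  ⟨fun x y => ⟨x.i, x.g * M x.l y.i * y.g, y.l⟩⟩

/-! ### The odometer `ℤ_{ℓ̄,h}` -/

/-- The inverse limit of the groups `ℤ / ℓ^n h ℤ`. -/
def odometerSubgroup (ℓ h : ℕ) : AddSubgroup (∀ n : ℕ, ZMod (ℓ ^ n * h)) where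
  carrier := {z | ∀ n : ℕ,
    ZMod.castHom (mul_dvd_mul_right (pow_dvd_pow ℓ n.le_succ) h) (ZMod (ℓ ^ n * h)) (z (n + 1))
      = z n}
  add_mem' := fun {a b} ha hb n => by
    simp only [Pi.add_apply, map_add]
    rw [ha n, hb n]
  zero_mem' := fun n => by simp only [Pi.zero_apply, map_zero]
  neg_mem' := fun {a} ha n => by
    simp only [Pi.neg_apply, map_neg]
    rw [ha n]

def Odometer (ℓ h : ℕ) : Type := ↥(odometerSubgroup ℓ h)

instance (ℓ h : ℕ) : AddCommGroup (Odometer ℓ h) :=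
  inferInstanceAs (AddCommGroup ↥(odometerSubgroup ℓ h))

/-- The inverse limit uniformity (and topology), each finite cyclic group being discrete. -/
instance (ℓ h : ℕ) : UniformSpace (Odometer ℓ h) :=
  UniformSpace.comap (fun z : ↥(odometerSubgroup ℓ h) => z.1)
    (@Pi.uniformSpace ℕ (fun n => ZMod (ℓ ^ n * h)) (fun _ => ⊥))

/-- The image of `1 ∈ ℤ` in the odometer. -/
def Odometer.one (ℓ h : ℕ) : Odometer ℓ h :=
  (⟨fun _ => 1, fun n => by simp only [map_one]⟩ : ↥(odometerSubgroup ℓ h))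

/-- The `ℤ`-action generated by the addition of `1`. -/
def Odometer.act (ℓ h : ℕ) (n : ℤ) (z : Odometer ℓ h) : Odometer ℓ h :=
  z + n • Odometer.one ℓ h

namespace Subst

/-! ### Topological dynamics of `X_θ` -/

variable [TopologicalSpace A]

/-- `q` is a factor map from `X_θ` onto the equicontinuous system `(Y, S)`. (As `q` is onto and
equivariant, `S` is an action of `ℤ`.) -/
structure IsEquicontinuousFactor (θ : Subst A ℓ) {Y : Type*} [UniformSpace Y] (S : ℤ → Y → Y)
    (q : θ.X → Y) : Prop where
  continuous : Continuous q
  surjective : Function.Surjective q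
  equivariant : ∀ n x, q (θ.shift n x) = S n (q x)
  equicontinuous : Equicontinuous S

/-- `π` is a maximal equicontinuous factor map: every equicontinuous factor of `X_θ` factors
through it. -/
structure IsMEF (θ : Subst A ℓ) {Z : Type*} [UniformSpace Z] (S : ℤ → Z → Z)
    (π : θ.X → Z) : Prop where
  factor : θ.IsEquicontinuousFactor S π
  maximal : ∀ (Y : Type u) [UniformSpace Y] [CompactSpace Y] [T2Space Y] (S' : ℤ → Y → Y)
    (q : θ.X → Y), θ.IsEquicontinuousFactor S' q → ∃ r : Z → Y, Continuous r ∧ q = r ∘ π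

/-- The Ellis semigroup: the closure of `{σ^n}` in `X_θ → X_θ` for pointwise convergence. -/
def ellis (θ : Subst A ℓ) : Set (θ.X → θ.X) := closure (Set.range θ.shift)

/-- The kernel `ℳ(X_θ)`: the smallest bilateral ideal of the Ellis semigroup. -/
def kernel (θ : Subst A ℓ) : Set (θ.X → θ.X) :=
  ⋂₀ {J | J ⊆ θ.ellis ∧ J.Nonempty ∧ ∀ f ∈ θ.ellis, ∀ g ∈ J, f ∘ g ∈ J ∧ g ∘ f ∈ J}

structure IsMinimalIdempotent (θ : Subst A ℓ) (e : θ.X → θ.X) : Prop where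
  mem : e ∈ θ.ellis
  idem : e ∘ e = e
  minimal : ∀ p ∈ θ.ellis, p ∘ p = p → e ∘ p = p → p ∘ e = p → p = e

/-- The structure group `𝒢 = e E e` of the Ellis semigroup. -/
def structureGroup (θ : Subst A ℓ) (e : θ.X → θ.X) : Set (θ.X → θ.X) :=
  {g | ∃ f ∈ θ.ellis, g = e ∘ f ∘ e}

/-- `E^fib`: the elements of the Ellis semigroup preserving the fibres of the maximal equicontinuous
factor, that is, the fibres of every equicontinuous factor. -/
def ellisFib (θ : Subst A ℓ) : Set (θ.X → θ.X) :=
  {f | f ∈ θ.ellis ∧ ∀ (Y : Type u) [UniformSpace Y] [CompactSpace Y] [T2Space Y]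
    (S : ℤ → Y → Y) (q : θ.X → Y), θ.IsEquicontinuousFactor S q → ∀ x, q (f x) = q x}

/-- `𝒢^fib_0`: the group of the restrictions to `e · Fix(θ)` of the elements of
`𝒢^fib = 𝒢 ∩ E^fib`. -/
def gFibZero (θ : Subst A ℓ) (e : θ.X → θ.X) : Subgroup (Equiv.Perm ↥(e '' θ.fixedPts)) :=
  Subgroup.closure {τ | ∃ g ∈ θ.structureGroup e ∩ θ.ellisFib, ∀ x, (τ x : θ.X) = g x}

/-- `Γ_0`: the restriction to `e · Fix(θ)` of the little structure group. The little structure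
group is generated by the entries `q p` of the sandwich matrix of the kernel, normalised at `e`;
here `p` runs over the idempotents of the left ideal `E e` and `q` over those of the right ideal
`e E`. -/
def littleZero (θ : Subst A ℓ) (e : θ.X → θ.X) : Subgroup (Equiv.Perm ↥(e '' θ.fixedPts)) :=
  Subgroup.closure {τ | ∃ p ∈ θ.ellis, ∃ q ∈ θ.ellis, p ∘ p = p ∧ p ∘ e = p ∧
    q ∘ q = q ∧ e ∘ q = q ∧ ∀ x, (τ x : θ.X) = q (p x)}

/-- The normal closure of `Γ_0` in `𝒢^fib_0` consists of all permutations of `e · Fix(θ)`. -/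
def NormalClosureFull (θ : Subst A ℓ) (e : θ.X → θ.X) : Prop :=
  (Subgroup.normalClosure ((θ.littleZero e).subgroupOf (θ.gFibZero e) : Set (θ.gFibZero e))).map
    (θ.gFibZero e).subtype = ⊤

/-- The automorphism group of `X_θ`, as a set of homeomorphisms. -/
def aut (θ : Subst A ℓ) : Set (θ.X ≃ₜ θ.X) := {α | ∀ x, α (θ.shift 1 x) = θ.shift 1 (α x)}

/-- Two points are proximal: for each `N`, some common translates of them agree on `[-N, N]`. -/
def Proximal (θ : Subst A ℓ) (x y : θ.X) : Prop :=
  ∀ N : ℕ, ∃ n : ℤ, ∀ k : ℤ, |k| ≤ N → (θ.shift n x).1 k = (θ.shift n y).1 k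

end Subst

/-! ### Covariant functions on the maximal equicontinuous factor -/

section Covariant

variable [TopologicalSpace A] {θ : Subst A ℓ} {h : ℕ}

/-- A point of the maximal equicontinuous factor is singular if its fibre contains two distinct
proximal points. -/
def IsSingular (π : θ.X → Odometer ℓ h) (η : Odometer ℓ h) : Prop :=
  ∃ x y, π x = η ∧ π y = η ∧ x ≠ y ∧ θ.Proximal x y

/-- The orbit of `0` under the automorphisms of the maximal equicontinuous factor induced by the
automorphisms of `X_θ`. -/
def autOrbit (π : θ.X → Odometer ℓ h) : Set (Odometer ℓ h) :=
  {η | ∃ α ∈ θ.aut, ∃ x, π x = 0 ∧ π (α x) = η}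

/-- `e π⁻¹(η)`. -/
def fib (e : θ.X → θ.X) (π : θ.X → Odometer ℓ h) (η : Odometer ℓ h) : Set θ.X :=
  e '' (π ⁻¹' {η})

/-- The covariant functions `g` on the maximal equicontinuous factor for which there is a `ξ` such
that `g η` is a bijection from `e π⁻¹(η)` to `e π⁻¹(η + ξ)` for all `η`. Covariance is
`α ∘ g η ∘ α⁻¹ = g (α_eq η)` for all automorphisms `α`. -/
structure Cov (e : θ.X → θ.X) (π : θ.X → Odometer ℓ h) where
  ξ : Odometer ℓ h
  toEquiv : ∀ η, ↥(fib e π η) ≃ ↥(fib e π (η + ξ))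
  cov : ∀ α ∈ θ.aut, ∀ (η η' : Odometer ℓ h) (x : fib e π η) (y : fib e π η'),
    (y : θ.X) = α x → (toEquiv η' y : θ.X) = α (toEquiv η x)

/-- The product `(g g')(η) = g(η + ξ') ∘ g'(η)`. -/
instance (e : θ.X → θ.X) (π : θ.X → Odometer ℓ h) : Mul (Cov e π) :=
  ⟨fun g g' =>
    { ξ := g'.ξ + g.ξ
      toEquiv := fun η => (g'.toEquiv η).trans ((g.toEquiv (η + g'.ξ)).trans
        (Equiv.setCongr (by rw [add_assoc])))
      cov := fun α hα η η' x y hxy =>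
        g.cov α hα (η + g'.ξ) (η' + g'.ξ) _ _ (g'.cov α hα η η' x y hxy) }⟩

/-- The covariant function `t` has value `a` on the singular orbit and the identity elsewhere. Here
`a : A → A` is an element of `ℋ₊`, acting on `e π⁻¹(0)` through the letter at position `0`; by
covariance, the value of `t` at `0` determines its values on the orbit of `0`. -/
structure IsExtension {e : θ.X → θ.X} {π : θ.X → Odometer ℓ h} (a : A → A) (t : Cov e π) :
    Prop where
  ξ_eq : t.ξ = 0
  at_zero : ∀ x : fib e π 0, (t.toEquiv 0 x : θ.X).1 0 = a ((x : θ.X).1 0)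
  off_orbit : ∀ η ∉ autOrbit π, ∀ x : fib e π η, (t.toEquiv η x : θ.X) = x

end Covariant

end EllisQB

open EllisQB

set_option linter.unusedSectionVars false

/-! ### Column maps of powers and their constant rank. -/

namespace EllisQB

namespace Subst

variable {A : Type u} {ℓ : ℕ} [NeZero ℓ]

/-! ### Column maps of the powers -/

/-! Since `θ` is simplified, all elements of `S_θ` have the same rank `c`, so each of them is
injective on the range of any other (`IsSimplified.injOn`). Recognizability, proved by counting
words (`IsAdmissible.not_overlap`), gives a factor map `address` onto the `ℓ`-adic odometer whose
fibre over `0` is `Fix(θ)`. By injectivity on ranges, two points of one fibre which agree at a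
position agree on every block `θ^n(a)` around it (`IsAdmissible.agree_iff`). Over an address outside
`ℤ`, agreement at one position is therefore equality. Over an integer the fibre is a translate of
`Fix(θ)`. A fixed point is a pair `(b, a)` of letters at `-1` and `0`, where `b` governs the left
half and `a` the right half.

An element of `E` which is not a shift is a limit along an ultrafilter going to `+∞` or `-∞`. On
`Fix(θ)` it therefore depends on exactly one of `a` and `b` (`IsAdmissible.dependsOn`), and all its
values in `Fix(θ)` satisfy `b = i a` for a single `i ∈ I_θ` (`IsAdmissible.exists_graph`). Such a
map is not injective, while shifts are. Hence the non-shifts form an ideal, and it is the kernel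
(`kernel_eq`).

Idempotents of `E` act trivially over non-integral addresses (`IsAdmissible.idem_apply`), so the
products `q p` move integral fibres only. The permutations of `e Fix(θ)` induced by elements of
`eEe` of this kind form a group which contains `Γ_0` and is normalised by `𝒢^fib_0`; the hypothesis
makes it the full symmetric group (`localPerms_eq_top`). An element of `eEe` can thus be altered at
will over one `ℤ`-orbit of addresses without changing it elsewhere. Consequently every covariant
family agrees with elements of `eEe` over each finite set of addresses, and compactness of `E` puts
it into `eEe` (`mem_structureGroup_of_covariant`). The same hypothesis forces every equicontinuous
factor to collapse `Fix(θ)`, so the `ℓ`-adic odometer is maximal and `h = 1`.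

Finally, each element of the kernel is uniquely `p_i ∘ g ∘ q_l` with `g ∈ eEe`. Here `p_i` is an
idempotent `(b, a) ↦ (i a, a)`, and `q_+`, `q_-` send a fixed point to the point of `e Fix(θ)` whose
letter at `0` is `a`, respectively `φ b`. The sandwich entries `q_l p_i` act on that letter by `e₊`
and `φ i`, and trivially over non-integral addresses. -/

theorem ofNat_mod (i : ℕ) : Fin.ofNat ℓ (i % ℓ) = Fin.ofNat ℓ i := by
  apply Fin.ext
  simp [Fin.ofNat]

theorem ofNat_congr {i j : ℕ} (h : i % ℓ = j % ℓ) : Fin.ofNat ℓ i = Fin.ofNat ℓ j := by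
  rw [← ofNat_mod i, h, ofNat_mod]

theorem pos_length : 0 < ℓ := Nat.pos_of_ne_zero (NeZero.ne ℓ)

theorem colPow_add (θ : Subst A ℓ) (m n i j : ℕ) (hi : i < ℓ ^ m) :
    θ.colPow (m + n) (i + j * ℓ ^ m) = θ.colPow m i ∘ θ.colPow n j := by
  induction m generalizing i with
  | zero =>
    have : i = 0 := by simpa using hi
    subst this
    simp [colPow]
  | succ m ih =>
    have h1 : (i + j * ℓ ^ (m + 1)) / ℓ = i / ℓ + j * ℓ ^ m := by
      rw [pow_succ, ← mul_assoc, Nat.add_mul_div_right _ _ pos_length]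
    have h2 : i / ℓ < ℓ ^ m := by
      rw [Nat.div_lt_iff_lt_mul pos_length, ← pow_succ]
      exact hi
    have h3 : Fin.ofNat ℓ (i + j * ℓ ^ (m + 1)) = Fin.ofNat ℓ i := by
      apply ofNat_congr
      rw [pow_succ, ← mul_assoc, Nat.add_mul_mod_self_right]
    rw [show m + 1 + n = (m + n) + 1 by ring]
    simp only [colPow]
    rw [h1, ih _ h2, h3]
    rfl

theorem act_mul_add (θ : Subst A ℓ) (u : ℤ → A) (q : ℤ) (r : ℕ) (hr : r < ℓ) :
    θ.act u (q * ℓ + r) = θ.col (Fin.ofNat ℓ r) (u q) := by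
  have hl : (0 : ℤ) < ℓ := by exact_mod_cast pos_length (ℓ := ℓ)
  have h1 : (q * ℓ + r) % (ℓ : ℤ) = r := by
    rw [add_comm, Int.add_mul_emod_self_right]
    exact Int.emod_eq_of_lt (by positivity) (by exact_mod_cast hr)
  have h2 : (q * ℓ + r) / (ℓ : ℤ) = q := by
    rw [add_comm, Int.add_mul_ediv_right _ _ hl.ne', Int.ediv_eq_zero_of_lt (by positivity)
      (by exact_mod_cast hr), zero_add]
  simp only [act, h1, h2, Int.toNat_natCast]

theorem act_iterate_mul_add (θ : Subst A ℓ) (u : ℤ → A) (n : ℕ) (q : ℤ) (r : ℕ)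
    (hr : r < ℓ ^ n) : θ.act^[n] u (q * (ℓ : ℤ) ^ n + r) = θ.colPow n r (u q) := by
  induction n generalizing q r with
  | zero =>
    have : r = 0 := by simpa using hr
    subst this
    simp [colPow]
  | succ n ih =>
    have h2 : r / ℓ < ℓ ^ n := by
      rw [Nat.div_lt_iff_lt_mul pos_length, ← pow_succ]
      exact hr
    have h1 : q * (ℓ : ℤ) ^ (n + 1) + r = (q * (ℓ : ℤ) ^ n + (r / ℓ : ℕ)) * ℓ + (r % ℓ : ℕ) := by
      have : (r : ℤ) = (r / ℓ : ℕ) * ℓ + (r % ℓ : ℕ) := by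
        exact_mod_cast (Nat.div_add_mod' r ℓ).symm
      rw [pow_succ]
      linear_combination this
    rw [Function.iterate_succ_apply', h1, act_mul_add _ _ _ _ (Nat.mod_lt _ pos_length), ih _ _ h2,
      ofNat_mod]
    rfl

theorem exists_eq_mul_add (n : ℕ) (k : ℤ) :
    ∃ (q : ℤ) (r : ℕ), r < ℓ ^ n ∧ k = q * (ℓ : ℤ) ^ n + r := by
  have hl : (0 : ℤ) < (ℓ : ℤ) ^ n := by
    have := pos_length (ℓ := ℓ)
    positivity
  refine ⟨k / (ℓ : ℤ) ^ n, (k % (ℓ : ℤ) ^ n).toNat, ?_, ?_⟩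
  · have := Int.emod_lt_of_pos k hl
    zify
    rw [Int.toNat_of_nonneg (Int.emod_nonneg _ hl.ne')]
    exact this
  · rw [Int.toNat_of_nonneg (Int.emod_nonneg _ hl.ne')]
    exact (Int.ediv_mul_add_emod k _).symm

theorem act_translate (θ : Subst A ℓ) (u : ℤ → A) (n : ℕ) (m k : ℤ) :
    θ.act^[n] u (k + (ℓ : ℤ) ^ n * m) = θ.act^[n] (fun t => u (t + m)) k := by
  obtain ⟨q, r, hr, rfl⟩ := exists_eq_mul_add (ℓ := ℓ) n k
  rw [show q * (ℓ : ℤ) ^ n + r + (ℓ : ℤ) ^ n * m = (q + m) * (ℓ : ℤ) ^ n + r by ring,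
    act_iterate_mul_add _ _ _ _ _ hr, act_iterate_mul_add _ _ _ _ _ hr]

theorem act_mem {θ : Subst A ℓ} {u : ℤ → A} (hu : u ∈ θ.shiftSet) : θ.act u ∈ θ.shiftSet := by
  intro k n
  obtain ⟨q, s, hs, rfl⟩ := exists_eq_mul_add (ℓ := ℓ) 1 k
  rw [pow_one] at hs
  -- `n` consecutive letters of `θ(u)` meet the images of at most `n + 1` letters of `u`.
  obtain ⟨a, m, j, hj, hw⟩ := hu q (n + 1)
  refine ⟨a, m + 1, j * ℓ + s, ?_, fun t ht => ?_⟩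
  · have hl := pos_length (ℓ := ℓ)
    calc j * ℓ + s + n ≤ j * ℓ + ℓ + n * ℓ := by nlinarith
      _ = (j + (n + 1)) * ℓ := by ring
      _ ≤ ℓ ^ m * ℓ := Nat.mul_le_mul_right _ hj
      _ = ℓ ^ (m + 1) := (pow_succ _ _).symm
  · have h1 : q * (ℓ : ℤ) ^ 1 + s + t = (q + ((s + t) / ℓ : ℕ)) * ℓ + ((s + t) % ℓ : ℕ) := by
      have : ((s + t : ℕ) : ℤ) = ((s + t) / ℓ : ℕ) * ℓ + ((s + t) % ℓ : ℕ) := by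
        exact_mod_cast (Nat.div_add_mod' (s + t) ℓ).symm
      push_cast at this ⊢
      linear_combination this
    have h2 : (s + t) / ℓ < n + 1 := by
      rw [Nat.div_lt_iff_lt_mul pos_length]
      nlinarith
    have h3 : (j * ℓ + s + t) / ℓ = j + (s + t) / ℓ := by
      rw [add_assoc, add_comm, Nat.add_mul_div_right _ _ pos_length, add_comm]
    have h4 : Fin.ofNat ℓ (j * ℓ + s + t) = Fin.ofNat ℓ (s + t) := by
      apply ofNat_congr
      rw [add_assoc, add_comm, Nat.add_mul_mod_self_right]
    show θ.act u (q * (ℓ : ℤ) ^ 1 + s + t) = _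
    rw [h1, act_mul_add _ _ _ _ (Nat.mod_lt _ pos_length), ofNat_mod]
    simp only [colPow, h3, h4, Function.comp]
    rw [← hw _ h2]

/-! ### Ranks -/

theorem Sgp.exists_colPow {θ : Subst A ℓ} {f : A → A} (hf : θ.Sgp f) :
    ∃ n i, 0 < n ∧ i < ℓ ^ n ∧ f = θ.colPow n i := by
  induction hf with
  | col n i hn hi => exact ⟨n, i, hn, hi, rfl⟩
  | comp f g _ _ hf hg =>
    obtain ⟨n, i, hn, hi, rfl⟩ := hf
    obtain ⟨m, j, hm, hj, rfl⟩ := hg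
    refine ⟨n + m, i + j * ℓ ^ n, by omega, ?_, (colPow_add _ _ _ _ _ hi).symm⟩
    calc i + j * ℓ ^ n < ℓ ^ n + j * ℓ ^ n := by omega
      _ = (j + 1) * ℓ ^ n := by ring
      _ ≤ ℓ ^ m * ℓ ^ n := Nat.mul_le_mul_right _ hj
      _ = ℓ ^ (n + m) := by rw [pow_add, mul_comm]

theorem sgp_col (θ : Subst A ℓ) (i : ℕ) : θ.Sgp (θ.col (Fin.ofNat ℓ i)) := by
  rw [← ofNat_mod]
  exact Sgp.col 1 (i % ℓ) one_pos (by simpa using Nat.mod_lt _ pos_length)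

theorem sgp_ePlus (θ : Subst A ℓ) : θ.Sgp θ.ePlus := sgp_col _ _

theorem sgp_eMinus (θ : Subst A ℓ) : θ.Sgp θ.eMinus := sgp_col _ _

theorem Sgp.iterate {θ : Subst A ℓ} {f : A → A} (hf : θ.Sgp f) (n : ℕ) : θ.Sgp f^[n + 1] := by
  induction n with
  | zero => exact hf
  | succ n ih =>
    rw [Function.iterate_succ']
    exact hf.comp _ _ ih

theorem H.comp_left {θ : Subst A ℓ} {p q f : A → A} (hp : p ∘ p = p) (hf : f ∈ θ.H p q) :
    p ∘ f = f := by
  obtain ⟨t, -, rfl⟩ := hf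
  rw [← Function.comp_assoc, hp]

theorem H.comp_right {θ : Subst A ℓ} {p q f : A → A} (hq : q ∘ q = q) (hf : f ∈ θ.H p q) :
    f ∘ q = f := by
  obtain ⟨t, -, rfl⟩ := hf
  rw [Function.comp_assoc, Function.comp_assoc, hq]

theorem H.sgp {θ : Subst A ℓ} {p q f : A → A} (hp : θ.Sgp p) (hq : θ.Sgp q) (hf : f ∈ θ.H p q) :
    θ.Sgp f := by
  obtain ⟨t, ht, rfl⟩ := hf
  exact hp.comp _ _ (ht.comp _ _ hq)

variable [Finite A]

/-- The outermost factor of a column map of a positive power is a column of `θ` itself, which bounds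
the rank by `c`; the other inequality is the minimality of `c`. -/
theorem IsSimplified.rank_eq {θ : Subst A ℓ} (hs : θ.IsSimplified) {f : A → A} (hf : θ.Sgp f) :
    rank f = θ.columnRank := by
  obtain ⟨n, i, hn, hi, rfl⟩ := hf.exists_colPow
  refine le_antisymm ?_ (Nat.sInf_le ⟨n, i, hi, rfl⟩)
  obtain ⟨n, rfl⟩ : ∃ m, n = m + 1 := ⟨n - 1, by omega⟩
  rw [← hs.rank_col (Fin.ofNat ℓ i)]
  exact Set.ncard_le_ncard (Set.range_comp_subset_range _ _) (Set.toFinite _)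

/-- `f ∘ g` and `g` have equal rank. This is the cancellation law behind all later comparisons of
letters. -/
theorem IsSimplified.injOn {θ : Subst A ℓ} (hs : θ.IsSimplified) {f g : A → A} (hf : θ.Sgp f)
    (hg : θ.Sgp g) : Set.InjOn f (Set.range g) := by
  apply Set.injOn_of_ncard_image_eq _ (Set.toFinite _)
  rw [← Set.range_comp]
  exact (hs.rank_eq (hf.comp _ _ hg)).trans (hs.rank_eq hg).symm

theorem IsSimplified.range_comp {θ : Subst A ℓ} (hs : θ.IsSimplified) {f g : A → A}
    (hf : θ.Sgp f) (hg : θ.Sgp g) : Set.range (f ∘ g) = Set.range f := by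
  apply Set.eq_of_subset_of_ncard_le (Set.range_comp_subset_range _ _) _ (Set.toFinite _)
  exact ((hs.rank_eq hf).trans (hs.rank_eq (hf.comp _ _ hg)).symm).le

/-- Some power of an element of the semigroup is the identity on its range. -/
theorem IsSimplified.exists_iterate_eq {θ : Subst A ℓ} (hs : θ.IsSimplified) {f : A → A}
    (hf : θ.Sgp f) : ∃ p, 0 < p ∧ ∀ a ∈ Set.range f, f^[p] a = a := by
  obtain ⟨m, m', hne, heq⟩ : ∃ m m', m < m' ∧ f^[m + 1] = f^[m' + 1] := by
    obtain ⟨m, m', hne, heq⟩ := Finite.exists_ne_map_eq_of_infinite (fun n : ℕ => f^[n + 1])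
    rcases lt_or_gt_of_ne hne with h | h
    · exact ⟨m, m', h, heq⟩
    · exact ⟨m', m, h, heq.symm⟩
  refine ⟨m' - m, by omega, fun a ha => ?_⟩
  obtain ⟨k, hk⟩ : ∃ k, m' - m = k + 1 := ⟨m' - m - 1, by omega⟩
  apply hs.injOn (hf.iterate m) hf _ ha
  · rw [← Function.iterate_add_apply, show m + 1 + (m' - m) = m' + 1 by omega, heq]
  · rw [hk, Function.iterate_succ']
    exact ⟨_, rfl⟩

/-- The elements of `ℋ₊` are invertible. -/
theorem IsSimplified.exists_inverse {θ : Subst A ℓ} (hs : θ.IsSimplified)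
    (he : θ.ePlus ∘ θ.ePlus = θ.ePlus) {R : A → A} (hR : R ∈ θ.H θ.ePlus θ.ePlus) :
    ∃ R' ∈ θ.H θ.ePlus θ.ePlus, R ∘ R' = θ.ePlus ∧ R' ∘ R = θ.ePlus := by
  have hRs := H.sgp θ.sgp_ePlus θ.sgp_ePlus hR
  have hl := H.comp_left he hR
  have hr := H.comp_right he hR
  obtain ⟨p, hp, hid⟩ := hs.exists_iterate_eq hRs
  have hrange : Set.range R = Set.range θ.ePlus := by
    rw [← hl]
    exact hs.range_comp θ.sgp_ePlus hRs
  have hcomm : ∀ k, R^[k + 1] ∘ θ.ePlus = R^[k + 1] := fun k => by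
    rw [Function.iterate_succ, Function.comp_assoc, hr]
  have hcomm' : ∀ k, θ.ePlus ∘ R^[k + 1] = R^[k + 1] := fun k => by
    rw [Function.iterate_succ', ← Function.comp_assoc, hl]
  have hpe : R^[p] = θ.ePlus := by
    obtain ⟨k, rfl⟩ : ∃ k, p = k + 1 := ⟨p - 1, by omega⟩
    rw [← hcomm]
    funext a
    exact hid _ (hrange ▸ ⟨a, rfl⟩)
  -- The inverse is `R^(2p-1)` and not `R^(p-1)`, because for `p = 1` the latter is `id`, which need
  -- not be `e₊`.
  have h2p : R^[2 * p - 1 + 1] = θ.ePlus := by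
    rw [show 2 * p - 1 + 1 = p + p by omega, Function.iterate_add, hpe, he]
  obtain ⟨k, hk⟩ : ∃ k, 2 * p - 1 = k + 1 := ⟨2 * p - 2, by omega⟩
  refine ⟨R^[2 * p - 1], ⟨R^[2 * p - 1], ?_, ?_⟩, ?_, ?_⟩
  · rw [hk]
    exact hRs.iterate k
  · rw [hk, hcomm, hcomm']
  · rw [← Function.iterate_succ', h2p]
  · rw [← Function.iterate_succ, h2p]

end Subst

end EllisQB

/-! ### The dynamics of `X_θ` and the Ellis semigroup as limits along ultrafilters. -/

namespace EllisQB

namespace Subst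

open Filter Topology

/-! ### Shifts and the action of the substitution on `X_θ` -/

section Basic

variable {A : Type u} {ℓ : ℕ} [NeZero ℓ]

theorem shift_apply (θ : Subst A ℓ) (n : ℤ) (x : θ.X) (k : ℤ) : (θ.shift n x).1 k = x.1 (k + n) :=
  rfl

theorem shift_shift (θ : Subst A ℓ) (m n : ℤ) (x : θ.X) :
    θ.shift m (θ.shift n x) = θ.shift (m + n) x := by
  apply Subtype.ext
  funext k
  simp only [shift_apply, add_assoc]

theorem shift_zero (θ : Subst A ℓ) (x : θ.X) : θ.shift 0 x = x := by
  apply Subtype.ext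
  funext k
  simp only [shift_apply, add_zero]

theorem shift_neg_shift (θ : Subst A ℓ) (n : ℤ) (x : θ.X) : θ.shift (-n) (θ.shift n x) = x := by
  rw [shift_shift, neg_add_cancel, shift_zero]

theorem shift_shift_neg (θ : Subst A ℓ) (n : ℤ) (x : θ.X) : θ.shift n (θ.shift (-n) x) = x := by
  rw [shift_shift, add_neg_cancel, shift_zero]

/-- The action of the substitution on `X_θ`. -/
def actX (θ : Subst A ℓ) (x : θ.X) : θ.X := ⟨θ.act x.1, act_mem x.2⟩

theorem actX_iterate (θ : Subst A ℓ) (n : ℕ) (x : θ.X) : (θ.actX^[n] x).1 = θ.act^[n] x.1 := by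
  induction n with
  | zero => rfl
  | succ n ih =>
    rw [Function.iterate_succ_apply', Function.iterate_succ_apply', ← ih]
    rfl

theorem actX_iterate_shift (θ : Subst A ℓ) (n : ℕ) (m : ℤ) (x : θ.X) :
    θ.actX^[n] (θ.shift m x) = θ.shift ((ℓ : ℤ) ^ n * m) (θ.actX^[n] x) := by
  apply Subtype.ext
  funext k
  rw [shift_apply, actX_iterate, actX_iterate, act_translate]
  rfl

theorem actX_iterate_apply (θ : Subst A ℓ) (n : ℕ) (x : θ.X) (q : ℤ) (r : ℕ) (hr : r < ℓ ^ n) :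
    (θ.actX^[n] x).1 (q * (ℓ : ℤ) ^ n + r) = θ.colPow n r (x.1 q) := by
  rw [actX_iterate, act_iterate_mul_add _ _ _ _ _ hr]

theorem act_zero (θ : Subst A ℓ) (u : ℤ → A) : θ.act u 0 = θ.ePlus (u 0) := by
  have := θ.act_mul_add u 0 0 pos_length
  rwa [zero_mul, zero_add, Nat.cast_zero] at this

theorem act_neg_one (θ : Subst A ℓ) (u : ℤ → A) : θ.act u (-1) = θ.eMinus (u (-1)) := by
  have hl := pos_length (ℓ := ℓ)
  have := θ.act_mul_add u (-1) (ℓ - 1) (by omega)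
  refine Eq.trans ?_ this
  congr 1
  push_cast [Nat.cast_sub (show 1 ≤ ℓ from hl)]
  ring

theorem act_iterate_zero (θ : Subst A ℓ) (n : ℕ) (u : ℤ → A) :
    θ.act^[n] u 0 = θ.ePlus^[n] (u 0) := by
  induction n with
  | zero => rfl
  | succ n ih => rw [Function.iterate_succ_apply', Function.iterate_succ_apply', act_zero, ih]

theorem act_iterate_neg_one (θ : Subst A ℓ) (n : ℕ) (u : ℤ → A) :
    θ.act^[n] u (-1) = θ.eMinus^[n] (u (-1)) := by
  induction n with
  | zero => rfl
  | succ n ih => rw [Function.iterate_succ_apply', Function.iterate_succ_apply', act_neg_one, ih]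

theorem act_iterate_congr (θ : Subst A ℓ) (n : ℕ) {u v : ℤ → A} (h0 : u 0 = v 0)
    (h1 : u (-1) = v (-1)) {k : ℤ} (hk : -(ℓ : ℤ) ^ n ≤ k) (hk' : k < (ℓ : ℤ) ^ n) :
    θ.act^[n] u k = θ.act^[n] v k := by
  obtain ⟨q, r, hr, rfl⟩ := exists_eq_mul_add (ℓ := ℓ) n k
  have hr' : (r : ℤ) < (ℓ : ℤ) ^ n := by exact_mod_cast hr
  rw [act_iterate_mul_add _ _ _ _ _ hr, act_iterate_mul_add _ _ _ _ _ hr]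
  have hq : q < 1 := by
    by_contra! h
    nlinarith
  have hq' : -2 < q := by
    by_contra! h
    nlinarith
  obtain rfl | rfl : q = 0 ∨ q = -1 := by omega
  · rw [h0]
  · rw [h1]

/-- Two fixed points with the same letters at `-1` and `0` are equal. -/
theorem fixedPts_ext {θ : Subst A ℓ} (hℓ : 2 ≤ ℓ) {u v : θ.X} (hu : u ∈ θ.fixedPts)
    (hv : v ∈ θ.fixedPts) (h0 : u.1 0 = v.1 0) (h1 : u.1 (-1) = v.1 (-1)) : u = v := by
  apply Subtype.ext
  funext k
  have hk : |k| < (ℓ : ℤ) ^ k.natAbs := by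
    rw [Int.abs_eq_natAbs]
    exact_mod_cast Nat.lt_pow_self (by omega)
  rw [abs_lt] at hk
  have := θ.act_iterate_congr k.natAbs h0 h1 hk.1.le hk.2
  rwa [Function.iterate_fixed hu, Function.iterate_fixed hv] at this

/-- A point whose central letters are fixed by `θ^p` gives a fixed point of `θ^p`. -/
theorem exists_act_iterate_fixed {θ : Subst A ℓ} (hℓ : 2 ≤ ℓ) {p : ℕ} (hp : 0 < p) (y : θ.X)
    (h0 : θ.act^[p] y.1 0 = y.1 0) (h1 : θ.act^[p] y.1 (-1) = y.1 (-1)) :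
    ∃ z : θ.X, θ.act^[p] z.1 = z.1 ∧ z.1 0 = y.1 0 ∧ z.1 (-1) = y.1 (-1) := by
  have hbig : ∀ (k : ℤ) (m : ℕ), k.natAbs ≤ m → |k| < (ℓ : ℤ) ^ (p * m) := fun k m hm => by
    rw [Int.abs_eq_natAbs]
    have : m < ℓ ^ m := Nat.lt_pow_self (by omega)
    have h2 : ℓ ^ m ≤ ℓ ^ (p * m) := Nat.pow_le_pow_right (by omega) (by nlinarith)
    exact_mod_cast (by omega : k.natAbs < ℓ ^ (p * m))
  have hstep : ∀ (k : ℤ) (m : ℕ), k.natAbs ≤ m →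
      θ.act^[p * (m + 1)] y.1 k = θ.act^[p * m] y.1 k := fun k m hm => by
    have hk := abs_lt.mp (hbig k m hm)
    rw [mul_add, mul_one, Function.iterate_add_apply]
    exact θ.act_iterate_congr _ h0 h1 hk.1.le hk.2
  have hstab : ∀ (k : ℤ) (m : ℕ), k.natAbs ≤ m →
      θ.act^[p * m] y.1 k = θ.act^[p * k.natAbs] y.1 k := fun k m hm => by
    induction m, hm using Nat.le_induction with
    | base => rfl
    | succ m hm ih => rw [hstep k m hm, ih]
  -- The fixed point is the limit of `θ^(pm)(y)`. Its letter at `k` no longer changes from `m = |k|`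
  -- on, so it can be written down directly.
  have hmem : (fun k : ℤ => θ.act^[p * k.natAbs] y.1 k) ∈ θ.shiftSet := by
    intro k n
    obtain ⟨a, m, j, hj, hw⟩ := (θ.actX^[p * (k.natAbs + n)] y).2 k n
    refine ⟨a, m, j, hj, fun t ht => ?_⟩
    rw [← hw t ht, actX_iterate]
    exact (hstab _ _ (by omega)).symm
  refine ⟨⟨_, hmem⟩, ?_, ?_, ?_⟩
  · funext k
    obtain ⟨q, r, hr, hk⟩ := exists_eq_mul_add (ℓ := ℓ) p k
    have h2 : θ.act^[p] (fun k : ℤ => θ.act^[p * k.natAbs] y.1 k) k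
        = θ.act^[p] (θ.act^[p * (k.natAbs + q.natAbs)] y.1) k := by
      rw [hk, act_iterate_mul_add _ _ _ _ _ hr, act_iterate_mul_add _ _ _ _ _ hr, ← hk]
      rw [hstab q (k.natAbs + q.natAbs) (by omega)]
    show θ.act^[p] (fun k : ℤ => θ.act^[p * k.natAbs] y.1 k) k = _
    rw [h2, ← Function.iterate_add_apply, show p + p * (k.natAbs + q.natAbs)
      = p * (k.natAbs + q.natAbs + 1) by ring, hstab k _ (by omega)]
  · rfl
  · show θ.act^[p * 1] y.1 (-1) = _
    rw [mul_one, h1]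

end Basic

/-! ### Limits of shifts -/

section Topological

variable {A : Type u} {ℓ : ℕ} [NeZero ℓ] [TopologicalSpace A] [DiscreteTopology A]

theorem tendsto_iff {θ : Subst A ℓ} {ι : Type*} {l : Filter ι} {F : ι → θ.X} {y : θ.X} :
    Tendsto F l (𝓝 y) ↔ ∀ k, ∀ᶠ i in l, (F i).1 k = y.1 k := by
  rw [tendsto_subtype_rng, tendsto_pi_nhds]
  simp only [nhds_discrete, tendsto_pure]

/-- The map `f` is the pointwise limit of the shifts along the ultrafilter `U`. -/
def IsLim (θ : Subst A ℓ) (U : Ultrafilter ℤ) (f : θ.X → θ.X) : Prop :=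
  ∀ (x : θ.X) (k : ℤ), ∀ᶠ n in (U : Filter ℤ), x.1 (k + n) = (f x).1 k

theorem isLim_iff {θ : Subst A ℓ} {U : Ultrafilter ℤ} {f : θ.X → θ.X} :
    θ.IsLim U f ↔ Tendsto θ.shift U (𝓝 f) := by
  rw [tendsto_pi_nhds]
  simp only [tendsto_iff]
  rfl

/-- Pulling the neighbourhoods of `f` back to `ℤ` gives a filter, refined to an ultrafilter.
Statements about `E` become statements about the letters at `k + n` for `U`-almost all `n`. -/
theorem mem_ellis_iff {θ : Subst A ℓ} {f : θ.X → θ.X} :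
    f ∈ θ.ellis ↔ ∃ U, θ.IsLim U f := by
  simp only [isLim_iff]
  constructor
  · intro hf
    have : NeBot (comap θ.shift (𝓝 f)) := by
      rw [ellis, mem_closure_iff_clusterPt, ClusterPt] at hf
      exact comap_neBot_iff_frequently.mpr
        (frequently_iff.mpr fun {V} hV => by
          obtain ⟨g, hg, n, rfl⟩ := (mem_closure_iff_nhds.mp (mem_closure_iff_clusterPt.mpr hf)) V hV
          exact ⟨_, hg, n, rfl⟩)
    refine ⟨Ultrafilter.of (comap θ.shift (𝓝 f)), ?_⟩
    exact tendsto_iff_comap.mpr (Ultrafilter.of_le _)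
  · rintro ⟨U, hU⟩
    exact mem_closure_of_tendsto hU (Eventually.of_forall fun n => ⟨n, rfl⟩)

theorem shift_mem_ellis (θ : Subst A ℓ) (n : ℤ) : θ.shift n ∈ θ.ellis :=
  subset_closure ⟨n, rfl⟩

theorem IsLim.comm {θ : Subst A ℓ} {U : Ultrafilter ℤ} {f : θ.X → θ.X} (hf : θ.IsLim U f)
    (m : ℤ) (x : θ.X) : f (θ.shift m x) = θ.shift m (f x) := by
  apply Subtype.ext
  funext k
  obtain ⟨n, h1, h2⟩ := ((hf (θ.shift m x) k).and (hf x (k + m))).exists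
  rw [shift_apply, ← h1, ← h2, shift_apply, add_right_comm]

theorem ellis_comm {θ : Subst A ℓ} {f : θ.X → θ.X} (hf : f ∈ θ.ellis)
    (m : ℤ) (x : θ.X) : f (θ.shift m x) = θ.shift m (f x) := by
  obtain ⟨U, hU⟩ := mem_ellis_iff.mp hf
  exact hU.comm m x

theorem continuous_shift (θ : Subst A ℓ) (n : ℤ) : Continuous (θ.shift n) := by
  refine Continuous.subtype_mk (continuous_pi fun k => ?_) _
  exact (continuous_apply (k + n)).comp continuous_subtype_val

theorem continuous_comp_right {θ : Subst A ℓ} (g : θ.X → θ.X) :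
    Continuous fun f : θ.X → θ.X => f ∘ g :=
  continuous_pi fun x => continuous_apply (g x)

/-- Composition is continuous in its left factor only, so the closure is taken in two stages: shifts
are continuous and preserve `E`, then the left factor is approximated by shifts. -/
theorem ellis_comp {θ : Subst A ℓ} {f g : θ.X → θ.X} (hf : f ∈ θ.ellis) (hg : g ∈ θ.ellis) :
    f ∘ g ∈ θ.ellis := by
  have h1 : ∀ n, θ.shift n ∘ g ∈ θ.ellis := fun n => by
    have hc : Continuous fun f : θ.X → θ.X => θ.shift n ∘ f :=
      continuous_pi fun x => (θ.continuous_shift n).comp (continuous_apply x)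
    refine map_mem_closure hc hg ?_
    rintro _ ⟨m, rfl⟩
    exact ⟨n + m, funext fun x => (θ.shift_shift n m x).symm⟩
  have h2 : f ∘ g ∈ closure θ.ellis := by
    refine map_mem_closure (f := fun f : θ.X → θ.X => f ∘ g) (continuous_comp_right g) hf ?_
    rintro _ ⟨m, rfl⟩
    exact h1 m
  rwa [ellis, closure_closure] at h2

/-- Composition with automorphisms commutes with the Ellis semigroup. -/
theorem ellis_aut {θ : Subst A ℓ} {f : θ.X → θ.X} (hf : f ∈ θ.ellis) {α : θ.X ≃ₜ θ.X}
    (hα : α ∈ θ.aut) (x : θ.X) : f (α x) = α (f x) := by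
  have hα' : ∀ (n : ℤ) (x : θ.X), α (θ.shift n x) = θ.shift n (α x) := by
    have hneg : ∀ x, α (θ.shift (-1) x) = θ.shift (-1) (α x) := fun x => by
      rw [← θ.shift_neg_shift 1 (α (θ.shift (-1) x)), ← hα, shift_shift_neg]
    intro n
    induction n using Int.induction_on with
    | zero => intro x; rw [shift_zero, shift_zero]
    | succ n ih =>
      intro x
      rw [add_comm, ← shift_shift, hα, ih, shift_shift]
    | pred n ih =>
      intro x
      rw [sub_eq_add_neg, add_comm, ← shift_shift, hneg, ih, shift_shift]
  obtain ⟨U, hU⟩ := mem_ellis_iff.mp hf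
  rw [isLim_iff, tendsto_pi_nhds] at hU
  have h1 := hU (α x)
  have h2 := (α.continuous.tendsto (f x)).comp (hU x)
  refine tendsto_nhds_unique h1 (h2.congr fun n => ?_)
  simp only [Function.comp, hα']

variable [Finite A]

theorem isClosed_shiftSet (θ : Subst A ℓ) : IsClosed θ.shiftSet := by
  have : θ.shiftSet = ⋂ (k : ℤ) (n : ℕ), (fun (u : ℤ → A) (t : Fin n) => u (k + t)) ⁻¹'
      {w | ∃ (a : A) (m j : ℕ), j + n ≤ ℓ ^ m ∧ ∀ t : Fin n, w t = θ.colPow m (j + t) a} := by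
    ext u
    simp only [shiftSet, Allowed, Set.mem_ofPred_eq, Set.mem_iInter, Set.mem_preimage, Fin.forall_iff]
  rw [this]
  refine isClosed_iInter fun k => isClosed_iInter fun n => ?_
  exact (isClosed_discrete _).preimage (by fun_prop)

instance (θ : Subst A ℓ) : CompactSpace θ.X :=
  isCompact_iff_compactSpace.mp θ.isClosed_shiftSet.isCompact

theorem exists_isLim (θ : Subst A ℓ) (U : Ultrafilter ℤ) : ∃ f ∈ θ.ellis, θ.IsLim U f := by
  obtain ⟨f, -, hf⟩ := isCompact_univ.ultrafilter_le_nhds' (U.map θ.shift) univ_mem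
  have : θ.IsLim U f := isLim_iff.mpr hf
  exact ⟨f, mem_ellis_iff.mpr ⟨U, this⟩, this⟩

/-- Limits along a prescribed sequence of shifts: the clause on `P` says that `U` refines the filter
of tails of `s`. -/
theorem exists_isLim_seq (θ : Subst A ℓ) (s : ℕ → ℤ) : ∃ f ∈ θ.ellis, ∃ U, θ.IsLim U f ∧
    ∀ P : ℤ → Prop, (∀ᶠ m in atTop, P (s m)) → ∀ᶠ n in (U : Filter ℤ), P n := by
  obtain ⟨f, hf, hU⟩ := θ.exists_isLim ((hyperfilter ℕ).map s)
  refine ⟨f, hf, _, hU, fun P hP => ?_⟩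
  exact Nat.hyperfilter_le_atTop hP

theorem exists_isLim_seq_apply (θ : Subst A ℓ) (s : ℕ → ℤ) : ∃ f ∈ θ.ellis,
    ∀ (x : θ.X) (k : ℤ) (a : A), (∀ᶠ m in atTop, x.1 (k + s m) = a) → (f x).1 k = a := by
  obtain ⟨f, hf, U, hU, hs⟩ := θ.exists_isLim_seq s
  refine ⟨f, hf, fun x k a ha => ?_⟩
  obtain ⟨n, h1, h2⟩ := ((hU x k).and (hs (fun n => x.1 (k + n) = a) ha)).exists
  rw [← h1, h2]

end Topological

end Subst

end EllisQB

/-! ### Minimality, idempotence of the extreme columns, and word complexity. -/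

namespace EllisQB

namespace Subst

open Filter Topology

/-- The standing hypotheses on the substitution. -/
structure IsAdmissible {A : Type u} {ℓ : ℕ} [NeZero ℓ] (θ : Subst A ℓ) : Prop where
  two_le : 2 ≤ ℓ
  prim : θ.IsPrimitive
  aper : θ.IsAperiodic
  simp : θ.IsSimplified

/-! ### Minimality -/

section Minimal

variable {A : Type u} {ℓ : ℕ} [NeZero ℓ] {θ : Subst A ℓ}

/-- Every allowed word occurs in every point of `X_θ`. -/
theorem IsAdmissible.exists_occurrence (hθ : θ.IsAdmissible) (x : θ.X) {n : ℕ} {w : ℕ → A}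
    (hw : θ.Allowed n w) : ∃ p : ℤ, ∀ t < n, x.1 (p + t) = w t := by
  obtain ⟨k, -, hk⟩ := hθ.prim
  obtain ⟨a, m, j, hj, hw⟩ := hw
  -- A window of length `2 ℓ^(m+k)` contains a complete block `θ^(m+k)(b')`, and by primitivity the
  -- letter `a` occurs in `θ^k(b')`.
  obtain ⟨b, M, J, hJ, hx⟩ := x.2 0 (2 * ℓ ^ (m + k))
  have hl := hθ.two_le
  have hN : m + k < M := by
    rw [← Nat.pow_lt_pow_iff_right (show 1 < ℓ by omega)]
    have : 0 < ℓ ^ (m + k) := by positivity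
    omega
  obtain ⟨M, rfl⟩ : ∃ M', M = m + k + M' := ⟨M - (m + k), by omega⟩
  set L := ℓ ^ (m + k) with hL
  have hLpos : 0 < L := by positivity
  set q := J / L + 1 with hq
  have hq1 : J < q * L := by
    have := Nat.lt_div_mul_add (a := J) hLpos
    rw [hq, add_mul, one_mul]
    exact this
  have hq2 : q * L ≤ J + L := by
    have := Nat.div_mul_le_self J L
    rw [hq, add_mul, one_mul]
    omega
  obtain ⟨i, hi, hia⟩ := hk (θ.colPow M q b) a
  refine ⟨((q * L - J + i * ℓ ^ m + j : ℕ) : ℤ), fun t ht => ?_⟩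
  have hr : j + t + i * ℓ ^ m < L := by
    rw [hL, pow_add, mul_comm (ℓ ^ m)]
    calc j + t + i * ℓ ^ m < ℓ ^ m + i * ℓ ^ m := by omega
      _ = (i + 1) * ℓ ^ m := by ring
      _ ≤ _ := Nat.mul_le_mul_right _ hi
  have h1 := hx (q * L - J + i * ℓ ^ m + j + t) (by omega)
  simp only [zero_add] at h1
  rw [hw t ht, ← hia, ← Nat.cast_add, h1]
  have h2 : J + (q * L - J + i * ℓ ^ m + j + t) = (j + t + i * ℓ ^ m) + q * L := by omega
  rw [h2, hL, colPow_add _ _ _ _ _ hr, colPow_add _ _ _ _ _ (by omega)]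
  rfl

theorem IsAdmissible.exists_letter (hθ : θ.IsAdmissible) (x : θ.X) (a : A) :
    ∃ p : ℤ, x.1 p = a := by
  obtain ⟨p, hp⟩ := hθ.exists_occurrence x (n := 1) (w := fun _ => a)
    ⟨a, 0, 0, by simp, fun t _ => rfl⟩
  exact ⟨p, by simpa using hp 0⟩

variable [TopologicalSpace A] [DiscreteTopology A] [Finite A]

theorem IsAdmissible.nonempty (hθ : θ.IsAdmissible) [Nonempty A] : Nonempty θ.X := by
  obtain ⟨a⟩ := ‹Nonempty A›
  have hl := hθ.two_le
  -- A block of length `ℓ^(2n)` placed at `-ℓ^n`, so that it grows in both directions.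
  set F : ℕ → ℤ → A := fun n k => θ.act^[n + n] (fun _ => a) (k + (ℓ : ℤ) ^ n)
  obtain ⟨u, -, hu⟩ := isCompact_univ.ultrafilter_le_nhds' ((hyperfilter ℕ).map F) univ_mem
  have hu' : Tendsto F (hyperfilter ℕ) (𝓝 u) := hu
  rw [tendsto_pi_nhds] at hu'
  simp only [nhds_discrete, tendsto_pure] at hu'
  refine ⟨u, fun k m => ?_⟩
  have h1 : ∀ᶠ n in (hyperfilter ℕ : Filter ℕ), ∀ t ∈ Finset.range m, F n (k + t) = u (k + t) :=
    (eventually_all_finset _).mpr fun t _ => hu' _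
  have h2 : ∀ᶠ n in (hyperfilter ℕ : Filter ℕ), k.natAbs + m + 1 ≤ n :=
    Nat.hyperfilter_le_atTop (eventually_ge_atTop _)
  obtain ⟨n, h1, h2⟩ := (h1.and h2).exists
  have hn : n < ℓ ^ n := Nat.lt_pow_self (by omega)
  obtain ⟨j, hj⟩ : ∃ j : ℕ, k + (ℓ : ℤ) ^ n = j := by
    apply Int.eq_ofNat_of_zero_le
    have : (n : ℤ) < (ℓ : ℤ) ^ n := by exact_mod_cast hn
    omega
  have hj2 : j + m ≤ ℓ ^ (n + n) := by
    have h3 : ℓ ^ n + ℓ ^ n ≤ ℓ ^ (n + n) := by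
      rw [pow_add]
      have : 2 ≤ ℓ ^ n := by omega
      nlinarith
    have h4 : k + ((ℓ ^ n : ℕ) : ℤ) = j := by exact_mod_cast hj
    omega
  refine ⟨a, n + n, j, hj2, fun t ht => ?_⟩
  have := h1 t (Finset.mem_range.mpr ht)
  refine this.symm.trans ?_
  show θ.act^[n + n] (fun _ => a) (k + t + (ℓ : ℤ) ^ n) = _
  have h5 := θ.act_iterate_mul_add (fun _ => a) (n + n) 0 (j + t) (by omega)
  have h6 : k + t + (ℓ : ℤ) ^ n = 0 * (ℓ : ℤ) ^ (n + n) + (j + t : ℕ) := by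
    push_cast
    linear_combination hj
  rw [← h5, h6]

/-- The Ellis semigroup acts transitively. -/
theorem IsAdmissible.exists_ellis_apply_eq (hθ : θ.IsAdmissible) (x y : θ.X) :
    ∃ f ∈ θ.ellis, f x = y := by
  choose p hp using fun N : ℕ => hθ.exists_occurrence x (y.2 (-N) (2 * N + 1))
  obtain ⟨f, hf, h⟩ := θ.exists_isLim_seq_apply fun N => p N + N
  refine ⟨f, hf, Subtype.ext (funext fun k => h x k _ ?_)⟩
  filter_upwards [eventually_ge_atTop k.natAbs] with N hN
  have := hp N (k + N).toNat (by omega)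
  rw [Int.toNat_of_nonneg (by omega)] at this
  rw [show k + (p N + N) = p N + (k + N) by ring, this, show -(N : ℤ) + (k + N) = k by ring]

/-! ### Fixed points -/

theorem IsAdmissible.exists_point (hθ : θ.IsAdmissible) [Nonempty A] (a : A) :
    ∃ x : θ.X, x.1 0 = a := by
  obtain ⟨x⟩ := hθ.nonempty
  obtain ⟨p, hp⟩ := hθ.exists_letter x a
  exact ⟨θ.shift p x, by rw [shift_apply, zero_add, hp]⟩

theorem iterate_mul_eq {α : Type*} {f : α → α} {a : α} {p : ℕ} (h : f^[p] a = a) (q : ℕ) :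
    f^[p * q] a = a := by
  rw [Function.iterate_mul]
  exact Function.iterate_fixed h q

/-- Powers of `e₊` and `e₋` fix the central letters of `θ(x)`, which therefore generate a
`θ`-periodic point. By simplification it is `θ`-fixed, so `e₊` and `e₋` themselves fix these
letters. -/
theorem IsAdmissible.idem_central (hθ : θ.IsAdmissible) (x : θ.X) :
    θ.ePlus (θ.ePlus (x.1 0)) = θ.ePlus (x.1 0) ∧
      θ.eMinus (θ.eMinus (x.1 (-1))) = θ.eMinus (x.1 (-1)) := by
  obtain ⟨p, hp, hpe⟩ := hθ.simp.exists_iterate_eq θ.sgp_ePlus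
  obtain ⟨q, hq, hqe⟩ := hθ.simp.exists_iterate_eq θ.sgp_eMinus
  obtain ⟨z, hz, hz0, hz1⟩ := exists_act_iterate_fixed hθ.two_le (Nat.mul_pos hp hq) (θ.actX x)
    (by
      show θ.act^[p * q] (θ.act x.1) 0 = θ.act x.1 0
      rw [act_iterate_zero, act_zero]
      exact iterate_mul_eq (hpe _ ⟨_, rfl⟩) q)
    (by
      show θ.act^[p * q] (θ.act x.1) (-1) = θ.act x.1 (-1)
      rw [act_iterate_neg_one, act_neg_one, mul_comm]
      exact iterate_mul_eq (hqe _ ⟨_, rfl⟩) p)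
  have hfix := hθ.simp.periodic_fixed _ z.2 _ (Nat.mul_pos hp hq) hz
  have h0 : z.1 0 = θ.ePlus (x.1 0) := hz0.trans (θ.act_zero _)
  have h1 : z.1 (-1) = θ.eMinus (x.1 (-1)) := hz1.trans (θ.act_neg_one _)
  rw [← h0, ← h1, ← act_zero, ← act_neg_one, hfix]
  exact ⟨rfl, rfl⟩

theorem IsAdmissible.ePlus_idem (hθ : θ.IsAdmissible) (a : A) :
    θ.ePlus (θ.ePlus a) = θ.ePlus a := by
  have : Nonempty A := ⟨a⟩
  obtain ⟨x, rfl⟩ := hθ.exists_point a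
  exact (hθ.idem_central x).1

theorem IsAdmissible.eMinus_idem (hθ : θ.IsAdmissible) (a : A) :
    θ.eMinus (θ.eMinus a) = θ.eMinus a := by
  have : Nonempty A := ⟨a⟩
  obtain ⟨x, rfl⟩ := hθ.exists_point a
  have := (hθ.idem_central (θ.shift 1 x)).2
  rwa [shift_apply, neg_add_cancel] at this

theorem IsAdmissible.ePlus_comp (hθ : θ.IsAdmissible) : θ.ePlus ∘ θ.ePlus = θ.ePlus :=
  funext hθ.ePlus_idem

theorem IsAdmissible.eMinus_comp (hθ : θ.IsAdmissible) : θ.eMinus ∘ θ.eMinus = θ.eMinus :=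
  funext hθ.eMinus_idem

theorem IsAdmissible.exists_fixed (hθ : θ.IsAdmissible) (x : θ.X) :
    ∃ u ∈ θ.fixedPts, u.1 0 = θ.ePlus (x.1 0) ∧ u.1 (-1) = θ.eMinus (x.1 (-1)) := by
  have h0 : θ.act x.1 0 = θ.ePlus (x.1 0) := act_zero _ _
  have h1 : θ.act x.1 (-1) = θ.eMinus (x.1 (-1)) := act_neg_one _ _
  obtain ⟨z, hz, hz0, hz1⟩ := exists_act_iterate_fixed hθ.two_le one_pos (θ.actX x)
    (by
      show θ.act (θ.act x.1) 0 = θ.act x.1 0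
      rw [act_zero, h0, hθ.ePlus_idem])
    (by
      show θ.act (θ.act x.1) (-1) = θ.act x.1 (-1)
      rw [act_neg_one, h1, hθ.eMinus_idem])
  exact ⟨z, hz, hz0.trans h0, hz1.trans h1⟩

theorem fixedPts_zero {u : θ.X} (hu : u ∈ θ.fixedPts) : θ.ePlus (u.1 0) = u.1 0 := by
  have h : θ.act u.1 = u.1 := hu
  rw [← act_zero, h]

theorem fixedPts_neg_one {u : θ.X} (hu : u ∈ θ.fixedPts) : θ.eMinus (u.1 (-1)) = u.1 (-1) := by
  have h : θ.act u.1 = u.1 := hu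
  rw [← act_neg_one, h]

/-! ### Asymptotic points and the number of words -/

/-- The Morse–Hedlund argument: if words of length `k` determined the letter on their left, they
would determine the whole left side. A word occurring twice in `x` would make `x` periodic to the
left, and a limit along `-∞` would be a periodic point. -/
theorem IsAdmissible.exists_left_special (hθ : θ.IsAdmissible) [Nonempty A] (k : ℕ) :
    ∃ x y : θ.X, (∀ t : ℤ, 0 ≤ t → t < k → x.1 t = y.1 t) ∧ x.1 (-1) ≠ y.1 (-1) := by
  by_contra! hcon
  have hext : ∀ (x y : θ.X), (∀ t : ℤ, 0 ≤ t → t < k → x.1 t = y.1 t) → ∀ m : ℕ, ∀ t : ℤ, -m ≤ t →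
      t < k → x.1 t = y.1 t := by
    intro x y h m
    induction m with
    | zero =>
      intro t h1 h2
      exact h t (by simpa using h1) h2
    | succ m ih =>
      intro t h1 h2
      by_cases ht : -(m : ℤ) ≤ t
      · exact ih t ht h2
      · have := hcon (θ.shift (-m) x) (θ.shift (-m) y) fun s hs hs' => by
          rw [shift_apply, shift_apply]
          exact ih _ (by omega) (by omega)
        rw [shift_apply, shift_apply] at this
        push_cast at h1
        rwa [show t = -1 + -(m : ℤ) by omega]
  obtain ⟨x⟩ := hθ.nonempty
  obtain ⟨i, j, hij, hw⟩ := Finite.exists_ne_map_eq_of_infinite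
    (fun (i : ℕ) (t : Fin k) => x.1 (t + i))
  have hagree : ∀ t : ℤ, t < k → x.1 (t + i) = x.1 (t + j) := fun t ht => by
    refine hext (θ.shift i x) (θ.shift j x) (fun s hs hs' => ?_) t.natAbs t (by omega) ht
    have := congrFun hw ⟨s.toNat, by omega⟩
    simp only [Int.toNat_of_nonneg hs] at this
    exact this
  obtain ⟨f, hf, U, hU, hs⟩ := θ.exists_isLim_seq fun m => -(m : ℤ)
  refine hθ.aper (f x) (j - i) ?_ ?_
  · have : (i : ℤ) ≠ j := by exact_mod_cast hij
    omega
  rw [← ellis_comm hf]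
  apply Subtype.ext
  funext t
  have h1 : ∀ᶠ n in (U : Filter ℤ), t + n - i < k := by
    refine hs (fun n => t + n - i < k) ?_
    filter_upwards [eventually_ge_atTop (t - i - k + 1).natAbs] with m hm
    omega
  obtain ⟨n, h1, h2, h3⟩ := (h1.and ((hU x t).and (hU (θ.shift (j - i) x) t))).exists
  rw [← h2, ← h3, shift_apply]
  have := hagree _ h1
  rw [show t + n + (j - i) = t + n - i + j by ring, ← this, sub_add_cancel]

/-- There are two distinct right asymptotic points. -/
theorem IsAdmissible.exists_asymptotic (hθ : θ.IsAdmissible) [Nonempty A] :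
    ∃ x y : θ.X, (∀ t : ℤ, 0 ≤ t → x.1 t = y.1 t) ∧ x.1 (-1) ≠ y.1 (-1) := by
  choose F G hFG hne using hθ.exists_left_special
  obtain ⟨x, -, hx⟩ := isCompact_univ.ultrafilter_le_nhds' ((hyperfilter ℕ).map F) univ_mem
  obtain ⟨y, -, hy⟩ := isCompact_univ.ultrafilter_le_nhds' ((hyperfilter ℕ).map G) univ_mem
  have hx' : Tendsto F (hyperfilter ℕ) (𝓝 x) := hx
  have hy' : Tendsto G (hyperfilter ℕ) (𝓝 y) := hy
  rw [tendsto_iff] at hx' hy'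
  refine ⟨x, y, fun t ht => ?_, ?_⟩
  · have h2 : ∀ᶠ n in (hyperfilter ℕ : Filter ℕ), t.toNat + 1 ≤ n :=
      Nat.hyperfilter_le_atTop (eventually_ge_atTop _)
    obtain ⟨n, h1, h2, h3⟩ := ((hx' t).and ((hy' t).and h2)).exists
    rw [← h1, ← h2]
    exact hFG n t ht (by omega)
  · obtain ⟨n, h1, h2⟩ := ((hx' (-1)).and (hy' (-1))).exists
    rw [← h1, ← h2]
    exact hne n

/-- The set of words of length `k` of `X_θ`. -/
def words (θ : Subst A ℓ) (k : ℕ) : Set (Fin k → A) := Set.range fun (x : θ.X) t => x.1 (t : ℕ)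

/-- Deleting the first letter maps words of length `k + 1` onto words of length `k`, and a left
special word prevents injectivity. -/
theorem IsAdmissible.lt_ncard_words (hθ : θ.IsAdmissible) [Nonempty A] (k : ℕ) :
    k < (θ.words k).ncard := by
  induction k with
  | zero =>
    obtain ⟨x⟩ := hθ.nonempty
    rw [Set.ncard_pos (Set.toFinite _)]
    exact ⟨_, x, rfl⟩
  | succ k ih =>
    refine lt_of_le_of_lt ih ?_
    set d : (Fin (k + 1) → A) → (Fin k → A) := fun w t => w t.succ
    have himg : d '' θ.words (k + 1) = θ.words k := by
      ext w
      constructor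
      · rintro ⟨_, ⟨x, rfl⟩, rfl⟩
        exact ⟨θ.shift 1 x, by funext t; simp [d, shift_apply]⟩
      · rintro ⟨x, rfl⟩
        exact ⟨_, ⟨θ.shift (-1) x, rfl⟩, by funext t; simp [d, shift_apply]⟩
    rw [← himg]
    refine lt_of_le_of_ne (Set.ncard_image_le (Set.toFinite _)) fun heq => ?_
    have hinj := (Set.ncard_image_iff (Set.toFinite _)).mp heq
    obtain ⟨x, y, hxy, hne⟩ := hθ.exists_left_special k
    have := hinj ⟨θ.shift (-1) x, rfl⟩ ⟨θ.shift (-1) y, rfl⟩ (by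
      funext t
      simp only [d, shift_apply, Fin.val_succ, Nat.cast_add, Nat.cast_one, add_neg_cancel_right]
      exact hxy _ (by positivity) (by exact_mod_cast t.2))
    apply hne
    simpa [shift_apply] using congrFun this 0

end Minimal

end Subst

end EllisQB

/-! ### Topology of the odometer and recognizability. -/

namespace EllisQB

open Filter Topology

theorem exists_eventually_eq {α β : Type*} [Finite β] (U : Ultrafilter α) (F : α → β) :
    ∃ b, ∀ᶠ a in (U : Filter α), F a = b := by
  obtain ⟨b, hb⟩ := (U.map F).eq_pure_of_finite
  refine ⟨b, ?_⟩
  have : {b} ∈ U.map F := by rw [hb]; exact rfl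
  exact this

theorem equicontinuous_comap_pi_bot {X Y ι κ : Type*} [TopologicalSpace X] {β : κ → Type*}
    (f : Y → ∀ n, β n) (F : ι → X → Y)
    (H : ∀ x n, ∀ᶠ x' in 𝓝 x, ∀ i, f (F i x) n = f (F i x') n) :
    Equicontinuous (uα := UniformSpace.comap f (@Pi.uniformSpace κ β (fun _ => ⊥))) F := by
  let _i : ∀ n, UniformSpace (β n) := fun _ => ⊥
  have hU : UniformSpace.comap f (@Pi.uniformSpace κ β (fun _ => ⊥))
      = ⨅ n, UniformSpace.comap (fun y => f y n) ⊥ := by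
    simp only [Pi.uniformSpace_eq, UniformSpace.comap_iInf, ← UniformSpace.comap_comap]
    rfl
  rw [hU, equicontinuous_iInf_rng]
  intro n x V hV
  obtain ⟨W, hW, hWV⟩ := mem_comap.mp hV
  filter_upwards [H x n] with x' hx' i
  apply hWV
  show (f (F i x) n, f (F i x') n) ∈ W
  rw [hx']
  exact refl_mem_uniformity hW

/-! ### The odometer -/

namespace Odometer

variable {ℓ h : ℕ}

theorem ext_level {a b : Odometer ℓ h} (H : ∀ n, a.1 n = b.1 n) : a = b :=
  Subtype.ext (funext H)

theorem add_level (a b : Odometer ℓ h) (n : ℕ) : (a + b).1 n = a.1 n + b.1 n := rfl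

theorem zero_level (n : ℕ) : (0 : Odometer ℓ h).1 n = 0 := rfl

theorem zsmul_one_level (m : ℤ) (n : ℕ) : (m • one ℓ h).1 n = m := by
  have : (m • one ℓ h).1 n = m • (1 : ZMod (ℓ ^ n * h)) := rfl
  rw [this, zsmul_one]

theorem castHom_level (a : Odometer ℓ h) (n : ℕ) :
    ZMod.castHom (mul_dvd_mul_right (pow_dvd_pow ℓ n.le_succ) h) (ZMod (ℓ ^ n * h)) (a.1 (n + 1))
      = a.1 n := a.2 n

theorem level_eq_intCast_of_le (a : Odometer ℓ h) {m : ℤ} {n n' : ℕ} (hn : n ≤ n')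
    (ha : a.1 n' = m) : a.1 n = m := by
  induction n', hn using Nat.le_induction with
  | base => exact ha
  | succ k hk ih =>
    apply ih
    rw [← castHom_level, ha, map_intCast]

/-- Each level has finitely many values, so closed level sets are clopen. The level sets of the
address are compact images, hence closed. -/
theorem continuous_of_isClosed [NeZero ℓ] [NeZero h] {Y : Type*} [TopologicalSpace Y]
    {f : Y → Odometer ℓ h} (H : ∀ n c, IsClosed {y | (f y).1 n = c}) : Continuous f := by
  let _i : ∀ n, UniformSpace (ZMod (ℓ ^ n * h)) := fun _ => ⊥
  refine continuous_induced_rng.mpr (continuous_pi fun n => ?_)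
  rw [continuous_iff_isClosed]
  intro s _
  have hne : NeZero (ℓ ^ n * h) := ⟨mul_ne_zero (pow_ne_zero _ (NeZero.ne ℓ)) (NeZero.ne h)⟩
  have : (fun y => (f y).1 n) ⁻¹' s = ⋃ c ∈ s, {y | (f y).1 n = c} := by
    ext y
    simp
  have h2 := Set.Finite.isClosed_biUnion (Set.toFinite s) (fun c _ => H n c)
  rw [← this] at h2
  exact h2

theorem isOpen_level (n : ℕ) (c : ZMod (ℓ ^ n * h)) : IsOpen {a : Odometer ℓ h | a.1 n = c} := by
  let _i : ∀ n, UniformSpace (ZMod (ℓ ^ n * h)) := fun _ => ⊥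
  have h1 : Continuous fun a : Odometer ℓ h => a.1 n :=
    (continuous_apply n).comp (continuous_induced_dom (f := fun z : Odometer ℓ h => z.1))
  exact (isOpen_discrete {c}).preimage h1

instance : T2Space (Odometer ℓ h) := by
  refine ⟨fun a b hab => ?_⟩
  obtain ⟨n, hn⟩ : ∃ n, a.1 n ≠ b.1 n := by
    by_contra! H
    exact hab (ext_level H)
  refine ⟨_, _, isOpen_level n (a.1 n), isOpen_level n (b.1 n), rfl, rfl, ?_⟩
  rw [Set.disjoint_left]
  intro c hc hc'
  exact hn (hc.symm.trans hc')

theorem equicontinuous_act : Equicontinuous (act ℓ h) := by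
  refine equicontinuous_comap_pi_bot (fun z : Odometer ℓ h => z.1) _ fun z n => ?_
  filter_upwards [(isOpen_level n (z.1 n)).mem_nhds rfl] with z' hz' m
  have h1 : z'.1 n = z.1 n := hz'
  show (z + m • one ℓ h).1 n = (z' + m • one ℓ h).1 n
  rw [add_level, add_level, h1]

end Odometer

namespace Subst

/-! ### Recognizability -/

section Recognizability

variable {A : Type u} {ℓ : ℕ} [NeZero ℓ] {θ : Subst A ℓ}
variable [TopologicalSpace A] [DiscreteTopology A] [Finite A]

/-- Dividing `m` by `ℓ^n` with remainder `i` turns `σ^m θ^n` into `σ^i θ^n σ^(m / ℓ^n)`; then pass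
to the limit. -/
theorem IsLim.actX_iterate {U V : Ultrafilter ℤ} {f g : θ.X → θ.X} (hf : θ.IsLim U f)
    (hg : θ.IsLim V g) {n : ℕ} {i : ℤ} (hU : ∀ᶠ m in (U : Filter ℤ), m % (ℓ : ℤ) ^ n = i)
    (hUV : U.map (fun m => m / (ℓ : ℤ) ^ n) = V) (y : θ.X) :
    f (θ.actX^[n] y) = θ.shift i (θ.actX^[n] (g y)) := by
  subst hUV
  apply Subtype.ext
  funext k
  obtain ⟨q, r, hr, hk⟩ := exists_eq_mul_add (ℓ := ℓ) n (k + i)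
  rw [shift_apply, hk, actX_iterate_apply _ _ _ _ _ hr]
  have h3 : ∀ᶠ m in (U : Filter ℤ), y.1 (q + m / (ℓ : ℤ) ^ n) = (g y).1 q := hg y q
  obtain ⟨m, h1, h2, h3⟩ := (hU.and ((hf (θ.actX^[n] y) k).and h3)).exists
  rw [← h2, ← h3]
  have h4 := Int.ediv_mul_add_emod m ((ℓ : ℤ) ^ n)
  have h5 : k + m = (q + m / (ℓ : ℤ) ^ n) * (ℓ : ℤ) ^ n + r := by
    rw [h1] at h4
    linear_combination hk - h4
  rw [h5, actX_iterate_apply _ _ _ _ _ hr]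

theorem pow_pos_int (n : ℕ) : (0 : ℤ) < (ℓ : ℤ) ^ n := by
  have := pos_length (ℓ := ℓ)
  positivity

/-- By transitivity `x = f(θ^n(x))` for some `f ∈ E`, and the residue modulo `ℓ^n` is constant along
an ultrafilter of `f`. -/
theorem IsAdmissible.exists_shift_actX (hθ : θ.IsAdmissible) (n : ℕ) (x : θ.X) :
    ∃ i : ℕ, i < ℓ ^ n ∧ ∃ y, x = θ.shift i (θ.actX^[n] y) := by
  obtain ⟨f, hf, hfx⟩ := hθ.exists_ellis_apply_eq (θ.actX^[n] x) x
  obtain ⟨U, hU⟩ := mem_ellis_iff.mp hf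
  have hlt : ∀ m : ℤ, (m % (ℓ : ℤ) ^ n).toNat < ℓ ^ n := fun m => by
    have := Int.emod_lt_of_pos m (pow_pos_int (ℓ := ℓ) n)
    have h2 := Int.emod_nonneg m (pow_pos_int (ℓ := ℓ) n).ne'
    zify
    rwa [Int.toNat_of_nonneg h2]
  obtain ⟨i, hi⟩ := exists_eventually_eq U
    (fun m : ℤ => (⟨(m % (ℓ : ℤ) ^ n).toNat, hlt m⟩ : Fin (ℓ ^ n)))
  obtain ⟨g, -, hg⟩ := θ.exists_isLim (U.map fun m => m / (ℓ : ℤ) ^ n)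
  refine ⟨i, i.2, g x, hfx.symm.trans ?_⟩
  refine hU.actX_iterate hg ?_ rfl x
  filter_upwards [hi] with m hm
  rw [← hm]
  exact (Int.toNat_of_nonneg (Int.emod_nonneg m (pow_pos_int (ℓ := ℓ) n).ne')).symm

/-- If two translates of `θ^n(X_θ)` meet, then one contains the other. -/
theorem IsAdmissible.exists_actX_eq_shift (hθ : θ.IsAdmissible) {n : ℕ} {j : ℤ} {y y' : θ.X}
    (h : θ.actX^[n] y = θ.shift j (θ.actX^[n] y')) (w : θ.X) :
    ∃ w', θ.actX^[n] w = θ.shift j (θ.actX^[n] w') := by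
  obtain ⟨g, hg, rfl⟩ := hθ.exists_ellis_apply_eq y w
  obtain ⟨V, hV⟩ := mem_ellis_iff.mp hg
  have hL := (pow_pos_int (ℓ := ℓ) n).ne'
  -- A limit along multiples of `ℓ^n` satisfies `f θ^n = θ^n g`, so applying `f` to the given
  -- relation carries it from `y` to `g y = w`.
  obtain ⟨f, -, hf⟩ := θ.exists_isLim (V.map fun m => (ℓ : ℤ) ^ n * m)
  have key : ∀ z, f (θ.actX^[n] z) = θ.actX^[n] (g z) := fun z => by
    have := hf.actX_iterate hV (n := n) (i := 0)
      (Filter.eventually_map.mpr (Eventually.of_forall fun m => by simp))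
      (by
        rw [Ultrafilter.map_map]
        convert Ultrafilter.map_id V using 2
        funext m
        simp [hL]) z
    rwa [shift_zero] at this
  exact ⟨g y', by rw [← key, h, hf.comm, key]⟩

/-- An overlap makes the residue `0` redundant, since `θ^n(X_θ)` lies in its translate by `j`. Each
of `k` successive desubstitutions by `θ^n` then needs only `ℓ^n - 1` residues. -/
theorem IsAdmissible.exists_small_cover (hθ : θ.IsAdmissible) {n : ℕ} {j : ℕ} (hj : 0 < j)
    (hjn : j < ℓ ^ n) {y y' : θ.X} (h : θ.actX^[n] y = θ.shift j (θ.actX^[n] y')) (k : ℕ) :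
    ∃ F : Finset ℕ, F.card ≤ (ℓ ^ n - 1) ^ k ∧
      ∀ x : θ.X, ∃ s ∈ F, ∃ z, x = θ.shift s (θ.actX^[n * k] z) := by
  classical
  induction k with
  | zero => exact ⟨{0}, by simp, fun x => ⟨0, by simp, x, by simp [shift_zero]⟩⟩
  | succ k ih =>
    obtain ⟨F, hF, hcov⟩ := ih
    refine ⟨(Finset.Ico 1 (ℓ ^ n) ×ˢ F).image fun p => p.1 + ℓ ^ n * p.2, ?_, fun x => ?_⟩
    · refine Finset.card_image_le.trans ?_
      rw [Finset.card_product, Nat.card_Ico, pow_succ, mul_comm]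
      exact Nat.mul_le_mul_right _ hF
    · obtain ⟨i, hi, hi0, z, hz⟩ : ∃ i : ℕ, i < ℓ ^ n ∧ 0 < i ∧ ∃ z,
          x = θ.shift i (θ.actX^[n] z) := by
        obtain ⟨i, hi, z, hz⟩ := hθ.exists_shift_actX n x
        rcases Nat.eq_zero_or_pos i with rfl | h0
        · obtain ⟨w, hw⟩ := hθ.exists_actX_eq_shift h z
          exact ⟨j, hjn, hj, w, by rw [hz, hw, Nat.cast_zero, shift_zero]⟩
        · exact ⟨i, hi, h0, z, hz⟩
      obtain ⟨s, hs, w, hw⟩ := hcov z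
      refine ⟨i + ℓ ^ n * s, Finset.mem_image.mpr ⟨(i, s), ?_, rfl⟩, w, ?_⟩
      · simp only [Finset.mem_product, Finset.mem_Ico]
        exact ⟨⟨hi0, hi⟩, hs⟩
      · rw [hz, hw, actX_iterate_shift, shift_shift, ← Function.iterate_add_apply,
          show n * (k + 1) = n + n * k by ring]
        push_cast
        rfl

/-- A word of length `ℓ^(nk)` lies in two consecutive blocks, so an overlap leaves at most `(ℓ^n -
1)^k |A|²` such words. For large `k` this is less than `ℓ^(nk)`, against the lower bound for the
complexity. -/
theorem IsAdmissible.not_overlap (hθ : θ.IsAdmissible) {n : ℕ} {j : ℕ} (hj : 0 < j)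
    (hjn : j < ℓ ^ n) (y y' : θ.X) : θ.actX^[n] y ≠ θ.shift j (θ.actX^[n] y') := by
  classical
  intro h
  have : Nonempty A := ⟨y.1 0⟩
  have hbound : ∀ k, ℓ ^ (n * k) < (ℓ ^ n - 1) ^ k * (Nat.card A * Nat.card A) := fun k => by
    obtain ⟨F, hF, hcov⟩ := hθ.exists_small_cover hj hjn h k
    set N := n * k
    refine lt_of_lt_of_le (hθ.lt_ncard_words (ℓ ^ N)) ?_
    set P : ℕ × A × A → (Fin (ℓ ^ N) → A) := fun p t =>
      if (t : ℕ) + p.1 % ℓ ^ N < ℓ ^ N then θ.colPow N (t + p.1 % ℓ ^ N) p.2.1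
      else θ.colPow N (t + p.1 % ℓ ^ N - ℓ ^ N) p.2.2
    have hsub : θ.words (ℓ ^ N) ⊆ P '' ((F : Set ℕ) ×ˢ Set.univ) := by
      rintro _ ⟨x, rfl⟩
      obtain ⟨s, hs, z, rfl⟩ := hcov x
      refine ⟨(s, z.1 (s / ℓ ^ N : ℕ), z.1 ((s / ℓ ^ N : ℕ) + 1)), ⟨hs, trivial⟩, ?_⟩
      funext t
      have hmod : (s : ℤ) = (s / ℓ ^ N : ℕ) * (ℓ : ℤ) ^ N + (s % ℓ ^ N : ℕ) := by
        exact_mod_cast (Nat.div_add_mod' s (ℓ ^ N)).symm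
      have hlt : s % ℓ ^ N < ℓ ^ N := Nat.mod_lt _ (by have := pos_length (ℓ := ℓ); positivity)
      simp only [P, shift_apply]
      split_ifs with hc
      · rw [← actX_iterate_apply _ _ _ _ _ hc]
        refine congrArg (θ.actX^[N] z).1 ?_
        push_cast at hmod ⊢
        linear_combination -hmod
      · rw [← actX_iterate_apply _ _ _ _ _ (by omega : (t : ℕ) + s % ℓ ^ N - ℓ ^ N < ℓ ^ N)]
        refine congrArg (θ.actX^[N] z).1 ?_
        rw [Nat.cast_sub (by omega)]
        push_cast at hmod ⊢
        linear_combination -hmod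
    calc (θ.words (ℓ ^ N)).ncard ≤ (P '' ((F : Set ℕ) ×ˢ Set.univ)).ncard :=
          Set.ncard_le_ncard hsub (Set.toFinite _)
      _ ≤ ((F : Set ℕ) ×ˢ (Set.univ : Set (A × A))).ncard := Set.ncard_image_le (Set.toFinite _)
      _ = F.card * (Nat.card A * Nat.card A) := by
          rw [Set.ncard_prod, Set.ncard_coe_finset, Set.ncard_univ, Nat.card_prod]
      _ ≤ _ := Nat.mul_le_mul_right _ hF
  have h1 : (0 : ℝ) < (ℓ ^ n - 1 : ℕ) := by
    have : 0 < ℓ ^ n - 1 := by omega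
    exact_mod_cast this
  have h2 : 1 < ((ℓ ^ n : ℕ) : ℝ) / (ℓ ^ n - 1 : ℕ) := by
    rw [one_lt_div h1]
    have : ℓ ^ n - 1 < ℓ ^ n := by omega
    exact_mod_cast this
  obtain ⟨k, hk⟩ := pow_unbounded_of_one_lt ((Nat.card A * Nat.card A : ℕ) : ℝ) h2
  rw [div_pow, lt_div_iff₀ (by positivity)] at hk
  have h3 := hbound k
  rw [pow_mul] at h3
  have h4 : Nat.card A * Nat.card A * (ℓ ^ n - 1) ^ k < (ℓ ^ n) ^ k := by exact_mod_cast hk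
  rw [mul_comm] at h4
  omega

theorem IsAdmissible.dvd_of_shift_actX (hθ : θ.IsAdmissible) {n : ℕ} {k k' : ℤ} {y y' : θ.X}
    (h : θ.shift k (θ.actX^[n] y) = θ.shift k' (θ.actX^[n] y')) : (ℓ : ℤ) ^ n ∣ k' - k := by
  obtain ⟨q, r, hr, hk⟩ := exists_eq_mul_add (ℓ := ℓ) n (k' - k)
  rcases Nat.eq_zero_or_pos r with rfl | h0
  · exact ⟨q, by rw [hk]; push_cast; ring⟩
  · refine absurd ?_ (hθ.not_overlap h0 hr y (θ.shift q y'))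
    rw [← θ.shift_neg_shift k (θ.actX^[n] y), h, actX_iterate_shift, shift_shift, shift_shift]
    congr 1
    linear_combination hk

end Recognizability

end Subst

end EllisQB

/-! ### The address map and the agreement of points in a fibre. -/

namespace EllisQB

open Filter Topology

namespace Subst

/-! ### The factor map onto the odometer -/

section Address

variable {A : Type u} {ℓ : ℕ} [NeZero ℓ] {θ : Subst A ℓ}
variable [TopologicalSpace A] [DiscreteTopology A] [Finite A]

/-- The position of the origin in the partition of `x` into images of letters under `θ^n`. -/
noncomputable def IsAdmissible.offset (hθ : θ.IsAdmissible) (n : ℕ) (x : θ.X) : ℕ :=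
  (hθ.exists_shift_actX n x).choose

theorem IsAdmissible.offset_spec (hθ : θ.IsAdmissible) (n : ℕ) (x : θ.X) :
    hθ.offset n x < ℓ ^ n ∧ ∃ y, x = θ.shift (hθ.offset n x) (θ.actX^[n] y) :=
  (hθ.exists_shift_actX n x).choose_spec

theorem IsAdmissible.offset_eq (hθ : θ.IsAdmissible) (n : ℕ) (k : ℤ) (y : θ.X) :
    ((hθ.offset n (θ.shift k (θ.actX^[n] y)) : ℕ) : ZMod (ℓ ^ n * 1)) = k := by
  obtain ⟨-, z, hz⟩ := hθ.offset_spec n (θ.shift k (θ.actX^[n] y))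
  rw [← Int.cast_natCast, ZMod.intCast_eq_intCast_iff_dvd_sub]
  push_cast
  rw [mul_one]
  exact hθ.dvd_of_shift_actX hz.symm

/-- The factor map onto the odometer. -/
noncomputable def IsAdmissible.address (hθ : θ.IsAdmissible) (x : θ.X) : Odometer ℓ 1 :=
  (⟨fun n => (hθ.offset n x : ℕ), fun n => by
    obtain ⟨-, z, hz⟩ := hθ.offset_spec (n + 1) x
    have h1 := hθ.offset_eq n (hθ.offset (n + 1) x) (θ.actX z)
    rw [← Function.iterate_succ_apply, ← hz] at h1
    rw [Int.cast_natCast] at h1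
    exact (map_natCast _ _).trans h1.symm⟩ : ↥(odometerSubgroup ℓ 1))

theorem IsAdmissible.address_level (hθ : θ.IsAdmissible) (n : ℕ) (k : ℤ) (y : θ.X) :
    (hθ.address (θ.shift k (θ.actX^[n] y))).1 n = k :=
  hθ.offset_eq n k y

theorem IsAdmissible.exists_eq_shift_actX (hθ : θ.IsAdmissible) (n : ℕ) (x : θ.X) :
    ∃ r : ℕ, r < ℓ ^ n ∧ (hθ.address x).1 n = r ∧ ∃ y, x = θ.shift r (θ.actX^[n] y) := by
  obtain ⟨h1, h2⟩ := hθ.offset_spec n x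
  exact ⟨_, h1, rfl, h2⟩

theorem IsAdmissible.address_shift (hθ : θ.IsAdmissible) (m : ℤ) (x : θ.X) :
    hθ.address (θ.shift m x) = hθ.address x + m • Odometer.one ℓ 1 := by
  apply Odometer.ext_level
  intro n
  obtain ⟨r, -, hr, y, hy⟩ := hθ.exists_eq_shift_actX n x
  rw [Odometer.add_level, hr, Odometer.zsmul_one_level, hy, shift_shift, address_level]
  push_cast
  ring

theorem IsAdmissible.level_eq_iff (hθ : θ.IsAdmissible) (n : ℕ) (k : ℤ) (x : θ.X) :
    (hθ.address x).1 n = k ↔ ∃ y, x = θ.shift k (θ.actX^[n] y) := by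
  constructor
  · intro h
    obtain ⟨r, -, hr, y, rfl⟩ := hθ.exists_eq_shift_actX n x
    rw [hr, ← Int.cast_natCast, ZMod.intCast_eq_intCast_iff_dvd_sub] at h
    push_cast at h
    rw [mul_one] at h
    obtain ⟨q, hq⟩ := h
    refine ⟨θ.shift (-q) y, ?_⟩
    rw [actX_iterate_shift, shift_shift]
    congr 1
    linear_combination -hq
  · rintro ⟨y, rfl⟩
    exact hθ.address_level n k y

theorem continuous_actX (θ : Subst A ℓ) : Continuous θ.actX := by
  refine Continuous.subtype_mk (continuous_pi fun k => ?_) _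
  exact continuous_of_discreteTopology.comp ((continuous_apply _).comp continuous_subtype_val)

theorem IsAdmissible.continuous_address (hθ : θ.IsAdmissible) : Continuous hθ.address := by
  refine Odometer.continuous_of_isClosed fun n c => ?_
  obtain ⟨k, rfl⟩ := ZMod.intCast_surjective c
  have : {x | (hθ.address x).1 n = k} = Set.range (fun y => θ.shift k (θ.actX^[n] y)) := by
    ext x
    rw [Set.mem_ofPred_eq, hθ.level_eq_iff]
    exact ⟨fun ⟨y, hy⟩ => ⟨y, hy.symm⟩, fun ⟨y, hy⟩ => ⟨y, hy.symm⟩⟩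
  rw [this]
  exact (isCompact_range ((θ.continuous_shift k).comp (θ.continuous_actX.iterate n))).isClosed

/-- Address `0` means desubstitution by every `θ^n` without a shift. The central letters then
determine `x` on `[-ℓ^n, ℓ^n)` for all `n`, and they are those of a fixed point. -/
theorem IsAdmissible.address_eq_zero_iff (hθ : θ.IsAdmissible) (x : θ.X) :
    hθ.address x = 0 ↔ x ∈ θ.fixedPts := by
  constructor
  · intro h
    have hdes : ∀ n, ∃ y, x = θ.actX^[n] y := fun n => by
      have := (hθ.level_eq_iff n 0 x).mp (by rw [h, Odometer.zero_level, Int.cast_zero])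
      simpa only [shift_zero] using this
    have h0 : θ.ePlus (x.1 0) = x.1 0 := by
      obtain ⟨y, hy⟩ := hdes 1
      rw [hy, actX_iterate, act_iterate_zero]
      exact hθ.ePlus_idem _
    have h1 : θ.eMinus (x.1 (-1)) = x.1 (-1) := by
      obtain ⟨y, hy⟩ := hdes 1
      rw [hy, actX_iterate, act_iterate_neg_one]
      exact hθ.eMinus_idem _
    obtain ⟨u, hu, hu0, hu1⟩ := hθ.exists_fixed x
    have : x = u := by
      apply Subtype.ext
      funext k
      have hk : |k| < (ℓ : ℤ) ^ k.natAbs := by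
        rw [Int.abs_eq_natAbs]
        exact_mod_cast Nat.lt_pow_self (lt_of_lt_of_le one_lt_two hθ.two_le)
      rw [abs_lt] at hk
      -- One extra power: the central letters of `θ(y)`, unlike those of `y`, lie in the ranges of
      -- `e₊` and `e₋`, hence equal those of `x`.
      obtain ⟨y, hy⟩ := hdes (k.natAbs + 1)
      have e0 : x.1 0 = (θ.actX y).1 0 := by
        rw [hy, actX_iterate, act_iterate_zero, Function.iterate_succ_apply,
          Function.iterate_fixed (hθ.ePlus_idem _)]
        exact (act_zero _ _).symm
      have e1 : x.1 (-1) = (θ.actX y).1 (-1) := by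
        rw [hy, actX_iterate, act_iterate_neg_one, Function.iterate_succ_apply,
          Function.iterate_fixed (hθ.eMinus_idem _)]
        exact (act_neg_one _ _).symm
      have h2 := θ.act_iterate_congr k.natAbs (u := (θ.actX y).1) (v := u.1)
        (by rw [← e0, hu0, h0]) (by rw [← e1, hu1, h1]) hk.1.le hk.2
      rw [Function.iterate_fixed (hu : θ.act u.1 = u.1)] at h2
      rw [← h2, ← actX_iterate, ← Function.iterate_succ_apply, ← hy]
    rwa [this]
  · intro h
    apply Odometer.ext_level
    intro n
    have h1 : θ.actX x = x := Subtype.ext h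
    have := hθ.address_level n 0 x
    rwa [Function.iterate_fixed h1, shift_zero, Int.cast_zero] at this

/-! ### Blocks -/

/-- The letters of `x` in the block of level `n` around the origin are given by one letter, through
column maps which depend on the address only. -/
theorem IsAdmissible.exists_block (hθ : θ.IsAdmissible) (n : ℕ) (ζ : Odometer ℓ 1)
    (hζ : ∃ x, hθ.address x = ζ) :
    ∃ r j : ℕ, r < ℓ ^ n ∧ j < ℓ ∧ ζ.1 n = r ∧ ∀ x, hθ.address x = ζ → ∃ a : A, ∀ t : ℕ,
      t < ℓ ^ n → x.1 ((t : ℤ) - r) = θ.colPow n t (θ.col (Fin.ofNat ℓ j) a) := by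
  obtain ⟨x₀, hx₀⟩ := hζ
  -- Level `n + 1` is used so that the letter generating the block of level `n` lies in the range of
  -- a column map, where columns are injective.
  obtain ⟨R, hR, hRζ, -⟩ := hθ.exists_eq_shift_actX (n + 1) x₀
  have hpos : 0 < ℓ ^ n := by
    have := pos_length (ℓ := ℓ)
    positivity
  have hdecomp := Nat.div_add_mod' R (ℓ ^ n)
  have hj : R / ℓ ^ n < ℓ := by
    rw [Nat.div_lt_iff_lt_mul hpos, ← pow_succ']
    exact hR
  rw [hx₀] at hRζ
  refine ⟨R % ℓ ^ n, R / ℓ ^ n, Nat.mod_lt _ hpos, hj, ?_, fun x hx => ?_⟩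
  · have h1 := Odometer.level_eq_intCast_of_le ζ (m := R) n.le_succ (by rw [hRζ]; simp)
    rw [h1, Int.cast_natCast]
    conv_lhs => rw [← hdecomp]
    have h2 : ((ℓ : ZMod (ℓ ^ n * 1)) ^ n) = 0 := by
      have := ZMod.natCast_self (ℓ ^ n * 1)
      rw [mul_one] at this
      push_cast at this
      convert this using 2 <;> rw [mul_one]
    rw [Nat.cast_add, Nat.cast_mul, Nat.cast_pow, h2, mul_zero, zero_add]
  · obtain ⟨y, hy⟩ := (hθ.level_eq_iff (n + 1) R x).mp (by rw [hx, hRζ]; simp)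
    refine ⟨y.1 0, fun t ht => ?_⟩
    have hlt : t + (R / ℓ ^ n) * ℓ ^ n < ℓ ^ (n + 1) := by
      rw [pow_succ']
      calc t + (R / ℓ ^ n) * ℓ ^ n < ℓ ^ n + (R / ℓ ^ n) * ℓ ^ n := by omega
        _ = (R / ℓ ^ n + 1) * ℓ ^ n := by ring
        _ ≤ _ := Nat.mul_le_mul_right _ hj
    have h1 := θ.colPow_add n 1 t (R / ℓ ^ n) ht
    have h2 := θ.actX_iterate_apply (n + 1) y 0 _ hlt
    rw [h1, zero_mul, zero_add] at h2
    rw [hy, shift_apply]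
    refine Eq.trans (congrArg (θ.actX^[n + 1] y).1 ?_) h2
    have : (R : ℤ) = (R / ℓ ^ n : ℕ) * (ℓ : ℤ) ^ n + (R % ℓ ^ n : ℕ) := by
      exact_mod_cast hdecomp.symm
    push_cast at this ⊢
    linear_combination this

theorem IsAdmissible.eventually_level (hθ : θ.IsAdmissible) {U : Ultrafilter ℤ} {f : θ.X → θ.X}
    (hf : θ.IsLim U f) (x : θ.X) (n : ℕ) :
    ∀ᶠ m : ℤ in (U : Filter ℤ), (hθ.address (f x)).1 n = (hθ.address x).1 n + m := by
  rw [isLim_iff, tendsto_pi_nhds] at hf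
  have h1 := (hθ.continuous_address.tendsto (f x)).comp (hf x)
  filter_upwards [h1.eventually ((Odometer.isOpen_level n _).mem_nhds rfl)] with m hm
  rw [← Odometer.zsmul_one_level, ← Odometer.add_level, ← address_shift]
  exact hm.symm

/-- The elements of the Ellis semigroup induce translations of the odometer. -/
theorem IsAdmissible.exists_translation (hθ : θ.IsAdmissible) {f : θ.X → θ.X} (hf : f ∈ θ.ellis) :
    ∃ ζ, ∀ x, hθ.address (f x) = hθ.address x + ζ := by
  obtain ⟨U, hU⟩ := mem_ellis_iff.mp hf
  rcases isEmpty_or_nonempty θ.X with h | ⟨⟨x₀⟩⟩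
  · exact ⟨0, fun x => h.elim x⟩
  · refine ⟨hθ.address (f x₀) - hθ.address x₀, fun x => ?_⟩
    rw [add_sub, eq_sub_iff_add_eq]
    apply Odometer.ext_level
    intro n
    obtain ⟨m, h1, h2⟩ := ((hθ.eventually_level hU x n).and (hθ.eventually_level hU x₀ n)).exists
    rw [Odometer.add_level, Odometer.add_level, h1, h2]
    ring

/-- Each translation of the odometer is induced by an element of the Ellis semigroup. -/
theorem IsAdmissible.exists_ellis_translation (hθ : θ.IsAdmissible) (ζ : Odometer ℓ 1) :
    ∃ f ∈ θ.ellis, ∀ x, hθ.address (f x) = hθ.address x + ζ := by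
  choose s hs using fun n => ZMod.intCast_surjective (ζ.1 n)
  obtain ⟨f, hf, U, hU, hUs⟩ := θ.exists_isLim_seq s
  refine ⟨f, hf, fun x => Odometer.ext_level fun n => ?_⟩
  have h1 : ∀ᶠ m : ℤ in (U : Filter ℤ), ζ.1 n = m := by
    refine hUs (fun m => ζ.1 n = m) ?_
    filter_upwards [eventually_ge_atTop n] with m hm
    exact Odometer.level_eq_intCast_of_le ζ hm (hs m).symm
  obtain ⟨m, h1, h2⟩ := (h1.and (hθ.eventually_level hU x n)).exists
  rw [h2, Odometer.add_level, h1]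

/-- Finitely many non-vanishing conditions are visible at a finite level. -/
theorem exists_level_ne_zero (ζ : Odometer ℓ 1) (F : Finset ℤ)
    (h : ∀ s ∈ F, ζ + s • Odometer.one ℓ 1 ≠ 0) : ∃ n, ∀ s ∈ F, ζ.1 n + s ≠ 0 := by
  classical
  induction F using Finset.induction_on with
  | empty => exact ⟨0, by simp⟩
  | insert s F hs ih =>
    obtain ⟨n, hn⟩ := ih fun t ht => h t (Finset.mem_insert_of_mem ht)
    obtain ⟨m, hm⟩ : ∃ m, ζ.1 m + s ≠ 0 := by
      by_contra! H
      refine h s (Finset.mem_insert_self _ _) (Odometer.ext_level fun m => ?_)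
      rw [Odometer.add_level, Odometer.zsmul_one_level, H, Odometer.zero_level]
    have up : ∀ (t : ℤ) (k k' : ℕ), k ≤ k' → ζ.1 k + t ≠ 0 → ζ.1 k' + t ≠ 0 := by
      intro t k k' hk h1 h2
      apply h1
      have := Odometer.level_eq_intCast_of_le ζ (m := -t) hk (by
        push_cast
        exact eq_neg_of_add_eq_zero_left h2)
      rw [this]
      push_cast
      ring
    refine ⟨max n m, fun t ht => ?_⟩
    rcases Finset.mem_insert.mp ht with rfl | ht
    · exact up _ m _ (le_max_right _ _) hm
    · exact up _ n _ (le_max_left _ _) (hn t ht)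

/-- In two points with the same address, the letters at `a < b` coincide simultaneously as soon as
the two positions belong to a common block. -/
theorem IsAdmissible.agree_iff (hθ : θ.IsAdmissible) {x y : θ.X}
    (hxy : hθ.address x = hθ.address y) {a b : ℤ} (hab : a ≤ b)
    (h : ∀ s, a < s → s ≤ b → hθ.address x + s • Odometer.one ℓ 1 ≠ 0) :
    x.1 a = y.1 a ↔ x.1 b = y.1 b := by
  have hx := hθ.address_shift a x
  have hy := hθ.address_shift a y
  rw [← hxy] at hy
  set ζ := hθ.address x + a • Odometer.one ℓ 1 with hζ
  obtain ⟨n, hn⟩ := exists_level_ne_zero ζ (Finset.Ioc 0 (b - a)) fun s hs => by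
    rw [Finset.mem_Ioc] at hs
    rw [hζ, add_assoc, ← add_smul]
    exact h _ (by omega) (by omega)
  obtain ⟨r, j, hr, hj, hrζ, hblock⟩ := hθ.exists_block n ζ ⟨_, hx⟩
  -- If the block ended at or before `b`, then `s = ℓ^n - r` would be a cut in `(a, b]`, visible as
  -- address `0` at level `n`.
  have hlt : (r : ℤ) + (b - a) < (ℓ : ℤ) ^ n := by
    by_contra! hle
    have hr' : (r : ℤ) < (ℓ : ℤ) ^ n := by exact_mod_cast hr
    refine hn ((ℓ : ℤ) ^ n - r) (Finset.mem_Ioc.mpr ⟨by omega, by omega⟩) ?_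
    have h2 : ((ℓ : ZMod (ℓ ^ n * 1)) ^ n) = 0 := by
      have := ZMod.natCast_self (ℓ ^ n * 1)
      rw [mul_one] at this
      push_cast at this
      convert this using 2 <;> rw [mul_one]
    rw [hrζ]
    push_cast
    rw [h2]
    ring
  obtain ⟨c, hc⟩ := hblock _ hx
  obtain ⟨d, hd⟩ := hblock _ hy
  have key : ∀ t : ℕ, t < ℓ ^ n → ((θ.shift a x).1 ((t : ℤ) - r) = (θ.shift a y).1 ((t : ℤ) - r) ↔
      θ.col (Fin.ofNat ℓ j) c = θ.col (Fin.ofNat ℓ j) d) := fun t ht => by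
    rw [hc t ht, hd t ht]
    constructor
    · intro h3
      rcases Nat.eq_zero_or_pos n with rfl | hn
      · exact h3
      · exact hθ.simp.injOn (Sgp.col n t hn ht) (sgp_col θ j) ⟨_, rfl⟩ ⟨_, rfl⟩ h3
    · intro h3
      rw [h3]
  have ka := key r hr
  have kb := key (r + (b - a).toNat) (by zify; rw [Int.toNat_of_nonneg (by omega)]; exact hlt)
  rw [shift_apply, shift_apply, sub_self, zero_add] at ka
  rw [shift_apply, shift_apply, Nat.cast_add, Int.toNat_of_nonneg (by omega),
    show (r : ℤ) + (b - a) - r + a = b by ring] at kb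
  rw [ka, kb]

/-- The address is an integer. -/
def IsIntegral (ζ : Odometer ℓ 1) : Prop := ∃ m : ℤ, ζ = m • Odometer.one ℓ 1

/-- A non-integral address never becomes `0` under shifting: there are no cuts, and any two
positions share a block. -/
theorem IsAdmissible.eq_of_agree (hθ : θ.IsAdmissible) {x y : θ.X}
    (hxy : hθ.address x = hθ.address y) (hx : ¬ IsIntegral (hθ.address x)) {k : ℤ}
    (hk : x.1 k = y.1 k) : x = y := by
  apply Subtype.ext
  funext t
  have hne : ∀ s : ℤ, hθ.address x + s • Odometer.one ℓ 1 ≠ 0 := fun s hs =>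
    hx ⟨-s, by rw [neg_smul]; exact eq_neg_of_add_eq_zero_left hs⟩
  rcases le_total k t with h | h
  · exact (hθ.agree_iff hxy h fun s _ _ => hne s).mp hk
  · exact (hθ.agree_iff hxy h fun s _ _ => hne s).mpr hk

theorem zsmul_one_ne_zero (hℓ : 2 ≤ ℓ) {s : ℤ} (hs : s ≠ 0) : s • Odometer.one ℓ 1 ≠ 0 := by
  intro h
  have h1 : (s • Odometer.one ℓ 1).1 s.natAbs = 0 := by rw [h, Odometer.zero_level]
  rw [Odometer.zsmul_one_level, ZMod.intCast_zmod_eq_zero_iff_dvd, mul_one] at h1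
  have h2 := Int.natAbs_dvd_natAbs.mpr h1
  rw [Int.natAbs_natCast] at h2
  have := Nat.le_of_dvd (by omega) h2
  have h3 : s.natAbs < ℓ ^ s.natAbs := Nat.lt_pow_self (by omega)
  omega

/-- At address `0` the only cut lies between `-1` and `0`. -/
theorem IsAdmissible.fixed_agree_nonneg (hθ : θ.IsAdmissible) {u v : θ.X} (hu : u ∈ θ.fixedPts)
    (hv : v ∈ θ.fixedPts) {k : ℤ} (hk : 0 ≤ k) : u.1 0 = v.1 0 ↔ u.1 k = v.1 k := by
  rw [← hθ.address_eq_zero_iff] at hu hv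
  refine hθ.agree_iff (hu.trans hv.symm) hk fun s hs _ => ?_
  rw [hu, zero_add]
  exact zsmul_one_ne_zero hθ.two_le hs.ne'

theorem IsAdmissible.fixed_agree_neg (hθ : θ.IsAdmissible) {u v : θ.X} (hu : u ∈ θ.fixedPts)
    (hv : v ∈ θ.fixedPts) {k : ℤ} (hk : k ≤ -1) : u.1 (-1) = v.1 (-1) ↔ u.1 k = v.1 k := by
  rw [← hθ.address_eq_zero_iff] at hu hv
  refine (hθ.agree_iff (hu.trans hv.symm) hk fun s _ hs => ?_).symm
  rw [hu, zero_add]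
  exact zsmul_one_ne_zero hθ.two_le (by omega)

end Address

end Subst

end EllisQB

/-! ### Non-shift elements, idempotents, and collapsed pairs of fixed points. -/

namespace EllisQB

open Filter Topology Uniformity

theorem eventually_exists_finite {α β : Type*} [Finite β] (U : Ultrafilter α) {P : β → α → Prop}
    (h : ∀ᶠ a in (U : Filter α), ∃ b, P b a) : ∃ b, ∀ᶠ a in (U : Filter α), P b a := by
  by_contra H
  have h2 : ∀ᶠ a in (U : Filter α), ∀ b, ¬ P b a :=
    eventually_all.mpr fun b => Ultrafilter.eventually_not.mpr fun hb => H ⟨b, hb⟩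
  obtain ⟨a, ⟨b, hb⟩, hn⟩ := (h.and h2).exists
  exact hn b hb

namespace Subst

section Structure

variable {A : Type u} {ℓ : ℕ} [NeZero ℓ] {θ : Subst A ℓ}
variable [TopologicalSpace A] [DiscreteTopology A] [Finite A]

/-! ### The index set -/

theorem IsAdmissible.I_props (hθ : θ.IsAdmissible) {i : A → A} (hi : i ∈ θ.I) :
    θ.Sgp i ∧ (∀ a, i (θ.ePlus a) = i a) ∧ ∀ a, θ.eMinus (i a) = i a := by
  obtain ⟨L, R, R', ⟨-, hL, hR⟩, hR', -, -, rfl⟩ := hi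
  refine ⟨(H.sgp θ.sgp_eMinus θ.sgp_ePlus hL).comp _ _ (H.sgp θ.sgp_ePlus θ.sgp_ePlus hR'),
    fun a => ?_, fun a => ?_⟩
  · show L ((R' ∘ θ.ePlus) a) = L (R' a)
    rw [H.comp_right hθ.ePlus_comp hR']
  · exact congrFun (H.comp_left hθ.eMinus_comp hL) _

theorem IsAdmissible.I_injective (hθ : θ.IsAdmissible) {i : A → A} (hi : i ∈ θ.I) {a b : A}
    (ha : θ.ePlus a = a) (hb : θ.ePlus b = b) (h : i a = i b) : a = b :=
  hθ.simp.injOn (hθ.I_props hi).1 θ.sgp_ePlus ⟨a, ha⟩ ⟨b, hb⟩ h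

theorem IsAdmissible.exists_address_eq (hθ : θ.IsAdmissible) [Nonempty A] (ζ : Odometer ℓ 1) :
    ∃ x, hθ.address x = ζ := by
  obtain ⟨x⟩ := hθ.nonempty
  obtain ⟨f, -, hf⟩ := hθ.exists_ellis_translation (ζ - hθ.address x)
  exact ⟨f x, by rw [hf]; abel⟩

/-- At a non-zero address which is a multiple of `ℓ`, the letter at `-1` is the image of the letter
at `0` under an element of `I_θ`. -/
theorem IsAdmissible.exists_mem_I (hθ : θ.IsAdmissible) [Nonempty A] {ζ : Odometer ℓ 1}
    (h1 : ζ.1 1 = 0) (h0 : ζ ≠ 0) :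
    ∃ i ∈ θ.I, ∀ y, hθ.address y = ζ → y.1 (-1) = i (y.1 0) := by
  obtain ⟨n, hn⟩ : ∃ n, ζ.1 n ≠ 0 := by
    by_contra! H
    exact h0 (Odometer.ext_level H)
  obtain ⟨r, j, hr, hj, hrζ, hblock⟩ := hθ.exists_block n ζ (hθ.exists_address_eq ζ)
  have hr0 : 0 < r := Nat.pos_of_ne_zero fun h => hn (by rw [hrζ, h, Nat.cast_zero])
  obtain ⟨n, rfl⟩ : ∃ m, n = m + 1 := by
    refine ⟨n - 1, ?_⟩
    rcases Nat.eq_zero_or_pos n with rfl | h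
    · rw [pow_zero] at hr
      omega
    · omega
  have hdvd : ℓ ∣ r := by
    have := Odometer.level_eq_intCast_of_le ζ (m := r) (show 1 ≤ n + 1 by omega)
      (by rw [hrζ, Int.cast_natCast])
    rw [h1, Int.cast_natCast, eq_comm, ZMod.natCast_eq_zero_iff] at this
    simpa using this
  obtain ⟨r', rfl⟩ := hdvd
  have hr'0 : 0 < r' := Nat.pos_of_mul_pos_left hr0
  have hl := hθ.two_le
  set g := θ.col (Fin.ofNat ℓ j) with hg
  -- `L` and `R` need `e₊` as their rightmost factor. As `θ_j ∘ θ_0` is column `j` of `θ²`, the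
  -- enlarged maps are still consecutive columns of a power.
  have hg2 : θ.colPow 2 j = g ∘ θ.ePlus := by
    have := θ.colPow_add 1 1 j 0 (by simpa using hj)
    rwa [zero_mul, add_zero] at this
  have hidx : ∀ s, s < ℓ ^ (n + 1) → θ.colPow (n + 1 + 2) (s + j * ℓ ^ (n + 1))
      = θ.colPow (n + 1) s ∘ g ∘ θ.ePlus := fun s hs => by
    rw [colPow_add _ _ _ _ _ hs, hg2]
  have hlt : ∀ s, s < ℓ ^ (n + 1) → s + j * ℓ ^ (n + 1) < ℓ ^ (n + 1 + 2) := fun s hs =>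
    calc s + j * ℓ ^ (n + 1) < ℓ ^ (n + 1) + j * ℓ ^ (n + 1) := by omega
      _ = (j + 1) * ℓ ^ (n + 1) := by ring
      _ ≤ ℓ * ℓ ^ (n + 1) := Nat.mul_le_mul_right _ hj
      _ ≤ ℓ * ℓ * ℓ ^ (n + 1) := Nat.mul_le_mul_right _ (by nlinarith)
      _ = _ := by ring
  have hsgp : ∀ s, s < ℓ ^ (n + 1) → θ.Sgp (θ.colPow (n + 1) s ∘ g ∘ θ.ePlus) := fun s hs => by
    rw [← hidx s hs]
    exact Sgp.col _ _ (by omega) (hlt s hs)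
  have hR : θ.colPow (n + 1) (ℓ * r') ∘ g ∘ θ.ePlus ∈ θ.H θ.ePlus θ.ePlus := by
    refine ⟨_, hsgp _ hr, ?_⟩
    have : θ.ePlus ∘ θ.colPow (n + 1) (ℓ * r') = θ.colPow (n + 1) (ℓ * r') := by
      have h : Fin.ofNat ℓ (ℓ * r') = Fin.ofNat ℓ 0 := ofNat_congr (by simp)
      simp only [colPow, h]
      rw [← Function.comp_assoc]
      exact congrArg (· ∘ _) hθ.ePlus_comp
    funext a
    simp only [Function.comp, hθ.ePlus_idem]
    exact (congrFun this _).symm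
  have hL : θ.colPow (n + 1) (ℓ * r' - 1) ∘ g ∘ θ.ePlus ∈ θ.H θ.eMinus θ.ePlus := by
    refine ⟨_, hsgp (ℓ * r' - 1) (by omega), ?_⟩
    have : θ.eMinus ∘ θ.colPow (n + 1) (ℓ * r' - 1) = θ.colPow (n + 1) (ℓ * r' - 1) := by
      have h : Fin.ofNat ℓ (ℓ * r' - 1) = Fin.ofNat ℓ (ℓ - 1) := by
        apply ofNat_congr
        obtain ⟨k, rfl⟩ : ∃ k, r' = k + 1 := ⟨r' - 1, by omega⟩
        rw [show ℓ * (k + 1) - 1 = ℓ - 1 + ℓ * k by rw [mul_add]; omega, Nat.add_mul_mod_self_left]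
      simp only [colPow, h]
      rw [← Function.comp_assoc]
      exact congrArg (· ∘ _) hθ.eMinus_comp
    funext a
    simp only [Function.comp, hθ.ePlus_idem]
    exact (congrFun this _).symm
  obtain ⟨R', hR', hRR', hR'R⟩ := hθ.simp.exists_inverse hθ.ePlus_comp hR
  refine ⟨(θ.colPow (n + 1) (ℓ * r' - 1) ∘ g ∘ θ.ePlus) ∘ R', ⟨_, _, R', ⟨⟨n + 1 + 2, ℓ * r' + j * ℓ ^ (n + 1), by omega, by omega, hlt _ hr,
    ?_, (hidx _ hr).symm⟩, hL, hR⟩, hR', hRR', hR'R, rfl⟩, fun y hy => ?_⟩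
  · rw [show ℓ * r' + j * ℓ ^ (n + 1) - 1 = ℓ * r' - 1 + j * ℓ ^ (n + 1) by omega]
    exact (hidx _ (by omega)).symm
  · obtain ⟨a, ha⟩ := hblock y hy
    -- By constant rank `g` and `g ∘ e₊` have the same range. Hence the letters of `y` at `-1` and
    -- `0` are `L s` and `R s` for one `s`, and `L R⁻¹` links them.
    obtain ⟨s, hs⟩ : g a ∈ Set.range (g ∘ θ.ePlus) := by
      rw [hθ.simp.range_comp (sgp_col θ j) θ.sgp_ePlus]
      exact ⟨a, rfl⟩
    have e0 := ha _ hr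
    have e1 := ha (ℓ * r' - 1) (by omega)
    rw [sub_self, ← hs] at e0
    rw [← hs, Nat.cast_sub (by omega), Nat.cast_one,
      show ((ℓ * r' : ℕ) : ℤ) - 1 - (ℓ * r' : ℕ) = -1 by ring] at e1
    rw [e0, e1]
    have h5 := congrFun hR'R s
    simp only [Function.comp] at h5 ⊢
    rw [h5, hθ.ePlus_idem]

/-! ### Elements of the Ellis semigroup which are not shifts -/

/-- The values on fixed points depend exactly on the letter at position `κ`. -/
def DependsOn (θ : Subst A ℓ) (κ : ℤ) (f : θ.X → θ.X) : Prop :=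
  ∀ u ∈ θ.fixedPts, ∀ v ∈ θ.fixedPts, f u = f v ↔ u.1 κ = v.1 κ

theorem IsLim.le_cofinite {U : Ultrafilter ℤ} {f : θ.X → θ.X} (hU : θ.IsLim U f)
    (hf : f ∉ Set.range θ.shift) : (U : Filter ℤ) ≤ cofinite := by
  rcases U.le_cofinite_or_eq_pure with h | ⟨n, rfl⟩
  · exact h
  · refine absurd ⟨n, funext fun x => Subtype.ext (funext fun k => ?_)⟩ hf
    exact hU x k

/-- A non-principal ultrafilter on `ℤ` goes to `+∞` or `-∞`, so `f u` is read off far to the right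
or left in `u`. For fixed points, agreement there is equivalent to agreement at `0`, respectively
`-1`. -/
theorem IsAdmissible.dependsOn (hθ : θ.IsAdmissible) {f : θ.X → θ.X} (hf : f ∈ θ.ellis)
    (hf' : f ∉ Set.range θ.shift) : θ.DependsOn 0 f ∨ θ.DependsOn (-1) f := by
  obtain ⟨U, hU⟩ := mem_ellis_iff.mp hf
  have hco := hU.le_cofinite hf'
  rw [Int.cofinite_eq, Ultrafilter.le_sup_iff] at hco
  rcases hco with h | h
  · right
    intro u hu v hv
    constructor
    · intro heq
      obtain ⟨n, hn, h1, h2⟩ := ((Filter.Eventually.filter_mono h (eventually_le_atBot (-1))).and ((hU u 0).and (hU v 0))).exists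
      rw [hθ.fixed_agree_neg hu hv (k := 0 + n) (by simpa using hn), h1, h2, heq]
    · intro heq
      apply Subtype.ext
      funext k
      obtain ⟨n, hn, h1, h2⟩ :=
        ((Filter.Eventually.filter_mono h (eventually_le_atBot (-1 - k))).and ((hU u k).and (hU v k))).exists
      have hn' : n ≤ -1 - k := hn
      rw [← h1, ← h2, ← hθ.fixed_agree_neg hu hv (by omega), heq]
  · left
    intro u hu v hv
    constructor
    · intro heq
      obtain ⟨n, hn, h1, h2⟩ := ((Filter.Eventually.filter_mono h (eventually_ge_atTop 0)).and ((hU u 0).and (hU v 0))).exists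
      rw [hθ.fixed_agree_nonneg hu hv (k := 0 + n) (by simpa using hn), h1, h2, heq]
    · intro heq
      apply Subtype.ext
      funext k
      obtain ⟨n, hn, h1, h2⟩ :=
        ((Filter.Eventually.filter_mono h (eventually_ge_atTop (-k))).and ((hU u k).and (hU v k))).exists
      have hn' : -k ≤ n := hn
      rw [← h1, ← h2, ← hθ.fixed_agree_nonneg hu hv (by omega), heq]

/-- For almost all `n` the shifted address `-ξ + n` is a non-zero multiple of `ℓ`, so one element of
`I_θ` links the letters at `n - 1` and `n`, the same for all `y` in the fibre. As `I_θ` is finite,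
it is constant along the ultrafilter. -/
theorem IsAdmissible.exists_graph (hθ : θ.IsAdmissible) [Nonempty A] {f : θ.X → θ.X}
    (hf : f ∈ θ.ellis) (hf' : f ∉ Set.range θ.shift) :
    ∃ i ∈ θ.I, ∀ y, hθ.address (f y) = 0 → (f y).1 (-1) = i ((f y).1 0) := by
  obtain ⟨ξ, hξ⟩ := hθ.exists_translation hf
  obtain ⟨U, hU⟩ := mem_ellis_iff.mp hf
  have hco := hU.le_cofinite hf'
  obtain ⟨y₀, hy₀⟩ := hθ.exists_address_eq (-ξ)
  have h1 : ∀ᶠ n : ℤ in (U : Filter ℤ), (-ξ + n • Odometer.one ℓ 1).1 1 = 0 := by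
    filter_upwards [hθ.eventually_level hU y₀ 1] with n hn
    rw [Odometer.add_level, Odometer.zsmul_one_level, ← hy₀, ← hn, hξ, hy₀, neg_add_cancel,
      Odometer.zero_level]
  have h2 : ∀ᶠ n : ℤ in (U : Filter ℤ), -ξ + n • Odometer.one ℓ 1 ≠ 0 := by
    apply hco
    refine Set.Subsingleton.finite fun n hn m hm => ?_
    simp only [Set.mem_compl_iff, Set.mem_ofPred_eq, not_not] at hn hm
    by_contra hne
    refine zsmul_one_ne_zero hθ.two_le (sub_ne_zero.mpr hne) ?_
    rw [sub_smul, sub_eq_zero]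
    exact add_left_cancel (hn.trans hm.symm)
  have h3 : ∀ᶠ n : ℤ in (U : Filter ℤ), ∃ i : θ.I, ∀ y, hθ.address y = -ξ →
      y.1 (-1 + n) = i.1 (y.1 (0 + n)) := by
    filter_upwards [h1, h2] with n h1 h2
    obtain ⟨i, hi, h⟩ := hθ.exists_mem_I h1 h2
    exact ⟨⟨i, hi⟩, fun y hy => h (θ.shift n y) (by rw [hθ.address_shift, hy])⟩
  obtain ⟨i, hi⟩ := eventually_exists_finite U h3
  refine ⟨i, i.2, fun y hy => ?_⟩
  rw [hξ] at hy
  obtain ⟨n, h1, h2, h3⟩ := (hi.and ((hU y 0).and (hU y (-1)))).exists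
  rw [← h2, ← h3, h1 y (eq_neg_of_add_eq_zero_left hy)]

/-! ### Idempotents -/

theorem exists_idempotent {S : Set (θ.X → θ.X)} (hne : S.Nonempty) (hcl : IsClosed S)
    (hmul : ∀ f ∈ S, ∀ g ∈ S, f ∘ g ∈ S) : ∃ p ∈ S, p ∘ p = p := by
  let _ : Semigroup (θ.X → θ.X) := { mul := fun f g => f ∘ g, mul_assoc := fun _ _ _ => rfl }
  exact exists_idempotent_in_compact_subsemigroup (fun g => continuous_comp_right g) S hne
    hcl.isCompact hmul

theorem IsAdmissible.address_idem (hθ : θ.IsAdmissible) {p : θ.X → θ.X} (hp : p ∈ θ.ellis)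
    (hpp : p ∘ p = p) (x : θ.X) : hθ.address (p x) = hθ.address x := by
  obtain ⟨ξ, hξ⟩ := hθ.exists_translation hp
  have h1 := hξ (p x)
  rw [show p (p x) = p x from congrFun hpp x] at h1
  have : ξ = 0 := by simpa using h1
  rw [hξ, this, add_zero]

theorem exists_agree_of_eq {f : θ.X → θ.X} (hf : f ∈ θ.ellis) {x y : θ.X} (h : f x = f y) :
    ∃ k, x.1 k = y.1 k := by
  obtain ⟨U, hU⟩ := mem_ellis_iff.mp hf
  obtain ⟨n, h1, h2⟩ := ((hU x 0).and (hU y 0)).exists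
  exact ⟨0 + n, by rw [h1, h2, h]⟩

theorem proximal_of_eq {f : θ.X → θ.X} (hf : f ∈ θ.ellis) {x y : θ.X} (h : f x = f y) :
    θ.Proximal x y := by
  intro N
  obtain ⟨U, hU⟩ := mem_ellis_iff.mp hf
  have h1 : ∀ᶠ n : ℤ in (U : Filter ℤ), ∀ k ∈ Finset.Icc (-(N : ℤ)) N,
      x.1 (k + n) = y.1 (k + n) := by
    rw [eventually_all_finset]
    intro k _
    filter_upwards [hU x k, hU y k] with n h1 h2
    rw [h1, h2, h]
  obtain ⟨n, hn⟩ := h1.exists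
  exact ⟨n, fun k hk => hn k (Finset.mem_Icc.mpr (abs_le.mp hk))⟩

/-- `p` sends `p x` and `x` to the same point, so these two agree at some position. They also have
the same address, where agreement is equality. -/
theorem IsAdmissible.idem_apply (hθ : θ.IsAdmissible) {p : θ.X → θ.X} (hp : p ∈ θ.ellis)
    (hpp : p ∘ p = p) {x : θ.X} (hx : ¬ IsIntegral (hθ.address x)) : p x = x := by
  have h1 := hθ.address_idem hp hpp x
  obtain ⟨k, hk⟩ := exists_agree_of_eq hp (congrFun hpp x)
  exact hθ.eq_of_agree h1 (by rwa [h1]) hk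

theorem IsAdmissible.maps_fixed (hθ : θ.IsAdmissible) {f : θ.X → θ.X}
    (hf : ∀ x, hθ.address (f x) = hθ.address x) {u : θ.X} (hu : u ∈ θ.fixedPts) :
    f u ∈ θ.fixedPts := by
  rw [← hθ.address_eq_zero_iff] at hu ⊢
  rw [hf, hu]

/-- The limit of `σ^(ℓ^m k)`. On a fixed point `u` it is the limit of `θ^m(σ^k u)`, whose central
letters stabilise at `m = 1`. -/
theorem IsAdmissible.exists_limit (hθ : θ.IsAdmissible) (k : ℤ) :
    ∃ f ∈ θ.ellis, (∀ x, hθ.address (f x) = hθ.address x) ∧ ∀ u ∈ θ.fixedPts,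
      (f u).1 0 = θ.ePlus (u.1 k) ∧ (f u).1 (-1) = θ.eMinus (u.1 (k - 1)) := by
  obtain ⟨f, hf, U, hU, hs⟩ := θ.exists_isLim_seq fun m => (ℓ : ℤ) ^ m * k
  have hfix : ∀ u ∈ θ.fixedPts, ∀ (m : ℕ) (t : ℤ), u.1 (t + (ℓ : ℤ) ^ m * k)
      = θ.act^[m] (fun s => u.1 (s + k)) t := fun u hu m t => by
    rw [← act_translate, Function.iterate_fixed hu]
  refine ⟨f, hf, fun x => Odometer.ext_level fun n => ?_, fun u hu => ⟨?_, ?_⟩⟩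
  · have h1 : ∀ᶠ m : ℤ in (U : Filter ℤ), (m : ZMod (ℓ ^ n * 1)) = 0 := by
      refine hs (fun m => (m : ZMod (ℓ ^ n * 1)) = 0) ?_
      filter_upwards [eventually_ge_atTop n] with m hm
      rw [ZMod.intCast_zmod_eq_zero_iff_dvd]
      push_cast
      rw [mul_one]
      exact Dvd.dvd.mul_right (pow_dvd_pow _ hm) _
    obtain ⟨m, h1, h2⟩ := (h1.and (hθ.eventually_level hU x n)).exists
    rw [h2, h1, add_zero]
  · have h1 : ∀ᶠ m : ℤ in (U : Filter ℤ), u.1 (0 + m) = θ.ePlus (u.1 k) := by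
      refine hs (fun m => u.1 (0 + m) = θ.ePlus (u.1 k)) ?_
      filter_upwards [eventually_ge_atTop 1] with m hm
      obtain ⟨m, rfl⟩ : ∃ m', m = m' + 1 := ⟨m - 1, by omega⟩
      rw [hfix u hu, act_iterate_zero, Function.iterate_succ_apply, zero_add,
        Function.iterate_fixed (hθ.ePlus_idem _)]
    obtain ⟨m, h1, h2⟩ := (h1.and (hU u 0)).exists
    rw [← h2, h1]
  · have h1 : ∀ᶠ m : ℤ in (U : Filter ℤ), u.1 (-1 + m) = θ.eMinus (u.1 (k - 1)) := by
      refine hs (fun m => u.1 (-1 + m) = θ.eMinus (u.1 (k - 1))) ?_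
      filter_upwards [eventually_ge_atTop 1] with m hm
      obtain ⟨m, rfl⟩ : ∃ m', m = m' + 1 := ⟨m - 1, by omega⟩
      rw [hfix u hu, act_iterate_neg_one, Function.iterate_succ_apply,
        Function.iterate_fixed (hθ.eMinus_idem _), neg_add_eq_sub]
    obtain ⟨m, h1, h2⟩ := (h1.and (hU u (-1))).exists
    rw [← h2, h1]

/-- The elements of the Ellis semigroup preserving addresses, whose values on fixed points lie on
the graph of `i` and depend exactly on the letter at `κ`. -/
def graphSet (hθ : θ.IsAdmissible) (κ : ℤ) (i : A → A) : Set (θ.X → θ.X) :=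
  {f | f ∈ θ.ellis ∧ (∀ x, hθ.address (f x) = hθ.address x) ∧
    (∀ u ∈ θ.fixedPts, ∀ v ∈ θ.fixedPts, (f u).1 0 = (f v).1 0 ↔ u.1 κ = v.1 κ) ∧
    ∀ u ∈ θ.fixedPts, (f u).1 (-1) = i ((f u).1 0)}

theorem continuous_letter (u : θ.X) (k : ℤ) : Continuous fun f : θ.X → θ.X => (f u).1 k :=
  (continuous_apply k).comp (continuous_subtype_val.comp (continuous_apply u))

theorem isClosed_graphSet (hθ : θ.IsAdmissible) (κ : ℤ) (i : A → A) :
    IsClosed (graphSet hθ κ i) := by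
  have h1 : IsClosed {f : θ.X → θ.X | ∀ x, hθ.address (f x) = hθ.address x} := by
    rw [Set.ofPred_forall]
    exact isClosed_iInter fun x =>
      isClosed_eq (hθ.continuous_address.comp (continuous_apply x)) continuous_const
  have h2 : IsClosed {f : θ.X → θ.X | ∀ u ∈ θ.fixedPts, ∀ v ∈ θ.fixedPts,
      (f u).1 0 = (f v).1 0 ↔ u.1 κ = v.1 κ} := by
    simp only [Set.ofPred_forall]
    refine isClosed_iInter fun u => isClosed_iInter fun _ => isClosed_iInter fun v =>
      isClosed_iInter fun _ => ?_
    exact (isClosed_discrete {p : A × A | p.1 = p.2 ↔ u.1 κ = v.1 κ}).preimage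
      ((continuous_letter u 0).prodMk (continuous_letter v 0))
  have h3 : IsClosed {f : θ.X → θ.X | ∀ u ∈ θ.fixedPts, (f u).1 (-1) = i ((f u).1 0)} := by
    simp only [Set.ofPred_forall]
    refine isClosed_iInter fun u => isClosed_iInter fun _ => ?_
    exact isClosed_eq (continuous_letter u _)
      (continuous_of_discreteTopology.comp (continuous_letter u 0))
  exact isClosed_closure.inter (h1.inter (h2.inter h3))

/-- The idempotents with `(b, a) ↦ (i a, a)` on fixed points. -/
theorem IsAdmissible.exists_proj_plus (hθ : θ.IsAdmissible) {i : A → A} (hi : i ∈ θ.I) :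
    ∃ p ∈ θ.ellis, p ∘ p = p ∧
      ∀ u ∈ θ.fixedPts, (p u).1 0 = u.1 0 ∧ (p u).1 (-1) = i (u.1 0) := by
  -- If `L` and `R` are columns `k - 1` and `k` of a power, the limit of `σ^(ℓ^m k)` is `(b, a) ↦ (L
  -- a, R a)`, with values on the graph of `L R⁻¹`. The set is a closed semigroup, so it contains an
  -- idempotent.
  have hne : (graphSet hθ 0 i).Nonempty := by
    obtain ⟨L, R, R', ⟨⟨n, k, hn, hk, hkn, hL', hR'⟩, hL, hR⟩, -, -, hR'R, rfl⟩ := hi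
    simp only at hL' hR' hL hR
    obtain ⟨f, hf, hadd, hfix⟩ := hθ.exists_limit k
    have hRu : ∀ u ∈ θ.fixedPts, (f u).1 0 = R (u.1 0) ∧ (f u).1 (-1) = L (u.1 0) := by
      intro u hu
      have hu' : θ.actX^[n] u = u := Function.iterate_fixed (show θ.actX u = u from Subtype.ext hu) n
      have h0 := θ.actX_iterate_apply n u 0 k hkn
      have h1 := θ.actX_iterate_apply n u 0 (k - 1) (by omega)
      rw [zero_mul, zero_add, hu', ← hR'] at h0
      rw [zero_mul, zero_add, hu', ← hL', Nat.cast_sub (by omega), Nat.cast_one] at h1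
      obtain ⟨e0, e1⟩ := hfix u hu
      rw [e0, e1, h0, h1]
      exact ⟨congrFun (H.comp_left hθ.ePlus_comp hR) _, congrFun (H.comp_left hθ.eMinus_comp hL) _⟩
    refine ⟨f, hf, hadd, fun u hu v hv => ?_, fun u hu => ?_⟩
    · rw [(hRu u hu).1, (hRu v hv).1]
      exact (hθ.simp.injOn (H.sgp θ.sgp_ePlus θ.sgp_ePlus hR) θ.sgp_ePlus).eq_iff
        ⟨_, fixedPts_zero hu⟩ ⟨_, fixedPts_zero hv⟩
    · rw [(hRu u hu).1, (hRu u hu).2]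
      have := congrFun hR'R (u.1 0)
      simp only [Function.comp] at this ⊢
      rw [this, fixedPts_zero hu]
  obtain ⟨p, ⟨hp, hadd, hdep, hgr⟩, hpp⟩ := exists_idempotent hne (isClosed_graphSet hθ 0 i)
    fun f ⟨hf, hadd, hdep, hgr⟩ g ⟨hg, hadd', hdep', hgr'⟩ =>
      ⟨ellis_comp hf hg, fun x => (hadd _).trans (hadd' x),
        fun u hu v hv => (hdep _ (hθ.maps_fixed hadd' hu) _ (hθ.maps_fixed hadd' hv)).trans
          (hdep' u hu v hv),
        fun u hu => hgr _ (hθ.maps_fixed hadd' hu)⟩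
  -- `p (p u) = p u`, and the values of `p` have the same letter at `0` only if the arguments do.
  have h0 : ∀ u ∈ θ.fixedPts, (p u).1 0 = u.1 0 := fun u hu => by
    rw [← hdep _ (hθ.maps_fixed hadd hu) _ hu]
    exact congrArg (fun x : θ.X => x.1 0) (congrFun hpp u)
  exact ⟨p, hp, hpp, fun u hu => ⟨h0 u hu, by rw [hgr u hu, h0 u hu]⟩⟩

/-- The idempotents with `(i a, a') ↦ (i a, a)` on fixed points. -/
theorem IsAdmissible.exists_proj_minus (hθ : θ.IsAdmissible) {i : A → A} (hi : i ∈ θ.I) :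
    ∃ p ∈ θ.ellis, p ∘ p = p ∧
      ∀ u ∈ θ.fixedPts, (p u).1 (-1) = u.1 (-1) ∧ i ((p u).1 0) = u.1 (-1) := by
  have hne : (graphSet hθ (-1) i).Nonempty := by
    obtain ⟨q, hq, hqq, hqfix⟩ := hθ.exists_proj_plus hi
    -- This limit writes `e₊ b` at position `0`, and `q` then moves the value to the graph of `i`
    -- while keeping that letter.
    obtain ⟨f, hf, hadd, hfix⟩ := hθ.exists_limit (-1)
    refine ⟨q ∘ f, ellis_comp hq hf, fun x => (hθ.address_idem hq hqq _).trans (hadd x),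
      fun u hu v hv => ?_, fun u hu => ?_⟩
    · simp only [Function.comp]
      rw [(hqfix _ (hθ.maps_fixed hadd hu)).1, (hqfix _ (hθ.maps_fixed hadd hv)).1,
        (hfix u hu).1, (hfix v hv).1]
      exact (hθ.simp.injOn θ.sgp_ePlus θ.sgp_eMinus).eq_iff
        ⟨_, fixedPts_neg_one hu⟩ ⟨_, fixedPts_neg_one hv⟩
    · simp only [Function.comp]
      rw [(hqfix _ (hθ.maps_fixed hadd hu)).2, (hqfix _ (hθ.maps_fixed hadd hu)).1]
  obtain ⟨p, ⟨hp, hadd, hdep, hgr⟩, hpp⟩ := exists_idempotent hne (isClosed_graphSet hθ (-1) i)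
    fun f ⟨hf, hadd, hdep, hgr⟩ g ⟨hg, hadd', hdep', hgr'⟩ =>
      ⟨ellis_comp hf hg, fun x => (hadd _).trans (hadd' x),
        fun u hu v hv => by
          have hgu := hθ.maps_fixed hadd' hu
          have hgv := hθ.maps_fixed hadd' hv
          refine (hdep _ hgu _ hgv).trans ?_
          rw [hgr' u hu, hgr' v hv, ← hdep' u hu v hv]
          exact ⟨hθ.I_injective hi (fixedPts_zero hgu) (fixedPts_zero hgv), congrArg i⟩,
        fun u hu => hgr _ (hθ.maps_fixed hadd' hu)⟩
  have h0 : ∀ u ∈ θ.fixedPts, (p u).1 (-1) = u.1 (-1) := fun u hu => by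
    rw [← hdep _ (hθ.maps_fixed hadd hu) _ hu]
    exact congrArg (fun x : θ.X => x.1 0) (congrFun hpp u)
  exact ⟨p, hp, hpp, fun u hu => ⟨h0 u hu, by rw [← hgr u hu, h0 u hu]⟩⟩

/-! ### Distinct fixed points with a common half -/

/-- A limit along `+∞` identifies two right asymptotic points, so they have the same address.
Agreeing at `0` but not at `-1`, they must have a cut there, which means address `0`. -/
theorem IsAdmissible.exists_fixed_pair_right (hθ : θ.IsAdmissible) [Nonempty A] :
    ∃ u ∈ θ.fixedPts, ∃ v ∈ θ.fixedPts, u ≠ v ∧ u.1 0 = v.1 0 := by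
  obtain ⟨x, y, hxy, hne⟩ := hθ.exists_asymptotic
  obtain ⟨f, hf, U, hU, hs⟩ := θ.exists_isLim_seq fun m => (m : ℤ)
  have hfxy : f x = f y := by
    apply Subtype.ext
    funext k
    have h1 : ∀ᶠ m : ℤ in (U : Filter ℤ), 0 ≤ k + m := by
      refine hs (fun m => 0 ≤ k + m) ?_
      filter_upwards [eventually_ge_atTop k.natAbs] with m hm
      omega
    obtain ⟨m, h1, h2, h3⟩ := (h1.and ((hU x k).and (hU y k))).exists
    rw [← h2, ← h3, hxy _ h1]
  obtain ⟨ξ, hξ⟩ := hθ.exists_translation hf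
  have hadd : hθ.address x = hθ.address y := by
    have := hξ x
    rw [hfxy, hξ y] at this
    exact (add_right_cancel this).symm
  have hx0 : hθ.address x = 0 := by
    by_contra hx
    refine hne ((hθ.agree_iff hadd (by omega : (-1 : ℤ) ≤ 0) fun s hs hs' => ?_).mpr (hxy 0 le_rfl))
    obtain rfl : s = 0 := by omega
    rwa [zero_smul, add_zero]
  refine ⟨x, (hθ.address_eq_zero_iff x).mp hx0, y, (hθ.address_eq_zero_iff y).mp (hadd ▸ hx0),
    fun h => hne (by rw [h]), hxy 0 le_rfl⟩

theorem IsAdmissible.I_nonempty (hθ : θ.IsAdmissible) [Nonempty A] : θ.I.Nonempty := by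
  have hone := zsmul_one_ne_zero (ℓ := ℓ) hθ.two_le (s := ℓ)
    (by exact_mod_cast (pos_length (ℓ := ℓ)).ne')
  obtain ⟨i, hi, -⟩ := hθ.exists_mem_I (ζ := (ℓ : ℤ) • Odometer.one ℓ 1)
    (by rw [Odometer.zsmul_one_level, ZMod.intCast_zmod_eq_zero_iff_dvd]; simp) hone
  exact ⟨i, hi⟩

/-- Otherwise the idempotent which keeps the letter at `-1` is the identity on `Fix(θ)`. Then `b = i
a` throughout, and fixed points sharing `a` would coincide. -/
theorem IsAdmissible.exists_fixed_pair_left (hθ : θ.IsAdmissible) [Nonempty A] :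
    ∃ u ∈ θ.fixedPts, ∃ v ∈ θ.fixedPts, u ≠ v ∧ u.1 (-1) = v.1 (-1) := by
  obtain ⟨i, hi⟩ := hθ.I_nonempty
  obtain ⟨p, hp, hpp, hfix⟩ := hθ.exists_proj_minus hi
  obtain ⟨u, hu, v, hv, huv, h0⟩ := hθ.exists_fixed_pair_right
  by_contra! H
  have hid : ∀ w ∈ θ.fixedPts, i (w.1 0) = w.1 (-1) := fun w hw => by
    have h1 : p w = w := by
      by_contra hne
      exact H _ (hθ.maps_fixed (hθ.address_idem hp hpp) hw) w hw hne (hfix w hw).1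
    have := (hfix w hw).2
    rwa [h1] at this
  exact huv (fixedPts_ext hθ.two_le hu hv h0 (by rw [← hid u hu, ← hid v hv, h0]))

theorem IsAdmissible.exists_not_injective (hθ : θ.IsAdmissible) [Nonempty A] {f : θ.X → θ.X}
    (hf : f ∈ θ.ellis) (hf' : f ∉ Set.range θ.shift) :
    ∃ u ∈ θ.fixedPts, ∃ v ∈ θ.fixedPts, u ≠ v ∧ f u = f v := by
  rcases hθ.dependsOn hf hf' with h | h
  · obtain ⟨u, hu, v, hv, huv, h0⟩ := hθ.exists_fixed_pair_right
    exact ⟨u, hu, v, hv, huv, (h u hu v hv).mpr h0⟩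
  · obtain ⟨u, hu, v, hv, huv, h0⟩ := hθ.exists_fixed_pair_left
    exact ⟨u, hu, v, hv, huv, (h u hu v hv).mpr h0⟩

theorem shift_injective_apply (θ : Subst A ℓ) (n : ℤ) : Function.Injective (θ.shift n) :=
  fun x y h => by rw [← θ.shift_neg_shift n x, h, shift_neg_shift]

theorem not_shift_of_apply_eq {f : θ.X → θ.X} {u v : θ.X} (huv : u ≠ v) (h : f u = f v) :
    f ∉ Set.range θ.shift := by
  rintro ⟨n, rfl⟩
  exact huv (θ.shift_injective_apply n h)

theorem IsAdmissible.finite_fibre (hθ : θ.IsAdmissible) (ζ : Odometer ℓ 1) :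
    {x | hθ.address x = ζ}.Finite := by
  by_cases h : IsIntegral ζ
  · obtain ⟨m, rfl⟩ := h
    refine Set.Finite.of_finite_image (f := fun x : θ.X => (x.1 (0 + -m), x.1 (-1 + -m)))
      (Set.toFinite _) fun x hx y hy hxy => ?_
    apply θ.shift_injective_apply (-m)
    rw [Prod.mk.injEq] at hxy
    have hfix : ∀ z, hθ.address z = m • Odometer.one ℓ 1 → θ.shift (-m) z ∈ θ.fixedPts :=
      fun z hz => by
        rw [← hθ.address_eq_zero_iff, hθ.address_shift, hz, neg_smul, add_neg_cancel]
    exact fixedPts_ext hθ.two_le (hfix x hx) (hfix y hy) hxy.1 hxy.2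
  · refine Set.Finite.of_finite_image (f := fun x : θ.X => x.1 0)
      (Set.toFinite _) fun x hx y hy hxy => ?_
    have hx' : hθ.address x = ζ := hx
    have hy' : hθ.address y = ζ := hy
    exact hθ.eq_of_agree (hx'.trans hy'.symm) (by rwa [hx']) hxy

/-! ### Equicontinuous factors -/

/-- The equicontinuous family `S` contains all backward iterates, so undoing the shift by `n` keeps
the two images close to each other. -/
theorem factor_eq_of_ellis {Y : Type*} [UniformSpace Y] [T2Space Y] {S : ℤ → Y → Y}
    {q : θ.X → Y} (hq : θ.IsEquicontinuousFactor S q) {f : θ.X → θ.X} (hf : f ∈ θ.ellis)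
    {x y : θ.X} (h : q (f x) = q (f y)) : q x = q y := by
  obtain ⟨U, hU⟩ := mem_ellis_iff.mp hf
  rw [isLim_iff, tendsto_pi_nhds] at hU
  have hcancel : ∀ n z, S (-n) (q (θ.shift n z)) = q z := fun n z => by
    rw [← hq.equivariant, shift_neg_shift]
  refine eq_of_uniformity_basis (𝓤 Y).basis_sets fun {V} hV => ?_
  obtain ⟨W, hW, hsymm, hWV⟩ := comp_symm_mem_uniformity_sets hV
  have heq := hq.equicontinuous (q (f x)) W hW
  have hx := ((hq.continuous.tendsto (f x)).comp (hU x)).eventually heq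
  have hy := ((hq.continuous.tendsto (f y)).comp (hU y))
  rw [← h] at hy
  obtain ⟨n, h1, h2⟩ := (hx.and (hy.eventually heq)).exists
  have h1 := h1 (-n)
  have h2 := h2 (-n)
  simp only [Function.comp, hcancel] at h1 h2
  exact hWV ⟨_, SetRel.symm W h1, h2⟩

end Structure

end Subst

end EllisQB

/-! ### The structure group and its permutations of the singular fibre. -/

namespace EllisQB

open Filter Topology

theorem perm_apply_inv {α : Type*} (τ : Equiv.Perm α) (x : α) : τ (τ⁻¹ x) = x :=
  τ.apply_symm_apply x

namespace Subst

section StructureGroup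

variable {A : Type u} {ℓ : ℕ} [NeZero ℓ] {θ : Subst A ℓ}
variable [TopologicalSpace A] [DiscreteTopology A] [Finite A]
variable {e : θ.X → θ.X}

/-! ### The minimal idempotent -/

theorem IsMinimalIdempotent.apply_apply (he : θ.IsMinimalIdempotent e) (x : θ.X) :
    e (e x) = e x := congrFun he.idem x

/-- An idempotent shift is the identity, above every idempotent. Minimality would make `e` equal to
a projection onto a graph, which is not injective. -/
theorem IsMinimalIdempotent.not_shift (he : θ.IsMinimalIdempotent e) (hθ : θ.IsAdmissible)
    [Nonempty A] : e ∉ Set.range θ.shift := by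
  rintro ⟨n, rfl⟩
  have hid : θ.shift n = id := funext fun x => θ.shift_injective_apply n (congrFun he.idem x)
  obtain ⟨i, hi⟩ := hθ.I_nonempty
  obtain ⟨p, hp, hpp, hfix⟩ := hθ.exists_proj_plus hi
  obtain ⟨u, hu, v, hv, huv, h0⟩ := hθ.exists_fixed_pair_right
  have hpe := he.minimal p hp hpp (by rw [hid]; rfl) (by rw [hid]; rfl)
  have hadd := hθ.address_idem hp hpp
  refine not_shift_of_apply_eq (f := p) huv ?_ ⟨n, hpe.symm⟩
  refine fixedPts_ext hθ.two_le (hθ.maps_fixed hadd hu) (hθ.maps_fixed hadd hv) ?_ ?_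
  · rw [(hfix u hu).1, (hfix v hv).1, h0]
  · rw [(hfix u hu).2, (hfix v hv).2, h0]

theorem IsMinimalIdempotent.address (he : θ.IsMinimalIdempotent e) (hθ : θ.IsAdmissible)
    (x : θ.X) : hθ.address (e x) = hθ.address x :=
  hθ.address_idem he.mem he.idem x

theorem IsMinimalIdempotent.maps_fixed (he : θ.IsMinimalIdempotent e) (hθ : θ.IsAdmissible)
    {u : θ.X} (hu : u ∈ θ.fixedPts) : e u ∈ θ.fixedPts :=
  hθ.maps_fixed (he.address hθ) hu

/-- `e Fix(θ)` is the entire graph of one `i ∈ I_θ` over the range of `e₊`, so its points are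
parametrised by the letter at `0`. The point over `a` is `e` applied to the fixed point `(i a, a)`.
-/
theorem IsMinimalIdempotent.exists_graph (he : θ.IsMinimalIdempotent e) (hθ : θ.IsAdmissible)
    [Nonempty A] : ∃ i ∈ θ.I, (∀ u ∈ θ.fixedPts, (e u).1 (-1) = i ((e u).1 0)) ∧
      ∀ a, θ.ePlus a = a → ∃ v ∈ θ.fixedPts, e v = v ∧ v.1 0 = a := by
  obtain ⟨i, hi, hgr⟩ := hθ.exists_graph he.mem (he.not_shift hθ)
  have hgr' : ∀ u ∈ θ.fixedPts, (e u).1 (-1) = i ((e u).1 0) := fun u hu =>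
    hgr u ((hθ.address_eq_zero_iff _).mpr (he.maps_fixed hθ hu))
  refine ⟨i, hi, hgr', fun a ha => ?_⟩
  obtain ⟨x, hx⟩ := hθ.exists_point a
  obtain ⟨u, hu, hu0, -⟩ := hθ.exists_fixed x
  obtain ⟨p, hp, hpp, hfix⟩ := hθ.exists_proj_plus hi
  have hpu := hθ.maps_fixed (hθ.address_idem hp hpp) hu
  have hp0 : (p u).1 0 = a := by rw [(hfix u hu).1, hu0, hx, ha]
  have hp1 : (p u).1 (-1) = i a := by rw [(hfix u hu).2, hu0, hx, ha]
  refine ⟨e (p u), he.maps_fixed hθ hpu, he.apply_apply _, ?_⟩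
  have heu := he.maps_fixed hθ hpu
  rcases hθ.dependsOn he.mem (he.not_shift hθ) with h | h
  · rw [← hp0]
    exact (h _ heu _ hpu).mp (he.apply_apply _)
  · apply hθ.I_injective hi (fixedPts_zero heu) ha
    rw [← hgr' _ hpu, ← hp1]
    exact (h _ heu _ hpu).mp (he.apply_apply _)

theorem IsMinimalIdempotent.ext_zero (he : θ.IsMinimalIdempotent e) (hθ : θ.IsAdmissible)
    [Nonempty A] {u v : θ.X} (hu : u ∈ θ.fixedPts) (hv : v ∈ θ.fixedPts) (heu : e u = u)
    (hev : e v = v) (h : u.1 0 = v.1 0) : u = v := by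
  obtain ⟨i, -, hgr, -⟩ := he.exists_graph hθ
  refine fixedPts_ext hθ.two_le hu hv h ?_
  have h1 := hgr u hu
  have h2 := hgr v hv
  rw [heu] at h1
  rw [hev] at h2
  rw [h1, h2, h]

/-! ### The structure group -/

theorem IsMinimalIdempotent.mem_structureGroup (he : θ.IsMinimalIdempotent e) {g : θ.X → θ.X} :
    g ∈ θ.structureGroup e ↔ g ∈ θ.ellis ∧ (∀ x, e (g x) = g x) ∧ ∀ x, g (e x) = g x := by
  constructor
  · rintro ⟨f, hf, rfl⟩
    exact ⟨ellis_comp he.mem (ellis_comp hf he.mem), fun x => he.apply_apply _,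
      fun x => by simp only [Function.comp, he.apply_apply]⟩
  · rintro ⟨h1, h2, h3⟩
    exact ⟨g, h1, funext fun x => by simp only [Function.comp, h3, h2]⟩

theorem IsMinimalIdempotent.self_mem (he : θ.IsMinimalIdempotent e) : e ∈ θ.structureGroup e :=
  he.mem_structureGroup.mpr ⟨he.mem, he.apply_apply, he.apply_apply⟩

theorem IsMinimalIdempotent.comp_mem (he : θ.IsMinimalIdempotent e) {f g : θ.X → θ.X}
    (hf : f ∈ θ.structureGroup e) (hg : g ∈ θ.structureGroup e) : f ∘ g ∈ θ.structureGroup e := by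
  rw [he.mem_structureGroup] at *
  exact ⟨ellis_comp hf.1 hg.1, fun x => hf.2.1 _, fun x => congrArg f (hg.2.2 x)⟩

/-- The structure group is a group. -/
theorem IsMinimalIdempotent.exists_inverse (he : θ.IsMinimalIdempotent e) {f : θ.X → θ.X}
    (hf : f ∈ θ.structureGroup e) : ∃ f' ∈ θ.structureGroup e, f ∘ f' = e ∧ f' ∘ f = e := by
  have hleft : ∀ f ∈ θ.structureGroup e, ∃ f' ∈ θ.structureGroup e, f' ∘ f = e := by
    intro f hf
    obtain ⟨hfE, hef, hfe⟩ := he.mem_structureGroup.mp hf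
    -- `E f` is a compact semigroup, so it contains an idempotent `h f`. As `f e = f`, the map `e h
    -- f` is an idempotent below `e`, and minimality gives `e h f = e`.
    obtain ⟨p, ⟨h, hh, rfl⟩, hpp⟩ := exists_idempotent
      (S := (fun h : θ.X → θ.X => h ∘ f) '' θ.ellis) ⟨_, _, he.mem, rfl⟩
      ((isClosed_closure.isCompact.image (continuous_comp_right f)).isClosed) (by
        rintro _ ⟨h, hh, rfl⟩ _ ⟨k, hk, rfl⟩
        exact ⟨h ∘ f ∘ k, ellis_comp hh (ellis_comp hfE hk), rfl⟩)
    have hp := he.minimal (e ∘ h ∘ f) (ellis_comp he.mem (ellis_comp hh hfE))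
      (funext fun x => by
        have := congrFun hpp x
        simp only [Function.comp, hfe] at this ⊢
        rw [this])
      (funext fun x => he.apply_apply _) (funext fun x => by simp only [Function.comp, hfe])
    exact ⟨e ∘ h ∘ e, ⟨h, hh, rfl⟩, by
      refine Eq.trans (funext fun x => ?_) hp
      simp only [Function.comp, hef]⟩
  obtain ⟨f', hf', h1⟩ := hleft f hf
  obtain ⟨f'', hf'', h2⟩ := hleft f' hf'
  obtain ⟨-, hef, -⟩ := he.mem_structureGroup.mp hf
  obtain ⟨-, -, hfe''⟩ := he.mem_structureGroup.mp hf''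
  have : f'' = f := by
    funext x
    have e1 := congrFun h1 x
    have e2 := congrFun h2 (f x)
    simp only [Function.comp] at e1 e2
    rw [← hfe'', ← e1, e2, hef]
  rw [this] at h2
  exact ⟨f', hf', h2, h1⟩

theorem IsMinimalIdempotent.eq_of_apply_eq (he : θ.IsMinimalIdempotent e) {f : θ.X → θ.X}
    (hf : f ∈ θ.structureGroup e) {x y : θ.X} (h : f x = f y) : e x = e y := by
  obtain ⟨f', -, -, h1⟩ := he.exists_inverse hf
  rw [← congrFun h1 x, ← congrFun h1 y]
  exact congrArg f' h

theorem IsAdmissible.translation_zero (hθ : θ.IsAdmissible) {f : θ.X → θ.X} (hf : f ∈ θ.ellis)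
    {u : θ.X} (hu : u ∈ θ.fixedPts) (hfu : f u ∈ θ.fixedPts) (x : θ.X) :
    hθ.address (f x) = hθ.address x := by
  obtain ⟨ξ, hξ⟩ := hθ.exists_translation hf
  rw [← hθ.address_eq_zero_iff] at hu hfu
  have h := hξ u
  rw [hu, hfu, zero_add] at h
  rw [hξ, ← h, add_zero]

theorem IsMinimalIdempotent.translation_inverse (he : θ.IsMinimalIdempotent e)
    (hθ : θ.IsAdmissible) {f f' : θ.X → θ.X} {ξ : Odometer ℓ 1}
    (hf : ∀ x, hθ.address (f x) = hθ.address x + ξ) (hff' : f ∘ f' = e) (x : θ.X) :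
    hθ.address (f' x) = hθ.address x - ξ := by
  rw [eq_sub_iff_add_eq, ← hf, ← he.address hθ x, ← hff']
  rfl

theorem IsMinimalIdempotent.nonempty_image (hθ : θ.IsAdmissible) [Nonempty A] :
    Nonempty ↥(e '' θ.fixedPts) := by
  obtain ⟨x, hx⟩ := hθ.exists_address_eq 0
  exact ⟨⟨_, x, (hθ.address_eq_zero_iff x).mp hx, rfl⟩⟩

theorem IsMinimalIdempotent.mem_image (he : θ.IsMinimalIdempotent e) (hθ : θ.IsAdmissible)
    {x : θ.X} : x ∈ e '' θ.fixedPts ↔ x ∈ θ.fixedPts ∧ e x = x := by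
  constructor
  · rintro ⟨u, hu, rfl⟩
    exact ⟨he.maps_fixed hθ hu, he.apply_apply u⟩
  · rintro ⟨h1, h2⟩
    exact ⟨x, h1, h2⟩

/-! ### Permutations of the singular fibre -/

/-- The permutations of `e · Fix(θ)` which are induced by elements of the structure group acting
trivially outside of the integral addresses. -/
def localPerms (he : θ.IsMinimalIdempotent e) (hθ : θ.IsAdmissible) :
    Subgroup (Equiv.Perm ↥(e '' θ.fixedPts)) where
  carrier := {τ | ∃ f ∈ θ.structureGroup e, (∀ x : ↥(e '' θ.fixedPts), f x = τ x) ∧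
    ∀ x, ¬ IsIntegral (hθ.address x) → f x = x}
  mul_mem' := by
    rintro τ τ' ⟨f, hf, h1, h2⟩ ⟨f', hf', h1', h2'⟩
    refine ⟨f ∘ f', he.comp_mem hf hf', fun x => ?_, fun x hx => ?_⟩
    · simp only [Function.comp, h1', h1, Equiv.Perm.mul_apply]
    · simp only [Function.comp, h2' x hx, h2 x hx]
  one_mem' := ⟨e, he.self_mem, fun x => ((he.mem_image hθ).mp x.2).2,
    fun x hx => hθ.idem_apply he.mem he.idem hx⟩
  inv_mem' := by
    rintro τ ⟨f, hf, h1, h2⟩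
    obtain ⟨f', hf', -, hf'f⟩ := he.exists_inverse hf
    refine ⟨f', hf', fun x => ?_, fun x hx => ?_⟩
    · have h3 := h1 (τ⁻¹ x)
      rw [perm_apply_inv] at h3
      rw [← h3]
      exact (congrFun hf'f _).trans ((he.mem_image hθ).mp (τ⁻¹ x).2).2
    · conv_lhs => rw [← h2 x hx]
      exact (congrFun hf'f x).trans (hθ.idem_apply he.mem he.idem hx)

theorem exists_of_mem_gFibZero (he : θ.IsMinimalIdempotent e) (hθ : θ.IsAdmissible)
    {τ : Equiv.Perm ↥(e '' θ.fixedPts)} (hτ : τ ∈ θ.gFibZero e) :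
    ∃ g ∈ θ.structureGroup e, ∀ x : ↥(e '' θ.fixedPts), g x = τ x := by
  induction hτ using Subgroup.closure_induction with
  | mem τ h =>
    obtain ⟨g, hg, h⟩ := h
    exact ⟨g, hg.1, fun x => (h x).symm⟩
  | one => exact ⟨e, he.self_mem, fun x => ((he.mem_image hθ).mp x.2).2⟩
  | mul τ τ' _ _ h h' =>
    obtain ⟨f, hf, h1⟩ := h
    obtain ⟨f', hf', h1'⟩ := h'
    exact ⟨f ∘ f', he.comp_mem hf hf', fun x => by
      simp only [Function.comp, h1', h1, Equiv.Perm.mul_apply]⟩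
  | inv τ _ h =>
    obtain ⟨f, hf, h1⟩ := h
    obtain ⟨f', hf', -, hf'f⟩ := he.exists_inverse hf
    refine ⟨f', hf', fun x => ?_⟩
    have h3 := h1 (τ⁻¹ x)
    rw [perm_apply_inv] at h3
    rw [← h3]
    exact (congrFun hf'f _).trans ((he.mem_image hθ).mp (τ⁻¹ x).2).2

/-- Both factors of `q p` are idempotents, hence trivial over non-integral addresses. -/
theorem littleZero_le (he : θ.IsMinimalIdempotent e) (hθ : θ.IsAdmissible) :
    θ.littleZero e ≤ localPerms he hθ := by
  refine (Subgroup.closure_le _).mpr ?_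
  rintro τ ⟨p, hp, q, hq, hpp, hpe, hqq, heq, h⟩
  refine ⟨q ∘ p, he.mem_structureGroup.mpr ⟨ellis_comp hq hp, fun x => congrFun heq _,
    fun x => congrArg q (congrFun hpe x)⟩, fun x => (h x).symm, fun x hx => ?_⟩
  simp only [Function.comp, hθ.idem_apply hp hpp hx, hθ.idem_apply hq hqq hx]

/-- An element inducing a permutation of `e Fix(θ)` has translation `0`, so conjugation by it
preserves triviality over non-integral addresses. -/
theorem conj_mem_localPerms (he : θ.IsMinimalIdempotent e) (hθ : θ.IsAdmissible) [Nonempty A]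
    {γ τ : Equiv.Perm ↥(e '' θ.fixedPts)} (hγ : γ ∈ θ.gFibZero e) (hτ : τ ∈ localPerms he hθ) :
    γ * τ * γ⁻¹ ∈ localPerms he hθ := by
  obtain ⟨g, hg, hgγ⟩ := exists_of_mem_gFibZero he hθ hγ
  obtain ⟨f, hf, h1, h2⟩ := hτ
  obtain ⟨g', hg', hgg', hg'g⟩ := he.exists_inverse hg
  obtain ⟨x₀⟩ := IsMinimalIdempotent.nonempty_image (e := e) hθ
  have hadd : ∀ x, hθ.address (g x) = hθ.address x + 0 := fun x => by
    rw [add_zero]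
    refine hθ.translation_zero (he.mem_structureGroup.mp hg).1 ((he.mem_image hθ).mp x₀.2).1 ?_ x
    rw [hgγ]
    exact ((he.mem_image hθ).mp (γ x₀).2).1
  refine ⟨g ∘ f ∘ g', he.comp_mem hg (he.comp_mem hf hg'), fun x => ?_, fun x hx => ?_⟩
  · have h3 : g' x = (γ⁻¹ x : ↥(e '' θ.fixedPts)) := by
      have h4 := hgγ (γ⁻¹ x)
      rw [perm_apply_inv] at h4
      rw [← h4]
      exact (congrFun hg'g _).trans ((he.mem_image hθ).mp (γ⁻¹ x).2).2
    simp only [Function.comp, h3, h1, hgγ, Equiv.Perm.mul_apply]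
  · have h3 := he.translation_inverse hθ hadd hgg' x
    rw [sub_zero] at h3
    have h4 : f (g' x) = g' x := h2 _ (by rwa [h3])
    simp only [Function.comp, h4]
    exact (congrFun hgg' x).trans (hθ.idem_apply he.mem he.idem hx)

theorem localPerms_eq_top (he : θ.IsMinimalIdempotent e) (hθ : θ.IsAdmissible) [Nonempty A]
    (hfull : θ.NormalClosureFull e) : localPerms he hθ = ⊤ := by
  have hnormal : ((localPerms he hθ).comap (θ.gFibZero e).subtype).Normal :=
    ⟨fun τ hτ γ => conj_mem_localPerms he hθ γ.2 hτ⟩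
  rw [eq_top_iff, ← hfull, Subgroup.map_le_iff_le_comap]
  refine Subgroup.normalClosure_le_normal fun τ hτ => ?_
  exact littleZero_le he hθ hτ

/-- Every permutation of `e · Fix(θ)` is induced by an element of the structure group acting
trivially outside of the integral addresses. -/
theorem exists_localPerm (he : θ.IsMinimalIdempotent e) (hθ : θ.IsAdmissible) [Nonempty A]
    (hfull : θ.NormalClosureFull e) (t : ↥(e '' θ.fixedPts) → ↥(e '' θ.fixedPts))
    (ht : Function.Injective t) : ∃ f ∈ θ.structureGroup e,
      (∀ x : ↥(e '' θ.fixedPts), f x = t x) ∧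
      (∀ x, ¬ IsIntegral (hθ.address x) → f x = x) ∧ ∀ x, hθ.address (f x) = hθ.address x := by
  have hfin : Finite ↥(e '' θ.fixedPts) := by
    refine Set.Finite.subset (hθ.finite_fibre 0) fun x hx => ?_
    exact (hθ.address_eq_zero_iff x).mpr ((he.mem_image hθ).mp hx).1
  have hmem : Equiv.ofBijective t (Finite.injective_iff_bijective.mp ht) ∈ localPerms he hθ := by
    rw [localPerms_eq_top he hθ hfull]
    exact Subgroup.mem_top _
  obtain ⟨f, hf, h1, h2⟩ := hmem
  obtain ⟨x₀⟩ := IsMinimalIdempotent.nonempty_image (e := e) hθ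
  refine ⟨f, hf, h1, h2, hθ.translation_zero (he.mem_structureGroup.mp hf).1
    ((he.mem_image hθ).mp x₀.2).1 ?_⟩
  rw [h1]
  exact ((he.mem_image hθ).mp (t x₀).2).1

/-- All fixed points have the same image in each equicontinuous factor. -/
theorem factor_eq_of_fixed (he : θ.IsMinimalIdempotent e) (hfull : θ.NormalClosureFull e)
    {Y : Type u} [UniformSpace Y] [CompactSpace Y] [T2Space Y] {S : ℤ → Y → Y} {q : θ.X → Y}
    (hq : θ.IsEquicontinuousFactor S q) {u v : θ.X} (hu : u ∈ θ.fixedPts) (hv : v ∈ θ.fixedPts) :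
    q u = q v := by
  classical
  have htop : ∀ τ, τ ∈ θ.gFibZero e := fun τ => by
    have h1 : τ ∈ (⊤ : Subgroup _) := Subgroup.mem_top τ
    rw [← hfull] at h1
    exact Subgroup.map_subtype_le _ h1
  have hpres : ∀ τ ∈ θ.gFibZero e, ∀ x : ↥(e '' θ.fixedPts), q (τ x) = q x := by
    intro τ hτ
    induction hτ using Subgroup.closure_induction with
    | mem τ h =>
      obtain ⟨g, hg, h⟩ := h
      intro x
      rw [h]
      exact hg.2.2 Y S q hq x
    | one => exact fun x => rfl
    | mul τ τ' _ _ h h' => exact fun x => (h (τ' x)).trans (h' x)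
    | inv τ _ h =>
      intro x
      rw [← h (τ⁻¹ x), perm_apply_inv]
  have hqe : ∀ x, q (e x) = q x := fun x =>
    factor_eq_of_ellis hq he.mem (by rw [he.apply_apply])
  -- By hypothesis `𝒢^fib_0` is the full symmetric group, so it contains this transposition, and its
  -- elements preserve the fibres of `q`.
  have := hpres _ (htop (Equiv.swap ⟨e u, u, hu, rfl⟩ ⟨e v, v, hv, rfl⟩)) ⟨e u, u, hu, rfl⟩
  rw [Equiv.swap_apply_left] at this
  rw [← hqe u, ← hqe v]
  exact this.symm

/-! ### Covariant maps belong to the structure group -/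

theorem exists_structureGroup_translation (he : θ.IsMinimalIdempotent e) (hθ : θ.IsAdmissible)
    (ξ : Odometer ℓ 1) : ∃ f ∈ θ.structureGroup e, ∀ x, hθ.address (f x) = hθ.address x + ξ := by
  obtain ⟨f, hf, hξ⟩ := hθ.exists_ellis_translation ξ
  refine ⟨e ∘ f ∘ e, ⟨f, hf, rfl⟩, fun x => ?_⟩
  simp only [Function.comp, he.address hθ, hξ]

theorem IsAdmissible.isIntegral_sub (hθ : θ.IsAdmissible) {ζ η : Odometer ℓ 1}
    (h : IsIntegral (ζ - η)) : ∃ m : ℤ, ∀ x, hθ.address x = ζ → hθ.address (θ.shift m x) = η := by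
  obtain ⟨m, hm⟩ := h
  refine ⟨-m, fun x hx => ?_⟩
  rw [hθ.address_shift, hx, neg_smul, ← hm]
  abel

/-- Interpolation, one address at a time. An address in the `ℤ`-orbit of an earlier one is covered
by equivariance. Otherwise the error is carried to the fibre over `0`, corrected there by a local
permutation, and carried back; the earlier addresses then lie off `ℤ`, where the correction is
trivial. -/
theorem exists_structureGroup_eq_on (he : θ.IsMinimalIdempotent e) (hθ : θ.IsAdmissible)
    [Nonempty A] (hfull : θ.NormalClosureFull e) {T : θ.X → θ.X} {ξ : Odometer ℓ 1}
    (hshift : ∀ n x, T (θ.shift n x) = θ.shift n (T x))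
    (hadd : ∀ x, hθ.address (T x) = hθ.address x + ξ) (heT : ∀ x, e (T x) = T x)
    (hinj : ∀ x y, T x = T y → e x = e y) (F : Finset (Odometer ℓ 1)) :
    ∃ f ∈ θ.structureGroup e, (∀ x, hθ.address (f x) = hθ.address x + ξ) ∧
      ∀ x, e x = x → hθ.address x ∈ F → f x = T x := by
  classical
  induction F using Finset.induction_on with
  | empty =>
    obtain ⟨f, hf, h⟩ := exists_structureGroup_translation he hθ ξ
    exact ⟨f, hf, h, by simp⟩
  | insert η F _ ih =>
    obtain ⟨f, hf, hfadd, hfT⟩ := ih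
    by_cases hη : ∃ ζ ∈ F, IsIntegral (η - ζ)
    · obtain ⟨ζ, hζ, hint⟩ := hη
      obtain ⟨m, hm⟩ := hθ.isIntegral_sub hint
      refine ⟨f, hf, hfadd, fun x hex hx => ?_⟩
      rcases Finset.mem_insert.mp hx with hx | hx
      · apply θ.shift_injective_apply m
        rw [← ellis_comm (he.mem_structureGroup.mp hf).1, ← hshift]
        exact hfT _ (by rw [ellis_comm he.mem, hex]) (by rwa [hm x hx])
      · exact hfT x hex hx
    · push Not at hη
      obtain ⟨k, hk, hkadd⟩ := exists_structureGroup_translation he hθ η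
      obtain ⟨k', hk', hkk', hk'k⟩ := he.exists_inverse hk
      obtain ⟨f', hf', hff', hf'f⟩ := he.exists_inverse hf
      have hk'add := he.translation_inverse hθ hkadd hkk'
      have hf'add := he.translation_inverse hθ hfadd hff'
      have hek' := (he.mem_structureGroup.mp hk').2.1
      have hef' := (he.mem_structureGroup.mp hf').2.1
      have hek := (he.mem_structureGroup.mp hk).2.1
      -- With `w = k⁻¹ f⁻¹ T k` on `e Fix(θ)`, the product `f k w k⁻¹` equals `T` over `η`.
      have hmem : ∀ u : ↥(e '' θ.fixedPts), k' (f' (T (k u))) ∈ e '' θ.fixedPts := fun u => by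
        rw [he.mem_image hθ]
        refine ⟨?_, hek' _⟩
        have hu := (hθ.address_eq_zero_iff _).mpr ((he.mem_image hθ).mp u.2).1
        rw [← hθ.address_eq_zero_iff, hk'add, hf'add, hadd, hkadd, hu]
        abel
      have htinj : Function.Injective
          (fun u : ↥(e '' θ.fixedPts) => (⟨k' (f' (T (k u))), hmem u⟩ : ↥(e '' θ.fixedPts))) := by
        intro u v huv
        have h1 := he.eq_of_apply_eq hk' (congrArg Subtype.val huv)
        rw [hef', hef'] at h1
        have h2 := he.eq_of_apply_eq hf' h1
        rw [heT, heT] at h2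
        have h3 := hinj _ _ h2
        rw [hek, hek] at h3
        have h4 := he.eq_of_apply_eq hk h3
        rw [((he.mem_image hθ).mp u.2).2, ((he.mem_image hθ).mp v.2).2] at h4
        exact Subtype.ext h4
      obtain ⟨w, hw, hw1, hw2, hwadd⟩ := exists_localPerm he hθ hfull _ htinj
      refine ⟨f ∘ k ∘ w ∘ k', he.comp_mem hf (he.comp_mem hk (he.comp_mem hw hk')),
        fun x => ?_, fun x hex hx => ?_⟩
      · simp only [Function.comp, hfadd, hkadd, hwadd, hk'add]
        abel
      · have hkk'x : k (k' x) = x := (congrFun hkk' x).trans hex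
        rcases Finset.mem_insert.mp hx with hx | hx
        · have hfix : k' x ∈ e '' θ.fixedPts := by
            rw [he.mem_image hθ, ← hθ.address_eq_zero_iff, hk'add, hx, sub_self]
            exact ⟨rfl, hek' x⟩
          have h1 := hw1 ⟨k' x, hfix⟩
          simp only at h1
          simp only [Function.comp, h1, hkk'x]
          have h2 : k (k' (f' (T x))) = f' (T x) := (congrFun hkk' _).trans (hef' _)
          have h3 : f (f' (T x)) = T x := (congrFun hff' _).trans (heT _)
          rw [h2, h3]
        · have h1 : ¬ IsIntegral (hθ.address (k' x)) := by
            rw [hk'add]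
            rintro ⟨m, hm⟩
            refine hη _ hx ⟨-m, ?_⟩
            rw [neg_smul, ← hm]
            abel
          simp only [Function.comp, hw2 _ h1, hkk'x]
          exact hfT x hex hx

/-- Every map which commutes with the shift, induces a translation of the odometer, and is
injective on the range of `e`, belongs to the structure group. -/
theorem mem_structureGroup_of_covariant (he : θ.IsMinimalIdempotent e) (hθ : θ.IsAdmissible)
    [Nonempty A] (hfull : θ.NormalClosureFull e) {T : θ.X → θ.X} {ξ : Odometer ℓ 1}
    (hshift : ∀ n x, T (θ.shift n x) = θ.shift n (T x))
    (hadd : ∀ x, hθ.address (T x) = hθ.address x + ξ) (heT : ∀ x, e (T x) = T x)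
    (hTe : ∀ x, T (e x) = T x) (hinj : ∀ x y, T x = T y → e x = e y) :
    T ∈ θ.structureGroup e := by
  classical
  -- `e` need not be continuous and `eEe` need not be closed, so the condition is put on `f ∈ E` as
  -- membership of `f (e x)` in a finite set. Composing with `e` on both sides afterwards recovers
  -- `T`.
  have hcl : ∀ x, IsClosed {f : θ.X → θ.X | f (e x) ∈
      {y | hθ.address y = hθ.address (T x) ∧ e y = T x}} := fun x => by
    refine IsClosed.preimage (continuous_apply (e x)) ?_
    exact ((hθ.finite_fibre (hθ.address (T x))).subset fun y hy => hy.1).isClosed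
  obtain ⟨f, hf, h⟩ := IsCompact.inter_iInter_nonempty
    (isClosed_closure.isCompact : IsCompact θ.ellis) _ hcl fun F => by
      obtain ⟨f, hf, hfadd, hfT⟩ := exists_structureGroup_eq_on he hθ hfull hshift hadd heT hinj
        (F.image hθ.address)
      refine ⟨f, (he.mem_structureGroup.mp hf).1, Set.mem_iInter₂.mpr fun x hx => ?_⟩
      have h1 := hfT (e x) (he.apply_apply x)
        (by rw [he.address hθ]; exact Finset.mem_image_of_mem _ hx)
      show hθ.address (f (e x)) = _ ∧ e (f (e x)) = T x
      rw [h1, hTe, heT]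
      exact ⟨rfl, rfl⟩
  refine ⟨f, hf, funext fun x => ?_⟩
  exact (Set.mem_iInter.mp h x).2.symm

end StructureGroup

end Subst

end EllisQB

/-! ### Covariant families, singular points, the maximal factor and the kernel. -/

namespace EllisQB

open Filter Topology

section Main

variable {A : Type u} {ℓ : ℕ} [NeZero ℓ] {θ : Subst A ℓ}
variable [TopologicalSpace A] [DiscreteTopology A] [Finite A]
variable {e : θ.X → θ.X}

open Subst

/-! ### Covariant functions as maps of `X_θ` -/

theorem mem_fib (he : θ.IsMinimalIdempotent e) (hθ : θ.IsAdmissible) {η : Odometer ℓ 1} {x : θ.X} :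
    x ∈ fib e hθ.address η ↔ hθ.address x = η ∧ e x = x := by
  constructor
  · rintro ⟨u, hu, rfl⟩
    exact ⟨(he.address hθ u).trans hu, he.apply_apply u⟩
  · rintro ⟨h1, h2⟩
    exact ⟨x, h1, h2⟩

/-- Covariance under the identity automorphism, which replaces transport along `η = η'`. -/
theorem Cov.toEquiv_congr {h : ℕ} {π : θ.X → Odometer ℓ h} (c : Cov e π) {η η' : Odometer ℓ h}
    (x : fib e π η) (y : fib e π η') (hxy : (x : θ.X) = y) :
    (c.toEquiv η x : θ.X) = c.toEquiv η' y :=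
  c.cov (Homeomorph.refl _) (fun _ => rfl) η' η y x hxy

/-- The shift as a homeomorphism. -/
def shiftHomeomorph (θ : Subst A ℓ) (n : ℤ) : θ.X ≃ₜ θ.X where
  toFun := θ.shift n
  invFun := θ.shift (-n)
  left_inv := θ.shift_neg_shift n
  right_inv := θ.shift_shift_neg n
  continuous_toFun := θ.continuous_shift n
  continuous_invFun := θ.continuous_shift (-n)

theorem shiftHomeomorph_mem (θ : Subst A ℓ) (n : ℤ) : shiftHomeomorph θ n ∈ θ.aut := fun x => by
  show θ.shift n (θ.shift 1 x) = θ.shift 1 (θ.shift n x)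
  rw [shift_shift, shift_shift, add_comm]

/-- The map of `X_θ` which is `c(η) ∘ e` on the fibre of `η`. -/
def Cov.toMap {h : ℕ} {π : θ.X → Odometer ℓ h} (c : Cov e π) (x : θ.X) : θ.X :=
  c.toEquiv (π x) ⟨e x, x, rfl, rfl⟩

theorem Cov.toMap_apply (he : θ.IsMinimalIdempotent e) {hθ : θ.IsAdmissible}
    (c : Cov e hθ.address) (η : Odometer ℓ 1) (x : fib e hθ.address η) :
    c.toMap x = c.toEquiv η x :=
  c.toEquiv_congr _ _ ((mem_fib he hθ).mp x.2).2

theorem Cov.toMap_mem_fib {hθ : θ.IsAdmissible} (c : Cov e hθ.address) (x : θ.X) :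
    c.toMap x ∈ fib e hθ.address (hθ.address x + c.ξ) :=
  (c.toEquiv (hθ.address x) _).2

theorem Cov.address_toMap (he : θ.IsMinimalIdempotent e) {hθ : θ.IsAdmissible}
    (c : Cov e hθ.address) (x : θ.X) : hθ.address (c.toMap x) = hθ.address x + c.ξ :=
  ((mem_fib he hθ).mp (c.toMap_mem_fib x)).1

/-- Covariance is used for powers of the shift only; covariance under the other automorphisms is
automatic for limits of shifts. -/
theorem Cov.toMap_mem (he : θ.IsMinimalIdempotent e) {hθ : θ.IsAdmissible} [Nonempty A]
    (hfull : θ.NormalClosureFull e) (c : Cov e hθ.address) : c.toMap ∈ θ.structureGroup e := by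
  refine mem_structureGroup_of_covariant he hθ hfull (ξ := c.ξ) (fun n x => ?_)
    (c.address_toMap he) (fun x => ((mem_fib he hθ).mp (c.toMap_mem_fib x)).2)
    (fun x => c.toEquiv_congr _ _ (he.apply_apply x)) fun x y hxy => ?_
  · exact c.cov _ (shiftHomeomorph_mem θ n) _ _ _ _ (ellis_comm he.mem n x)
  · have hadd : hθ.address y = hθ.address x := by
      have := c.address_toMap he x
      rw [hxy, c.address_toMap he y] at this
      exact add_right_cancel this
    have hy : e y ∈ fib e hθ.address (hθ.address x) := ⟨y, hadd, rfl⟩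
    have h2 : c.toMap y = c.toEquiv (hθ.address x) ⟨e y, hy⟩ := c.toEquiv_congr _ _ rfl
    rw [h2] at hxy
    have := (c.toEquiv (hθ.address x)).injective (Subtype.ext hxy)
    exact congrArg Subtype.val this

theorem Cov.toMap_mul (he : θ.IsMinimalIdempotent e) {hθ : θ.IsAdmissible}
    (c d : Cov e hθ.address) : (c * d).toMap = c.toMap ∘ d.toMap := by
  funext x
  exact (c.toMap_apply he _ (d.toEquiv (hθ.address x) ⟨e x, x, rfl, rfl⟩)).symm

theorem Cov.toMap_injective (he : θ.IsMinimalIdempotent e) {hθ : θ.IsAdmissible} [Nonempty A] :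
    Function.Injective (Cov.toMap : Cov e hθ.address → θ.X → θ.X) := by
  intro c d hcd
  have hξ : c.ξ = d.ξ := by
    obtain ⟨x, -⟩ := hθ.exists_address_eq 0
    have h1 := c.address_toMap he x
    rw [hcd, d.address_toMap he x] at h1
    exact (add_left_cancel h1).symm
  have happ : ∀ η x, (c.toEquiv η x : θ.X) = d.toEquiv η x := fun η x => by
    rw [← c.toMap_apply he, ← d.toMap_apply he, hcd]
  obtain ⟨ξ, E, hE⟩ := c
  obtain ⟨ξ', E', hE'⟩ := d
  simp only at hξ happ
  subst hξ
  have : E = E' := funext fun η => Equiv.ext fun x => Subtype.ext (happ η x)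
  subst this
  rfl

theorem Cov.exists_toMap_eq (he : θ.IsMinimalIdempotent e) (hθ : θ.IsAdmissible) {f : θ.X → θ.X}
    (hf : f ∈ θ.structureGroup e) : ∃ c : Cov e hθ.address, c.toMap = f := by
  obtain ⟨f', hf', hff', hf'f⟩ := he.exists_inverse hf
  obtain ⟨hfE, hef, hfe⟩ := he.mem_structureGroup.mp hf
  obtain ⟨-, hef', -⟩ := he.mem_structureGroup.mp hf'
  obtain ⟨ξ, hξ⟩ := hθ.exists_translation hfE
  have hξ' := he.translation_inverse hθ hξ hff'
  refine ⟨⟨ξ, fun η => ⟨fun x => ⟨f x, ?_⟩, fun y => ⟨f' y, ?_⟩, fun x => ?_, fun y => ?_⟩,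
    fun α hα η η' x y hxy => ?_⟩, ?_⟩
  · rw [mem_fib he hθ, hξ, ((mem_fib he hθ).mp x.2).1]
    exact ⟨rfl, hef _⟩
  · rw [mem_fib he hθ, hξ', ((mem_fib he hθ).mp y.2).1, add_sub_cancel_right]
    exact ⟨rfl, hef' _⟩
  · exact Subtype.ext ((congrFun hf'f _).trans ((mem_fib he hθ).mp x.2).2)
  · exact Subtype.ext ((congrFun hff' _).trans ((mem_fib he hθ).mp y.2).2)
  · show f y = α (f x)
    rw [hxy, ellis_aut hfE hα]
  · exact funext hfe

/-! ### Singular points -/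

/-- Proximal points agree somewhere, which is equality off `ℤ`. Conversely a projection onto a graph
collapses two fixed points, and shifts carry such a pair to every integer. -/
theorem isSingular_iff (hθ : θ.IsAdmissible) [Nonempty A] {η : Odometer ℓ 1} :
    IsSingular hθ.address η ↔ IsIntegral η := by
  constructor
  · rintro ⟨x, y, rfl, hy, hne, hprox⟩
    by_contra hint
    obtain ⟨n, hn⟩ := hprox 0
    exact hne (hθ.eq_of_agree hy.symm hint (hn 0 (by simp)))
  · rintro ⟨m, rfl⟩
    obtain ⟨i, hi⟩ := hθ.I_nonempty
    obtain ⟨p, hp, hpp, hfix⟩ := hθ.exists_proj_plus hi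
    obtain ⟨u, hu, v, hv, huv, h0⟩ := hθ.exists_fixed_pair_right
    have hadd := hθ.address_idem hp hpp
    have hpuv : p u = p v := by
      refine fixedPts_ext hθ.two_le (hθ.maps_fixed hadd hu) (hθ.maps_fixed hadd hv) ?_ ?_
      · rw [(hfix u hu).1, (hfix v hv).1, h0]
      · rw [(hfix u hu).2, (hfix v hv).2, h0]
    have haddr : ∀ w ∈ θ.fixedPts, hθ.address (θ.shift m w) = m • Odometer.one ℓ 1 := fun w hw => by
      rw [hθ.address_shift, (hθ.address_eq_zero_iff w).mpr hw, zero_add]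
    refine ⟨θ.shift m u, θ.shift m v, haddr u hu, haddr v hv,
      fun h => huv (θ.shift_injective_apply m h), proximal_of_eq hp ?_⟩
    rw [ellis_comm hp, ellis_comm hp, hpuv]

/-- Automorphisms commute with `E`, so they send `Fix(θ)` into a single fibre and a collapsed pair
to a collapsed pair; that fibre is singular. Shifts already reach all integers. -/
theorem mem_autOrbit_iff (hθ : θ.IsAdmissible) [Nonempty A] {η : Odometer ℓ 1} :
    η ∈ autOrbit hθ.address ↔ IsIntegral η := by
  constructor
  · rintro ⟨α, hα, x, hx, rfl⟩
    rw [← isSingular_iff hθ]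
    obtain ⟨i, hi⟩ := hθ.I_nonempty
    obtain ⟨y, z, hy, hz, hyz, hprox⟩ := (isSingular_iff hθ (η := 0)).mpr ⟨0, by rw [zero_smul]⟩
    obtain ⟨p, hp, hpp, hfix⟩ := hθ.exists_proj_plus hi
    obtain ⟨u, hu, v, hv, huv, h0⟩ := hθ.exists_fixed_pair_right
    have hadd := hθ.address_idem hp hpp
    have hpuv : p u = p v := by
      refine fixedPts_ext hθ.two_le (hθ.maps_fixed hadd hu) (hθ.maps_fixed hadd hv) ?_ ?_
      · rw [(hfix u hu).1, (hfix v hv).1, h0]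
      · rw [(hfix u hu).2, (hfix v hv).2, h0]
    have hconst : ∀ w ∈ θ.fixedPts, hθ.address (α w) = hθ.address (α x) := fun w hw => by
      obtain ⟨g, hg, rfl⟩ := hθ.exists_ellis_apply_eq x w
      rw [← ellis_aut hg hα]
      exact hθ.translation_zero hg ((hθ.address_eq_zero_iff x).mp hx) hw _
    refine ⟨α u, α v, hconst u hu, hconst v hv, fun h => huv (α.injective h),
      proximal_of_eq hp ?_⟩
    rw [ellis_aut hp hα, ellis_aut hp hα, hpuv]
  · rintro ⟨m, rfl⟩
    obtain ⟨x, hx⟩ := hθ.exists_address_eq 0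
    refine ⟨shiftHomeomorph θ m, shiftHomeomorph_mem θ m, x, hx, ?_⟩
    show hθ.address (θ.shift m x) = _
    rw [hθ.address_shift, hx, zero_add]

/-! ### The maximal equicontinuous factor -/

/-- An equicontinuous factor is constant on `Fix(θ)`. Any fibre is carried into `Fix(θ)` by an
element of `E`, and points identified after applying it were identified before. -/
theorem isMEF (hθ : θ.IsAdmissible) [Nonempty A] (he : θ.IsMinimalIdempotent e)
    (hfull : θ.NormalClosureFull e) : θ.IsMEF (Odometer.act ℓ 1) hθ.address := by
  refine ⟨⟨hθ.continuous_address, hθ.exists_address_eq, hθ.address_shift,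
    Odometer.equicontinuous_act⟩, ?_⟩
  intro Y _ _ _ S q hq
  have hsurj : Function.Surjective hθ.address := hθ.exists_address_eq
  have hfactor : ∀ x y, hθ.address x = hθ.address y → q x = q y := fun x y hxy => by
    obtain ⟨f, hf, hξ⟩ := hθ.exists_ellis_translation (-hθ.address x)
    refine factor_eq_of_ellis hq hf (factor_eq_of_fixed he hfull hq ?_ ?_)
    · rw [← hθ.address_eq_zero_iff, hξ, add_neg_cancel]
    · rw [← hθ.address_eq_zero_iff, hξ, hxy, add_neg_cancel]
  have hcomp : q = (q ∘ Function.surjInv hsurj) ∘ hθ.address := funext fun x =>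
    hfactor _ _ (Function.surjInv_eq hsurj _).symm
  refine ⟨q ∘ Function.surjInv hsurj, ?_, hcomp⟩
  rw [(hθ.continuous_address.isClosedMap.isQuotientMap hθ.continuous_address hsurj).continuous_iff,
    ← hcomp]
  exact hq.continuous

/-! ### Factorization of the elements of the kernel -/

theorem eq_of_eq_on (hθ : θ.IsAdmissible) {f g : θ.X → θ.X} (hf : f ∈ θ.ellis) (hg : g ∈ θ.ellis)
    (h0 : ∀ u ∈ θ.fixedPts, f u = g u) (h1 : ∀ x, ¬ IsIntegral (hθ.address x) → f x = g x) :
    f = g := by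
  funext x
  by_cases hx : IsIntegral (hθ.address x)
  · obtain ⟨m, hm⟩ := hx
    have hu : θ.shift (-m) x ∈ θ.fixedPts := by
      rw [← hθ.address_eq_zero_iff, hθ.address_shift, hm, neg_smul, add_neg_cancel]
    have := h0 _ hu
    rw [ellis_comm hf, ellis_comm hg] at this
    exact θ.shift_injective_apply _ this
  · exact h1 x hx

/-- The position of the letter on which the elements of type `l` depend. -/
def Side.pos : Side → ℤ
  | Side.plus => 0
  | Side.minus => -1

/-- The idempotents `p` with `(b, a) ↦ (i a, a)` on fixed points, where `b` and `a` are the letters at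
`-1` and `0`. -/
structure IsProj (θ : Subst A ℓ) (i : A → A) (p : θ.X → θ.X) : Prop where
  mem : p ∈ θ.ellis
  idem : p ∘ p = p
  zero : ∀ u ∈ θ.fixedPts, (p u).1 0 = u.1 0
  neg_one : ∀ u ∈ θ.fixedPts, (p u).1 (-1) = i (u.1 0)

theorem exists_isProj (hθ : θ.IsAdmissible) {i : A → A} (hi : i ∈ θ.I) : ∃ p, IsProj θ i p := by
  obtain ⟨p, hp, hpp, hfix⟩ := hθ.exists_proj_plus hi
  exact ⟨p, hp, hpp, fun u hu => (hfix u hu).1, fun u hu => (hfix u hu).2⟩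

theorem IsProj.maps_fixed {i : A → A} {p : θ.X → θ.X} (hp : IsProj θ i p) (hθ : θ.IsAdmissible)
    {u : θ.X} (hu : u ∈ θ.fixedPts) : p u ∈ θ.fixedPts :=
  hθ.maps_fixed (hθ.address_idem hp.mem hp.idem) hu

theorem IsProj.apply_fixed {i : A → A} {p : θ.X → θ.X} (hp : IsProj θ i p) (hθ : θ.IsAdmissible)
    {u v : θ.X} (hu : u ∈ θ.fixedPts) (hv : v ∈ θ.fixedPts) (h : u.1 0 = v.1 0)
    (hv1 : v.1 (-1) = i (v.1 0)) : p u = v :=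
  fixedPts_ext hθ.two_le (hp.maps_fixed hθ hu) hv ((hp.zero u hu).trans h)
    (by rw [hp.neg_one u hu, h, hv1])

/-- On `Fix(θ)` projections keep `a` and overwrite `b`, so only the last one matters, and `p`
restores a point already on its graph. -/
theorem IsProj.comp_eq {i j : A → A} {p q : θ.X → θ.X} (hp : IsProj θ i p) (hq : IsProj θ j q)
    (hθ : θ.IsAdmissible) {f : θ.X → θ.X} (hf : f ∈ θ.ellis)
    (hgr : ∀ y, hθ.address (f y) = 0 → (f y).1 (-1) = i ((f y).1 0)) (x : θ.X) :
    p (q (f x)) = f x := by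
  by_cases hx : IsIntegral (hθ.address (f x))
  · obtain ⟨m, hm⟩ := hx
    apply θ.shift_injective_apply (-m)
    rw [← ellis_comm hp.mem, ← ellis_comm hq.mem, ← ellis_comm hf]
    have hadd : hθ.address (f (θ.shift (-m) x)) = 0 := by
      rw [ellis_comm hf, hθ.address_shift, hm, neg_smul, add_neg_cancel]
    have hfix := (hθ.address_eq_zero_iff _).mp hadd
    exact hp.apply_fixed hθ (hq.maps_fixed hθ hfix) hfix (hq.zero _ hfix) (hgr _ hadd)
  · rw [hθ.idem_apply hq.mem hq.idem hx, hθ.idem_apply hp.mem hp.idem hx]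

theorem IsProj.e_apply {i : A → A} {p : θ.X → θ.X} (hp : IsProj θ i p)
    (he : θ.IsMinimalIdempotent e) (hθ : θ.IsAdmissible) [Nonempty A]
    (hgr : ∀ u ∈ θ.fixedPts, (e u).1 (-1) = i ((e u).1 0))
    (hsurj : ∀ a, θ.ePlus a = a → ∃ v ∈ θ.fixedPts, e v = v ∧ v.1 0 = a) (x : θ.X) :
    e (p x) = p x := by
  refine congrFun (eq_of_eq_on hθ (ellis_comp he.mem hp.mem) hp.mem (fun u hu => ?_)
    fun x hx => ?_ : e ∘ p = p) x
  · obtain ⟨v, hv, hev, hv0⟩ := hsurj _ (fixedPts_zero hu)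
    have := hgr v hv
    rw [hev] at this
    have hpu := hp.apply_fixed hθ hu hv hv0.symm this
    simp only [Function.comp, hpu, hev]
  · simp only [Function.comp, hθ.idem_apply hp.mem hp.idem hx, hθ.idem_apply he.mem he.idem hx]

/-- The factors of type `l`: they have values in the range of `e`, and act on fixed points through
the letter at position `-1` or `0`. -/
structure IsCoproj (e : θ.X → θ.X) (hθ : θ.IsAdmissible) (κ : ℤ) (ψ : A → A) (q : θ.X → θ.X) :
    Prop where
  mem : q ∈ θ.ellis
  e_apply : ∀ x, e (q x) = q x
  address : ∀ x, hθ.address (q x) = hθ.address x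
  off : ∀ x, ¬ IsIntegral (hθ.address x) → q x = x
  zero : ∀ u ∈ θ.fixedPts, (q u).1 0 = ψ (u.1 κ)
  inj : ∀ u ∈ θ.fixedPts, ∀ v ∈ θ.fixedPts, ψ (u.1 κ) = ψ (v.1 κ) → u.1 κ = v.1 κ

theorem IsCoproj.apply_eq_iff {hθ : θ.IsAdmissible} {κ : ℤ} {ψ : A → A} {q : θ.X → θ.X}
    (hq : IsCoproj e hθ κ ψ q) (he : θ.IsMinimalIdempotent e) [Nonempty A] {u v : θ.X}
    (hu : u ∈ θ.fixedPts) (hv : v ∈ θ.fixedPts) : q u = q v ↔ u.1 κ = v.1 κ := by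
  constructor
  · intro h
    apply hq.inj u hu v hv
    rw [← hq.zero u hu, ← hq.zero v hv, h]
  · intro h
    refine he.ext_zero hθ (hθ.maps_fixed hq.address hu) (hθ.maps_fixed hq.address hv)
      (hq.e_apply u) (hq.e_apply v) ?_
    rw [hq.zero u hu, hq.zero v hv, h]

/-- The idempotent `(b, a) ↦ (b, i⁻¹ b)` onto the graph of `e` reads `b`, but writes `i⁻¹ b` at `0`.
Replacing this letter by `φ b` is a permutation of `e Fix(θ)`, realised because all permutations are
local; hence every `φ` is allowed. -/
theorem exists_coproj_minus (hθ : θ.IsAdmissible) [Nonempty A] (he : θ.IsMinimalIdempotent e)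
    (hfull : θ.NormalClosureFull e) {φ : A → A} (hφ : φ ∈ θ.H θ.ePlus θ.eMinus) :
    ∃ q, IsCoproj e hθ (-1) φ q := by
  obtain ⟨i, hi, hgr, hsurj⟩ := he.exists_graph hθ
  obtain ⟨d, hd, hdd, hdfix⟩ := hθ.exists_proj_minus hi
  have hadd := hθ.address_idem hd hdd
  have hed : ∀ u ∈ θ.fixedPts, e (d u) = d u := fun u hu => by
    have hdu := hθ.maps_fixed hadd hu
    obtain ⟨v, hv, hev, hv0⟩ := hsurj _ (fixedPts_zero hdu)
    have h1 := hgr v hv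
    rw [hev, hv0, (hdfix u hu).2, ← (hdfix u hu).1] at h1
    rw [← fixedPts_ext hθ.two_le hv hdu hv0 h1, hev]
  have hφplus : ∀ b, θ.ePlus (φ b) = φ b := congrFun (H.comp_left hθ.ePlus_comp hφ)
  have hφinj : ∀ u ∈ θ.fixedPts, ∀ v ∈ θ.fixedPts, φ (u.1 (-1)) = φ (v.1 (-1)) →
      u.1 (-1) = v.1 (-1) := fun u hu v hv h =>
    hθ.simp.injOn (H.sgp θ.sgp_ePlus θ.sgp_eMinus hφ) θ.sgp_eMinus ⟨_, fixedPts_neg_one hu⟩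
      ⟨_, fixedPts_neg_one hv⟩ h
  choose s hs hes hs0 using fun w : ↥(e '' θ.fixedPts) => hsurj _ (hφplus ((w : θ.X).1 (-1)))
  obtain ⟨w, hw, hw1, hw2, hwadd⟩ := exists_localPerm he hθ hfull
    (fun w => ⟨s w, (he.mem_image hθ).mpr ⟨hs w, hes w⟩⟩) fun x y hxy => by
      have h1 : s x = s y := congrArg Subtype.val hxy
      obtain ⟨hx, hex⟩ := (he.mem_image hθ).mp x.2
      obtain ⟨hy, hey⟩ := (he.mem_image hθ).mp y.2
      have h2 := hφinj _ hx _ hy (by rw [← hs0, ← hs0, h1])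
      have hgx := hgr _ hx
      have hgy := hgr _ hy
      rw [hex] at hgx
      rw [hey] at hgy
      refine Subtype.ext (fixedPts_ext hθ.two_le hx hy ?_ h2)
      exact hθ.I_injective hi (fixedPts_zero hx) (fixedPts_zero hy) (by rw [← hgx, ← hgy, h2])
  obtain ⟨hwE, hew, -⟩ := he.mem_structureGroup.mp hw
  refine ⟨w ∘ d, ellis_comp hwE hd, fun x => hew _, fun x => (hwadd _).trans (hadd x),
    fun x hx => ?_, fun u hu => ?_, hφinj⟩
  · simp only [Function.comp, hθ.idem_apply hd hdd hx, hw2 x hx]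
  · have h1 := hw1 ⟨d u, (he.mem_image hθ).mpr ⟨hθ.maps_fixed hadd hu, hed u hu⟩⟩
    simp only at h1
    simp only [Function.comp, h1, hs0, (hdfix u hu).1]

theorem IsProj.isCoproj {i : A → A} {p : θ.X → θ.X} (hp : IsProj θ i p)
    (he : θ.IsMinimalIdempotent e) (hθ : θ.IsAdmissible) [Nonempty A]
    (hgr : ∀ u ∈ θ.fixedPts, (e u).1 (-1) = i ((e u).1 0))
    (hsurj : ∀ a, θ.ePlus a = a → ∃ v ∈ θ.fixedPts, e v = v ∧ v.1 0 = a) :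
    IsCoproj e hθ 0 id p :=
  ⟨hp.mem, hp.e_apply he hθ hgr hsurj, hθ.address_idem hp.mem hp.idem,
    fun _ hx => hθ.idem_apply hp.mem hp.idem hx, hp.zero, fun _ _ _ _ h => h⟩

/-- The restriction of a factor to the range of `e` is invertible. -/
theorem IsCoproj.exists_section {hθ : θ.IsAdmissible} {κ : ℤ} {ψ : A → A} {q : θ.X → θ.X}
    (hq : IsCoproj e hθ κ ψ q) (he : θ.IsMinimalIdempotent e) :
    ∃ k ∈ θ.structureGroup e, (∀ x, q (k x) = e x) ∧ (∀ x, k (q (e x)) = e x) ∧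
      ∀ x, hθ.address (k x) = hθ.address x := by
  have hmem : q ∘ e ∈ θ.structureGroup e := he.mem_structureGroup.mpr
    ⟨ellis_comp hq.mem he.mem, fun x => hq.e_apply _, fun x => congrArg q (he.apply_apply x)⟩
  obtain ⟨k, hk, h1, h2⟩ := he.exists_inverse hmem
  have hek := (he.mem_structureGroup.mp hk).2.1
  refine ⟨k, hk, fun x => ?_, congrFun h2, fun x => ?_⟩
  · rw [← congrFun h1 x]
    simp only [Function.comp, hek]
  · have := he.translation_inverse hθ (ξ := 0) (f := q ∘ e)
      (fun x => by simp only [Function.comp, hq.address, he.address hθ, add_zero]) h1 x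
    rwa [sub_zero] at this

/-- An element of the Ellis semigroup of the type of `q` factors through `q`. -/
theorem IsCoproj.apply_section {hθ : θ.IsAdmissible} {κ : ℤ} {ψ : A → A} {q k : θ.X → θ.X}
    (hq : IsCoproj e hθ κ ψ q) (he : θ.IsMinimalIdempotent e) [Nonempty A]
    (hk : k ∈ θ.structureGroup e) (hqk : ∀ x, q (k x) = e x) (hkq : ∀ x, k (q (e x)) = e x)
    (hkadd : ∀ x, hθ.address (k x) = hθ.address x) {f : θ.X → θ.X} (hf : f ∈ θ.ellis)
    (hdep : θ.DependsOn κ f) : f ∘ k ∘ q = f := by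
  have hkE := (he.mem_structureGroup.mp hk).1
  refine eq_of_eq_on hθ (ellis_comp hf (ellis_comp hkE hq.mem)) hf (fun u hu => ?_) fun x hx => ?_
  · have hkq' : k (q u) ∈ θ.fixedPts := hθ.maps_fixed hkadd (hθ.maps_fixed hq.address hu)
    refine (hdep _ hkq' _ hu).mpr ((hq.apply_eq_iff he hkq' hu).mp ?_)
    rw [hqk, hq.e_apply]
  · have h1 := hkq x
    rw [hθ.idem_apply he.mem he.idem hx] at h1
    simp only [Function.comp, h1]

/-! ### The kernel -/

/-- Non-shifts collapse a pair of fixed points, and this keeps their products with `E` outside the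
shifts. Conversely any ideal contains `e`, because `eEe` is a group, and then every non-shift,
through `f = p e (q f)`. -/
theorem kernel_eq (hθ : θ.IsAdmissible) [Nonempty A] (he : θ.IsMinimalIdempotent e) :
    θ.kernel = θ.ellis \ Set.range θ.shift := by
  have hideal : ∀ f ∈ θ.ellis, ∀ g ∈ θ.ellis \ Set.range θ.shift,
      f ∘ g ∈ θ.ellis \ Set.range θ.shift ∧ g ∘ f ∈ θ.ellis \ Set.range θ.shift := by
    rintro f hf g ⟨hg, hg'⟩
    obtain ⟨u, hu, v, hv, huv, hguv⟩ := hθ.exists_not_injective hg hg'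
    refine ⟨⟨ellis_comp hf hg, not_shift_of_apply_eq huv (congrArg f hguv)⟩,
      ellis_comp hg hf, ?_⟩
    by_cases hfs : f ∈ Set.range θ.shift
    · obtain ⟨n, rfl⟩ := hfs
      rintro ⟨m, hm⟩
      refine hg' ⟨m - n, funext fun x => ?_⟩
      have := congrFun hm (θ.shift (-n) x)
      simp only [Function.comp, shift_shift, add_neg_cancel, shift_zero] at this
      rw [← this, sub_eq_add_neg]
    · obtain ⟨u, hu, v, hv, huv, hfuv⟩ := hθ.exists_not_injective hf hfs
      exact not_shift_of_apply_eq huv (congrArg g hfuv)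
  apply Set.Subset.antisymm
  · exact Set.sInter_subset_of_mem ⟨Set.sdiff_subset, ⟨e, he.mem, he.not_shift hθ⟩, hideal⟩
  · rintro f ⟨hf, hf'⟩ J ⟨hJE, ⟨j, hj⟩, hJ⟩
    have hg0 : e ∘ j ∘ e ∈ θ.structureGroup e := ⟨j, hJE hj, rfl⟩
    obtain ⟨g', hg', -, h1⟩ := he.exists_inverse hg0
    have heJ : e ∈ J := by
      rw [← h1]
      exact (hJ _ (he.mem_structureGroup.mp hg').1 _
        (hJ e he.mem _ (hJ e he.mem j hj).2).1).1
    obtain ⟨i₀, hi₀, hgr, hsurj⟩ := he.exists_graph hθ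
    obtain ⟨i, hi, hgi⟩ := hθ.exists_graph hf hf'
    obtain ⟨p, hp⟩ := exists_isProj hθ hi
    obtain ⟨q, hq⟩ := exists_isProj hθ hi₀
    have hfact : p ∘ (e ∘ (q ∘ f)) = f := funext fun x => by
      simp only [Function.comp, hq.e_apply he hθ hgr hsurj, hp.comp_eq hq hθ hf hgi]
    rw [← hfact]
    exact (hJ p hp.mem _ (hJ _ (ellis_comp hq.mem hf) e heJ).2).1

end Main

end EllisQB

/-! ### The matrix semigroup and its isomorphism with the kernel. -/

namespace EllisQB

section Matrix

variable {A : Type u} {ℓ : ℕ} [NeZero ℓ] {θ : Subst A ℓ}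
variable [TopologicalSpace A] [DiscreteTopology A] [Finite A]
variable {e : θ.X → θ.X}

open Subst

/-! ### The matrix semigroup -/

theorem ellis_eq_kernel_union (hθ : θ.IsAdmissible) [Nonempty A] (he : θ.IsMinimalIdempotent e) :
    θ.ellis = θ.kernel ∪ Set.range θ.shift := by
  rw [kernel_eq hθ he, Set.sdiff_union_of_subset]
  rintro _ ⟨n, rfl⟩
  exact θ.shift_mem_ellis n

theorem shift_injective (hθ : θ.IsAdmissible) [Nonempty A] : Function.Injective θ.shift := by
  intro n m hnm
  obtain ⟨x⟩ := hθ.nonempty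
  by_contra hne
  refine hθ.aper (θ.shift m x) (n - m) (sub_ne_zero.mpr hne) ?_
  rw [shift_shift, sub_add_cancel, congrFun hnm x]

/-- The entries of the sandwich matrix. -/
theorem IsCoproj.exists_isExtension {hθ : θ.IsAdmissible} [Nonempty A] {κ : ℤ} {ψ i : A → A}
    {p q : θ.X → θ.X} (hq : IsCoproj e hθ κ ψ q) (hp : IsProj θ i p)
    (he : θ.IsMinimalIdempotent e) {a : A → A}
    (ha : ∀ u ∈ θ.fixedPts, ψ ((p u).1 κ) = a (u.1 0)) :
    ∃ t : Cov e hθ.address, t.toMap = q ∘ p ∘ e ∧ IsExtension a t := by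
  have hmem : q ∘ p ∘ e ∈ θ.structureGroup e := he.mem_structureGroup.mpr
    ⟨ellis_comp hq.mem (ellis_comp hp.mem he.mem), fun x => hq.e_apply _,
      fun x => by simp only [Function.comp, he.apply_apply]⟩
  obtain ⟨t, ht⟩ := Cov.exists_toMap_eq he hθ hmem
  have happ : ∀ η (x : fib e hθ.address η), (t.toEquiv η x : θ.X) = q (p x) := fun η x => by
    rw [← t.toMap_apply he, ht]
    simp only [Function.comp, ((mem_fib he hθ).mp x.2).2]
  refine ⟨t, ht, ?_, fun x => ?_, fun η hη x => ?_⟩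
  · obtain ⟨x⟩ := hθ.nonempty
    have h := t.address_toMap he x
    rw [ht] at h
    simp only [Function.comp, hq.address, hθ.address_idem hp.mem hp.idem, he.address hθ] at h
    exact (left_eq_add.mp h)
  · have hx := (hθ.address_eq_zero_iff _).mp ((mem_fib he hθ).mp x.2).1
    rw [happ, hq.zero _ (hp.maps_fixed hθ hx), ha _ hx]
  · have hx : ¬ IsIntegral (hθ.address (x : θ.X)) := by
      rwa [((mem_fib he hθ).mp x.2).1, ← mem_autOrbit_iff hθ]
    rw [happ, hθ.idem_apply hp.mem hp.idem hx, hq.off _ hx]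

/-- Projections cancel on the range of `e`. -/
theorem IsProj.apply_e {i₀ i : A → A} {p r : θ.X → θ.X} (hr : IsProj θ i₀ r)
    (hp : IsProj θ i p) (he : θ.IsMinimalIdempotent e) (hθ : θ.IsAdmissible)
    (hgr : ∀ u ∈ θ.fixedPts, (e u).1 (-1) = i₀ ((e u).1 0)) {x : θ.X} (hx : e x = x) :
    r (p x) = x := by
  have := hr.comp_eq hp hθ he.mem (fun y hy => by
    have := hgr _ ((hθ.address_eq_zero_iff _).mp hy)
    rwa [he.apply_apply] at this) x
  rwa [hx] at this

/-- The Rees factorization of the elements of the kernel. -/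
theorem IsCoproj.exists_factorization {hθ : θ.IsAdmissible} [Nonempty A] {κ : ℤ}
    {ψ i₀ i : A → A} {p q r f : θ.X → θ.X} (hq : IsCoproj e hθ κ ψ q) (hp : IsProj θ i p)
    (hr : IsProj θ i₀ r) (her : ∀ x, e (r x) = r x) (he : θ.IsMinimalIdempotent e)
    (hf : f ∈ θ.ellis) (hgr : ∀ y, hθ.address (f y) = 0 → (f y).1 (-1) = i ((f y).1 0))
    (hdep : θ.DependsOn κ f) : ∃ g ∈ θ.structureGroup e, p ∘ g ∘ q = f := by
  obtain ⟨k, hk, hqk, hkq, hkadd⟩ := hq.exists_section he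
  obtain ⟨hkE, -, hke⟩ := he.mem_structureGroup.mp hk
  refine ⟨r ∘ f ∘ k, he.mem_structureGroup.mpr ⟨ellis_comp hr.mem (ellis_comp hf hkE),
    fun x => her _, fun x => by simp only [Function.comp, hke]⟩, funext fun x => ?_⟩
  have := congrFun (hq.apply_section he hk hqk hkq hkadd hf hdep) x
  simp only [Function.comp, hp.comp_eq hr hθ hf hgr] at this ⊢
  exact this

/-- The data of the Rees factorization of the kernel: the elements of the kernel are the maps
`p i ∘ g ∘ q l` with `g` in the structure group. -/
structure ReesData (e : θ.X → θ.X) (hθ : θ.IsAdmissible) (φ : A → A) where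
  i₀ : A → A
  p : θ.I → θ.X → θ.X
  q : Side → θ.X → θ.X
  r : θ.X → θ.X
  graph : ∀ u ∈ θ.fixedPts, (e u).1 (-1) = i₀ ((e u).1 0)
  surj : ∀ a, θ.ePlus a = a → ∃ v ∈ θ.fixedPts, e v = v ∧ v.1 0 = a
  proj : ∀ i, IsProj θ i.1 (p i)
  base : IsProj θ i₀ r
  coproj_plus : IsCoproj e hθ 0 id (q Side.plus)
  coproj_minus : IsCoproj e hθ (-1) φ (q Side.minus)

theorem ReesData.exists (hθ : θ.IsAdmissible) [Nonempty A] (he : θ.IsMinimalIdempotent e)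
    (hfull : θ.NormalClosureFull e) {φ : A → A} (hφ : φ ∈ θ.H θ.ePlus θ.eMinus) :
    Nonempty (ReesData e hθ φ) := by
  obtain ⟨i₀, hi₀, hgr, hsurj⟩ := he.exists_graph hθ
  obtain ⟨r, hr⟩ := exists_isProj hθ hi₀
  obtain ⟨q, hq⟩ := exists_coproj_minus hθ he hfull hφ
  choose p hp using fun i : θ.I => exists_isProj hθ i.2
  exact ⟨⟨i₀, p, fun l => Side.rec r q l, r, hgr, hsurj, hp, hr, hr.isCoproj he hθ hgr hsurj, hq⟩⟩

/-- The letter map by which the elements of type `l` act. -/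
def Side.letterMap (φ : A → A) : Side → A → A
  | Side.plus => id
  | Side.minus => φ

namespace ReesData

variable {hθ : θ.IsAdmissible} {φ : A → A} (D : ReesData e hθ φ)

theorem coproj : ∀ l, IsCoproj e hθ l.pos (l.letterMap φ) (D.q l)
  | Side.plus => D.coproj_plus
  | Side.minus => D.coproj_minus

theorem exists_isExtension [Nonempty A] (he : θ.IsMinimalIdempotent e) (l : Side) (i : θ.I) :
    ∃ t : Cov e hθ.address, t.toMap = D.q l ∘ D.p i ∘ e ∧ IsExtension (θ.matA φ l i) t := by
  refine (D.coproj l).exists_isExtension (D.proj i) he fun u hu => ?_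
  cases l
  · exact ((D.proj i).zero u hu).trans (fixedPts_zero hu).symm
  · exact congrArg φ ((D.proj i).neg_one u hu)

/-- The map `(i, g, l) ↦ p i ∘ g ∘ q l`. -/
noncomputable def toMap {M : Side → θ.I → Cov e hθ.address} (a : Rees M) : θ.X → θ.X :=
  D.p a.i ∘ a.g.toMap ∘ D.q a.l

variable {M : Side → θ.I → Cov e hθ.address}

theorem toMap_mul (he : θ.IsMinimalIdempotent e)
    (hM : ∀ l i, (M l i).toMap = D.q l ∘ D.p i ∘ e) (a b : Rees M) :
    D.toMap (a * b) = D.toMap a ∘ D.toMap b := by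
  have h : (a.g * M a.l b.i * b.g).toMap =
      a.g.toMap ∘ D.q a.l ∘ D.p b.i ∘ b.g.toMap := by
    rw [Cov.toMap_mul he, Cov.toMap_mul he, hM]
    funext x
    simp only [Function.comp, ((mem_fib he hθ).mp (b.g.toMap_mem_fib x)).2]
  show D.p a.i ∘ (a.g * M a.l b.i * b.g).toMap ∘ D.q b.l = _
  rw [h]
  rfl

/-- `r` restores the graph of `e`, hence inverts every `p i` on the range of `e` and strips the
index. -/
theorem base_toMap (he : θ.IsMinimalIdempotent e) (a : Rees M) (x : θ.X) :
    D.r (D.toMap a x) = a.g.toMap (D.q a.l x) :=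
  D.base.apply_e (D.proj a.i) he hθ D.graph ((mem_fib he hθ).mp (a.g.toMap_mem_fib _)).2

theorem toMap_apply_eq_iff [Nonempty A] (he : θ.IsMinimalIdempotent e)
    (hfull : θ.NormalClosureFull e) (a : Rees M) {u v : θ.X} (hu : u ∈ θ.fixedPts)
    (hv : v ∈ θ.fixedPts) : D.toMap a u = D.toMap a v ↔ u.1 a.l.pos = v.1 a.l.pos := by
  rw [← (D.coproj a.l).apply_eq_iff he hu hv]
  constructor
  · intro h
    have h1 := congrArg D.r h
    rw [D.base_toMap he, D.base_toMap he] at h1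
    have h2 := he.eq_of_apply_eq (a.g.toMap_mem he hfull) h1
    rwa [(D.coproj a.l).e_apply, (D.coproj a.l).e_apply] at h2
  · intro h
    simp only [toMap, Function.comp, h]

theorem range_toMap [Nonempty A] (he : θ.IsMinimalIdempotent e) (hfull : θ.NormalClosureFull e) :
    Set.range (D.toMap : Rees M → θ.X → θ.X) = θ.kernel := by
  rw [kernel_eq hθ he]
  apply Set.Subset.antisymm
  · rintro _ ⟨a, rfl⟩
    refine ⟨ellis_comp (D.proj a.i).mem (ellis_comp
      (he.mem_structureGroup.mp (a.g.toMap_mem he hfull)).1 (D.coproj a.l).mem), ?_⟩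
    have hpair : ∃ u ∈ θ.fixedPts, ∃ v ∈ θ.fixedPts, u ≠ v ∧ u.1 a.l.pos = v.1 a.l.pos := by
      cases a.l
      · exact hθ.exists_fixed_pair_right
      · exact hθ.exists_fixed_pair_left
    obtain ⟨u, hu, v, hv, huv, h⟩ := hpair
    exact not_shift_of_apply_eq huv ((D.toMap_apply_eq_iff he hfull a hu hv).mpr h)
  · rintro f ⟨hf, hf'⟩
    obtain ⟨i, hi, hgr⟩ := hθ.exists_graph hf hf'
    obtain ⟨l, hl⟩ : ∃ l : Side, θ.DependsOn l.pos f := by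
      rcases hθ.dependsOn hf hf' with h | h
      · exact ⟨Side.plus, h⟩
      · exact ⟨Side.minus, h⟩
    obtain ⟨g, hg, rfl⟩ := (D.coproj l).exists_factorization (D.proj ⟨i, hi⟩) D.base
      (D.base.e_apply he hθ D.graph D.surj) he hf hgr hl
    obtain ⟨c, rfl⟩ := Cov.exists_toMap_eq he hθ hg
    exact ⟨⟨⟨i, hi⟩, c, l⟩, rfl⟩

/-- A pair of fixed points equal at `0` and distinct at `-1` is collapsed by the elements of type
`+` and separated by those of type `-`. -/
theorem side_eq [Nonempty A] (he : θ.IsMinimalIdempotent e) (hfull : θ.NormalClosureFull e)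
    {a b : Rees M} (h : D.toMap a = D.toMap b) : a.l = b.l := by
  have hiff : ∀ u ∈ θ.fixedPts, ∀ v ∈ θ.fixedPts,
      (u.1 a.l.pos = v.1 a.l.pos ↔ u.1 b.l.pos = v.1 b.l.pos) := fun u hu v hv => by
    rw [← D.toMap_apply_eq_iff he hfull a hu hv, ← D.toMap_apply_eq_iff he hfull b hu hv, h]
  obtain ⟨u, hu, v, hv, huv, h0⟩ := hθ.exists_fixed_pair_right
  have h1 : u.1 (-1) ≠ v.1 (-1) := fun h1 => huv (fixedPts_ext hθ.two_le hu hv h0 h1)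
  have := hiff u hu v hv
  revert this
  cases a.l <;> cases b.l <;> simp [Side.pos, h0, h1]

/-- As `g` and `q` can be inverted on the range of `e`, an element of index `i` attains the fixed
point `(i c, c)` for every `c` in the range of `e₊`. Its values in `Fix(θ)` lie on one graph only,
and elements of `I_θ` are determined on that range. -/
theorem index_eq [Nonempty A] (he : θ.IsMinimalIdempotent e) (hfull : θ.NormalClosureFull e)
    {a b : Rees M} (h : D.toMap a = D.toMap b) : a.i = b.i := by
  have hplus : ∀ c, θ.ePlus c = c → a.i.1 c = b.i.1 c := by
    intro c hc
    obtain ⟨w, hw, hew, rfl⟩ := D.surj c hc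
    obtain ⟨g', hg', hgg', -⟩ := he.exists_inverse (a.g.toMap_mem he hfull)
    obtain ⟨k, hk, hqk, -, -⟩ := (D.coproj a.l).exists_section he
    have h1 : D.toMap a (k (g' w)) = D.p a.i w := by
      have := congrFun hgg' w
      simp only [Function.comp, hew] at this
      simp only [toMap, Function.comp, hqk, (he.mem_structureGroup.mp hg').2.1, this]
    have h2 : D.p b.i (b.g.toMap (D.q b.l (k (g' w)))) = D.p a.i w := by
      rw [← h1, h]
      rfl
    set z := b.g.toMap (D.q b.l (k (g' w)))
    have hz : z ∈ θ.fixedPts := by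
      have h3 := congrArg hθ.address h2
      rw [hθ.address_idem (D.proj _).mem (D.proj _).idem,
        hθ.address_idem (D.proj _).mem (D.proj _).idem, (hθ.address_eq_zero_iff w).mpr hw] at h3
      exact (hθ.address_eq_zero_iff z).mp h3
    have h0 := (D.proj b.i).zero z hz
    have hm := (D.proj b.i).neg_one z hz
    rw [h2, (D.proj a.i).zero w hw] at h0
    rw [h2, (D.proj a.i).neg_one w hw, ← h0] at hm
    exact hm
  refine Subtype.ext (funext fun c => ?_)
  rw [← (hθ.I_props a.i.2).2.1 c, ← (hθ.I_props b.i.2).2.1 c]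
  exact hplus _ (hθ.ePlus_idem c)

theorem toMap_injective [Nonempty A] (he : θ.IsMinimalIdempotent e)
    (hfull : θ.NormalClosureFull e) : Function.Injective (D.toMap : Rees M → θ.X → θ.X) := by
  intro a b h
  have hl := D.side_eq he hfull h
  have hi := D.index_eq he hfull h
  obtain ⟨i, g, l⟩ := a
  obtain ⟨j, g', m⟩ := b
  obtain rfl : i = j := hi
  obtain rfl : l = m := hl
  obtain ⟨k, hk, hqk, -, -⟩ := (D.coproj l).exists_section he
  have hg : g = g' := by
    refine Cov.toMap_injective he (funext fun z => ?_)
    have h1 := congrArg D.r (congrFun h (k z))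
    rw [D.base_toMap he, D.base_toMap he] at h1
    simp only [hqk, (he.mem_structureGroup.mp (g.toMap_mem he hfull)).2.2,
      (he.mem_structureGroup.mp (g'.toMap_mem he hfull)).2.2] at h1
    exact h1
  rw [hg]

theorem toMap_shift_mul [Nonempty A] (he : θ.IsMinimalIdempotent e)
    (hfull : θ.NormalClosureFull e) {n : ℤ} {s : Cov e hθ.address}
    (hs : s.toMap = θ.shift n ∘ e) (i : θ.I) (g : Cov e hθ.address) (l : Side) :
    D.toMap (⟨i, s * g, l⟩ : Rees M) = θ.shift n ∘ D.toMap (⟨i, g, l⟩ : Rees M) ∧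
      D.toMap (⟨i, s * g, l⟩ : Rees M) = D.toMap (⟨i, g, l⟩ : Rees M) ∘ θ.shift n := by
  have h1 : D.toMap (⟨i, s * g, l⟩ : Rees M) = θ.shift n ∘ D.toMap (⟨i, g, l⟩ : Rees M) := by
    funext x
    simp only [toMap, Cov.toMap_mul he, hs, Function.comp, ellis_comm (D.proj i).mem,
      ((mem_fib he hθ).mp (g.toMap_mem_fib _)).2]
  refine ⟨h1, h1.trans (funext fun x => ?_)⟩
  simp only [toMap, Function.comp, ellis_comm (D.coproj l).mem, ellis_comm (D.proj i).mem,
    ellis_comm (he.mem_structureGroup.mp (g.toMap_mem he hfull)).1]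

end ReesData

theorem exists_shift_cov (hθ : θ.IsAdmissible) (he : θ.IsMinimalIdempotent e) (n : ℤ) :
    ∃ s : Cov e hθ.address, s.toMap = θ.shift n ∘ e := by
  refine Cov.exists_toMap_eq he hθ (he.mem_structureGroup.mpr
    ⟨ellis_comp (θ.shift_mem_ellis n) he.mem, fun x => ?_, fun x => ?_⟩)
  · simp only [Function.comp, ellis_comm he.mem, he.apply_apply]
  · simp only [Function.comp, he.apply_apply]

end Matrix

end EllisQB
theorem mainTheorem5 {A : Type u} [Finite A] [Nonempty A] [TopologicalSpace A]
    [DiscreteTopology A] {ℓ : ℕ} [NeZero ℓ] (hℓ : 2 ≤ ℓ) (θ : Subst A ℓ)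
    (hprim : θ.IsPrimitive) (haper : θ.IsAperiodic) (hqb : θ.IsQuasiBijective)
    (hsimp : θ.IsSimplified) (e : θ.X → θ.X) (he : θ.IsMinimalIdempotent e)
    (hfull : θ.NormalClosureFull e) :
    -- `E(X_θ)` is the disjoint union of its kernel and of `ℤ`
    (θ.ellis = θ.kernel ∪ Set.range θ.shift ∧ Disjoint θ.kernel (Set.range θ.shift) ∧
      Function.Injective θ.shift) ∧
    -- the maximal equicontinuous factor, normalised at the fixed points
    ∃ (h : ℕ) (π : θ.X → Odometer ℓ h), 0 < h ∧ h < ℓ ∧ h.Coprime ℓ ∧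
      θ.IsMEF (Odometer.act ℓ h) π ∧ π ⁻¹' {0} = θ.fixedPts ∧
      (∀ η, η ∈ autOrbit π ↔ IsSingular π η) ∧
      -- the structure group of the kernel is the group of all covariant functions
      (∃ R : Cov e π → (θ.X → θ.X), Function.Injective R ∧ Set.range R = θ.structureGroup e ∧
        (∀ g g', R (g * g') = R g ∘ R g') ∧ ∀ g η (x : fib e π η), R g x = g.toEquiv η x) ∧
      -- the kernel is the matrix semigroup
      ∀ φ ∈ θ.H θ.ePlus θ.eMinus, ∃ M : Side → θ.I → Cov e π,
        (∀ l i, IsExtension (θ.matA φ l i) (M l i)) ∧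
        ∃ Ψ : Rees M → (θ.X → θ.X), Function.Injective Ψ ∧ Set.range Ψ = θ.kernel ∧
          (∀ a b, Ψ (a * b) = Ψ a ∘ Ψ b) ∧
          ∀ n : ℤ, ∃ s : Cov e π, (∀ η (x : fib e π η), (s.toEquiv η x : θ.X) = θ.shift n x) ∧
            ∀ i g l, Ψ ⟨i, s * g, l⟩ = θ.shift n ∘ Ψ ⟨i, g, l⟩ ∧
              Ψ ⟨i, s * g, l⟩ = Ψ ⟨i, g, l⟩ ∘ θ.shift n := by
  have hθ : θ.IsAdmissible := ⟨hℓ, hprim, haper, hsimp⟩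
  -- The hypothesis on the normal closure forces height `1`: no equicontinuous factor separates
  -- fixed points.
  refine ⟨⟨ellis_eq_kernel_union hθ he, ?_, shift_injective hθ⟩, 1, hθ.address, one_pos, hℓ,
    Nat.coprime_one_left ℓ, isMEF hθ he hfull, ?_, fun η => ?_, ?_, fun φ hφ => ?_⟩
  · rw [kernel_eq hθ he]
    exact Set.disjoint_sdiff_left
  · ext x
    exact hθ.address_eq_zero_iff x
  · rw [mem_autOrbit_iff hθ, isSingular_iff hθ]
  · refine ⟨Cov.toMap, Cov.toMap_injective he, ?_, Cov.toMap_mul he, fun g => g.toMap_apply he⟩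
    apply Set.Subset.antisymm
    · rintro _ ⟨g, rfl⟩
      exact g.toMap_mem he hfull
    · exact fun f hf => Cov.exists_toMap_eq he hθ hf
  · obtain ⟨D⟩ := ReesData.exists hθ he hfull hφ
    choose M hM hext using D.exists_isExtension he
    refine ⟨M, hext, D.toMap, D.toMap_injective he hfull, D.range_toMap he hfull,
      D.toMap_mul he hM, fun n => ?_⟩
    obtain ⟨s, hs⟩ := exists_shift_cov hθ he n
    refine ⟨s, fun η x => ?_, fun i g l => D.toMap_shift_mul he hfull hs i g l⟩
    rw [← s.toMap_apply he, hs]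
    simp only [Function.comp, ((mem_fib he hθ).mp x.2).2]
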